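/- Fix a finite alphabet $\Sigma$ and a set of variables. A span of a document $d\in\Sigma^*$ is $[i,j\rangle$ with $1\le i\le j\le |d|+1$. For a commutative semiring $\mathbb K$, a $\mathbb K$-annotator $S$ consists of a finite set $V$ of variables and a map that assigns to every document $d$ a function $S(d)$ from the $V$-tuples of spans of $d$ to $\mathbb K$; $\mathbf t\in S(d)$ means $S(d)(\mathbf t)\neq 0$. A document spanner is an annotator over the Boolean semiring $\mathbb B$. A $\mathbb K$-weighted VSet-automaton with variable set $V$ has a finite set of states, initial and final weights of its states, and transition weights $\delta(p,o,q)\in\mathbb K$, where $o$ is a letter, $\varepsilon$, or an operation that opens or closes a variable $v\in V$; there are no cycles of $\varepsilon$-transitions of nonzero weight. A run on $d$ is a sequence of transitions of nonzero weight that reads $d$, from a state of nonzero initial weight to a state of nonzero final weight. It is valid if every $v\in V$ is opened exactly once and closed exactly once, and closed after it is opened; a valid run $\rho$ defines the tuple $\mathbf t_\rho$ that maps $v$ to the span between the positions where $v$ is opened and closed. The weight of a run is the product of the initial weight, the transition weights and the final weight, and $A(d)(\mathbf t)$ is the sum of the weights of the valid runs $\rho$ of $A$ on $d$ with nonzero weight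 and $\mathbf t_\rho=\mathbf t$. An annotator is regular if it equals $(d,\mathbf t)\mapsto A(d)(\mathbf t)$ for some weighted VSet-automaton $A$ over the same semiring. $A$ is functional if all its runs are valid, and unambiguous if every $\mathbf t$ with $A(d)(\mathbf t)\ne0$ equals $\mathbf t_\rho$ for exactly one valid run $\rho$ of $A$ on $d$ with nonzero weight. The size of $A$ is its number of states plus its number of transitions (triples with $\delta(p,o,q)\neq 0$). A soft spanner is a triple $Q=(P,\mathfrak S,w)$ of a document spanner $P$, a finite set $\mathfrak S$ of document spanners, and a function $w:\mathfrak S\to\mathbb R$. For a document $d$ and $\mathbf t\in P(d)$ let $$\hat Q(d,\mathbf t)=\exp\Bigl(\sum_{S\in\mathfrak S}\ \sum_{\mathbf t'} w(S)\Bigr),$$ where $\mathbf t'$ ranges over the tuples in $S(d)$ that agree with $\mathbf t$ on all common variables. **Theorem.** Let $Q=(P,\mathfrak S,w)$ be a soft spanner such that $P$ and every $S\in\mathfrak S$ is regular. Then there is an $\mathbb R$-weighted VSet-automaton $A$, whose variables are those of $P$, such that for every document $d$ and every tuple $\mathbf t$ of spans of $d$ over the variables of $P$: $A(d)(\mathbf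 t)=\log\hat Q(d,\mathbf t)$ if $\mathbf t\in P(d)$, and $A(d)(\mathbf t)=0$ if $\mathbf t\notin P(d)$. Moreover, such an $A$ can be constructed in polynomial time if the spanners of $Q$ are given by unambiguous functional $\mathbb B$-weighted VSet-automata. That is, there are one program and one polynomial $p$ (for the fixed alphabet and set of variables) such that, for every soft spanner $Q$ and every representation of its spanners by unambiguous functional automata (given as lists of variables, states, initial and final states and transitions, together with the weights $w(S)$), the program stops after at most $p(N)$ steps and outputs a list representation of such an automaton $A$ with at most $p(N)$ listed states and transitions. Here $N$ is the sum of the sizes of the automata for $P$ and for all $S\in\mathfrak S$, plus $|\mathfrak S|$. Programs work on pairs whose components are pairs, natural numbers (such as the names of states, variables and letters) or real numbers. One step is a construction or inspection of a pair, an addition, truncated subtraction or comparison of natural numbers, an addition or multiplication of real numbers, a constant, a branch, or a function call. -/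

import Mathlib

/-! ## The Boolean semiring -/

/-- The Boolean semiring `({false, true}, or, and, false, true)`.  (A type of its own, because
Mathlib's ring structure on `Bool` has exclusive or as its addition.) -/
def BoolSR : Type := Bool

namespace BoolSR

instance : DecidableEq BoolSR := inferInstanceAs (DecidableEq Bool)
instance : Fintype BoolSR := inferInstanceAs (Fintype Bool)

instance : Zero BoolSR := ⟨false⟩
instance : One BoolSR := ⟨true⟩
instance : Add BoolSR := ⟨or⟩
instance : Mul BoolSR := ⟨and⟩

instance : CommSemiring BoolSR where
  add_assoc := by decide
  zero_add := by decide
  add_zero := by decide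
  add_comm := by decide
  mul_assoc := by decide
  one_mul := by decide
  mul_one := by decide
  mul_comm := by decide
  left_distrib := by decide
  right_distrib := by decide
  zero_mul := by decide
  mul_zero := by decide
  nsmul := nsmulRec
  nsmul_zero := fun _ => rfl
  nsmul_succ := fun _ _ => rfl

end BoolSR

/-! ## Documents, spans, tuples, annotators -/

/-- The spans `[i, j⟩`, `1 ≤ i ≤ j ≤ |d| + 1`, of a document `d`; the pair `p` stands for the span
with `i = p.1 + 1` and `j = p.2 + 1`, so `p.1` and `p.2` count the letters before the two ends. -/
abbrev Span {Γ : Type} (d : List Γ) : Type :=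
  {p : Fin (d.length + 1) × Fin (d.length + 1) // p.1 ≤ p.2}

/-- The `V`-tuples with values in the spans of `d`. -/
abbrev SpanTuple {Γ X : Type} (V : Finset X) (d : List Γ) : Type := {x // x ∈ V} → Span d

/-- A `K`-annotator: a finite set of variables, and for every document `d` a `K`-relation over the
spans of `d`.  (There are only finitely many span tuples of `d`, so supports are finite.) -/
structure Annotator (Γ X K : Type) where
  vars : Finset X
  rel : (d : List Γ) → SpanTuple vars d → K

/-- A document spanner is an annotator over the Boolean semiring. -/
abbrev Spanner (Γ X : Type) : Type := Annotator Γ X BoolSR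

/-! ## Weighted VSet-automata -/

/-- Transition labels: letters, `ε`, and the operations that open and close a variable. -/
inductive Label (Γ V : Type) : Type
  | letter (a : Γ)
  | eps
  | opn (v : V)
  | cls (v : V)

namespace Label

variable {Γ V : Type}

/-- The letter that a label reads, if any. -/
def letter? : Label Γ V → Option Γ
  | letter a => some a
  | _ => none

/-- The string that a sequence of labels reads. -/
def reads (ls : List (Label Γ V)) : List Γ := ls.filterMap letter?

/-- Every variable is opened exactly once and closed exactly once, and closed after it is
opened. -/
def Valid (ls : List (Label Γ V)) : Prop :=
  ∀ v : V, ∃ l₁ l₂ l₃ : List (Label Γ V), ls = l₁ ++ opn v :: (l₂ ++ cls v :: l₃) ∧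
    opn v ∉ l₁ ++ l₂ ++ l₃ ∧ cls v ∉ l₁ ++ l₂ ++ l₃

instance [Finite Γ] [Finite V] : Finite (Label Γ V) :=
  Finite.of_surjective
    (fun s : Option Γ ⊕ (V ⊕ V) =>
      match s with
      | .inl (some a) => letter a
      | .inl none => eps
      | .inr (.inl v) => opn v
      | .inr (.inr v) => cls v)
    (by
      rintro (a | _ | v | v)
      · exact ⟨.inl (some a), rfl⟩
      · exact ⟨.inl none, rfl⟩
      · exact ⟨.inr (.inl v), rfl⟩
      · exact ⟨.inr (.inr v), rfl⟩)

end Label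

/-- A `K`-weighted VSet-automaton over the alphabet `Γ` with variable set `V`, without
`ε`-cycles. -/
structure WVSA (Γ : Type) {X : Type} (V : Finset X) (K : Type) [CommSemiring K] where
  Q : Type
  [finQ : Finite Q]
  init : Q → K
  final : Q → K
  δ : Q → Label Γ {x // x ∈ V} → Q → K
  noEpsCycle : ∀ q, ¬ Relation.TransGen (fun p p' => δ p Label.eps p' ≠ 0) q q

attribute [instance] WVSA.finQ

namespace WVSA

variable {Γ X K : Type} {V : Finset X} [CommSemiring K] (A : WVSA Γ V K)

/-- Paths out of a state, as the list of the labels and target states of their steps; every step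
is a transition, i.e. has nonzero weight. -/
def IsPath : A.Q → List (Label Γ {x // x ∈ V} × A.Q) → Prop
  | _, [] => True
  | p, (o, q) :: ρ => A.δ p o q ≠ 0 ∧ IsPath q ρ

/-- The last state of a path. -/
def lastState : A.Q → List (Label Γ {x // x ∈ V} × A.Q) → A.Q
  | p, [] => p
  | _, (_, q) :: ρ => lastState q ρ

/-- The product of the weights of the transitions of a path. -/
def pathWeight : A.Q → List (Label Γ {x // x ∈ V} × A.Q) → K
  | _, [] => 1
  | p, (o, q) :: ρ => A.δ p o q * pathWeight q ρ

/-- The data of a run: the first state, then the label and the target state of every step.  The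
positions `i_j` in the document are determined by the labels. -/
abbrev RunData : Type := A.Q × List (Label Γ {x // x ∈ V} × A.Q)

/-- The sequence of the labels of a run. -/
def labels (ρ : A.RunData) : List (Label Γ {x // x ∈ V}) := ρ.2.map Prod.fst

/-- `ρ` is a run of `A` on the document `d`. -/
def IsRun (d : List Γ) (ρ : A.RunData) : Prop :=
  A.init ρ.1 ≠ 0 ∧ A.IsPath ρ.1 ρ.2 ∧ A.final (A.lastState ρ.1 ρ.2) ≠ 0 ∧
    Label.reads (A.labels ρ) = d

/-- The weight of a run. -/
def weight (ρ : A.RunData) : K :=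
  A.init ρ.1 * A.pathWeight ρ.1 ρ.2 * A.final (A.lastState ρ.1 ρ.2)

/-- The set of the valid and nonzero runs of `A` on `d`. -/
def runs (d : List Γ) : Set A.RunData :=
  {ρ | A.IsRun d ρ ∧ Label.Valid (A.labels ρ) ∧ A.weight ρ ≠ 0}

/-- `t` is the tuple `t_ρ` of the valid run `ρ`: each variable `v` is mapped to the span between
the positions at which `v` is opened and closed. -/
def Selects {d : List Γ} (ρ : A.RunData) (t : SpanTuple V d) : Prop :=
  ∀ v, (∃ l₁ l₂, A.labels ρ = l₁ ++ Label.opn v :: l₂ ∧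
      (Label.reads l₁).length = (t v).1.1) ∧
    (∃ l₁ l₂, A.labels ρ = l₁ ++ Label.cls v :: l₂ ∧
      (Label.reads l₁).length = (t v).1.2)

/-- The weight that `A` gives to the tuple `t` on the document `d`: the sum of the weights of the
valid and nonzero runs `ρ` on `d` with `t_ρ = t`.  The sum is finite by `finite_runs`. -/
noncomputable def sem (d : List Γ) (t : SpanTuple V d) : K :=
  ∑ᶠ (ρ : A.RunData) (_ : ρ ∈ {ρ | ρ ∈ A.runs d ∧ A.Selects ρ t}), A.weight ρ

/-- `A` is functional: all its runs are valid. -/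
def Functional : Prop := ∀ d ρ, A.IsRun d ρ → Label.Valid (A.labels ρ)

/-- `A` is unambiguous: every tuple in the result has exactly one valid and nonzero run. -/
def Unambiguous : Prop :=
  ∀ (d : List Γ) (t : SpanTuple V d), A.sem d t ≠ 0 →
    ∃! ρ : A.RunData, ρ ∈ A.runs d ∧ A.Selects ρ t

/-- The size of an automaton: the number of its states plus the number of its transitions. -/
noncomputable def size : ℕ :=
  Nat.card A.Q +
    {e : A.Q × Label Γ {x // x ∈ V} × A.Q | A.δ e.1 e.2.1 e.2.2 ≠ 0}.ncard

/-! That an automaton has only finitely many valid runs on a document. -/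

open Classical in
theorem finite_paths [Finite Γ] (k : ℕ) : ∀ q : A.Q,
    {l | A.IsPath q l ∧ (l.map Prod.fst).countP (fun o => decide (o ≠ Label.eps)) = k}.Finite := by
  let r : A.Q → A.Q → Prop := fun p p' => A.δ p Label.eps p' ≠ 0
  have wf : WellFounded (fun a b => Relation.TransGen r b a) := by
    have h1 : IsTrans A.Q (fun a b => Relation.TransGen r b a) :=
      ⟨fun a b c hab hbc => hbc.trans hab⟩
    have h2 : Std.Irrefl (fun a b => Relation.TransGen r b a) := ⟨fun a h => A.noEpsCycle a h⟩
    exact Finite.wellFounded_of_trans_of_irrefl _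
  induction k using Nat.strong_induction_on with
  | _ k ih =>
    intro q
    induction q using wf.induction with
    | _ q ihq =>
      have hfin : ({[]} ∪ ⋃ s : Label Γ {x // x ∈ V} × A.Q,
          (fun l => s :: l) '' {l | A.δ q s.1 s.2 ≠ 0 ∧ A.IsPath s.2 l ∧
            ((s :: l).map Prod.fst).countP (fun o => decide (o ≠ Label.eps)) = k}).Finite := by
        refine (Set.finite_singleton _).union (Set.finite_iUnion fun s => Set.Finite.image _ ?_)
        obtain ⟨o, p⟩ := s
        by_cases ho : o = Label.eps
        · subst ho
          by_cases hp : A.δ q Label.eps p ≠ 0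
          · refine (ihq p (Relation.TransGen.single hp)).subset ?_
            rintro l ⟨-, h2, h3⟩
            exact ⟨h2, by simpa using h3⟩
          · refine Set.finite_empty.subset ?_
            rintro l ⟨h1, -⟩
            exact hp h1
        · rcases k with _ | k
          · refine Set.finite_empty.subset ?_
            rintro l ⟨-, -, h3⟩
            simp [ho] at h3
          · refine (ih k (Nat.lt_succ_self k) p).subset ?_
            rintro l ⟨-, h2, h3⟩
            exact ⟨h2, by simpa [ho] using h3⟩
      refine hfin.subset ?_
      rintro (_ | ⟨s, l⟩) ⟨h1, h2⟩
      · left; rfl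
      · right
        exact Set.mem_iUnion.2 ⟨s, l, ⟨h1.1, h1.2, h2⟩, rfl⟩

open Classical in
theorem finite_runs [Finite Γ] (d : List Γ) : (A.runs d).Finite := by
  have key : ∀ ls : List (Label Γ {x // x ∈ V}), Label.Valid ls →
      ls.countP (fun o => decide (o ≠ Label.eps)) ≤
        (Label.reads ls).length + 2 * Fintype.card {x // x ∈ V} := by
    intro ls hv
    have h1 : ls.countP (fun o => decide (o ≠ Label.eps)) = (Label.reads ls).length +
        ((∑ v : {x // x ∈ V}, ls.count (Label.opn v)) +
          ∑ v : {x // x ∈ V}, ls.count (Label.cls v)) := by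
      clear hv
      induction ls with
      | nil => simp [Label.reads]
      | cons o l ih =>
        simp only [Label.reads] at ih ⊢
        rw [List.countP_cons, ih]
        cases o <;>
          simp [List.count_cons, Label.letter?, List.filterMap_cons,
            Finset.sum_add_distrib] <;> omega
    have h2 : ∀ v : {x // x ∈ V}, ls.count (Label.opn v) ≤ 1 ∧ ls.count (Label.cls v) ≤ 1 := by
      intro v
      obtain ⟨l₁, l₂, l₃, rfl, ho, hc⟩ := hv v
      simp only [List.mem_append, not_or] at ho hc
      simp [List.count_eq_zero_of_not_mem, ho, hc]
    have h3 : ∑ v : {x // x ∈ V}, ls.count (Label.opn v) ≤ Fintype.card {x // x ∈ V} := by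
      simpa using Finset.sum_le_sum (s := Finset.univ) fun v _ => (h2 v).1
    have h4 : ∑ v : {x // x ∈ V}, ls.count (Label.cls v) ≤ Fintype.card {x // x ∈ V} := by
      simpa using Finset.sum_le_sum (s := Finset.univ) fun v _ => (h2 v).2
    omega
  have hfin : (⋃ q : A.Q, ⋃ k : Fin (d.length + 2 * Fintype.card {x // x ∈ V} + 1),
      Prod.mk q '' {l | A.IsPath q l ∧
        (l.map Prod.fst).countP (fun o => decide (o ≠ Label.eps)) = (k : ℕ)}).Finite :=
    Set.finite_iUnion fun q => Set.finite_iUnion fun k => (A.finite_paths k q).image _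
  refine hfin.subset ?_
  rintro ⟨q, l⟩ ⟨⟨-, hp, -, hd⟩, hv, -⟩
  have := key _ hv
  rw [hd] at this
  exact Set.mem_iUnion.2 ⟨q, Set.mem_iUnion.2 ⟨⟨_, Nat.lt_succ_of_le this⟩, l, ⟨hp, rfl⟩, rfl⟩⟩

end WVSA

/-- An automaton represents an annotator if both give the same weight to every tuple. -/
def WVSA.Represents {Γ X K : Type} [CommSemiring K] {S : Annotator Γ X K}
    (A : WVSA Γ S.vars K) : Prop :=
  ∀ d t, A.sem d t = S.rel d t

/-- An annotator is regular if some weighted VSet-automaton represents it. -/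
def Annotator.Regular {Γ X K : Type} [CommSemiring K] (S : Annotator Γ X K) : Prop :=
  ∃ A : WVSA Γ S.vars K, A.Represents

/-! ## Soft spanners -/

/-- A soft spanner `(P, 𝔖, w)`. -/
structure SoftSpanner (Γ X : Type) where
  P : Spanner Γ X
  factors : Finset (Spanner Γ X)
  w : {S // S ∈ factors} → ℝ

/-- Two tuples are joinable if they agree on all common variables. -/
def Joinable {Γ X : Type} {V W : Finset X} {d : List Γ} (t : SpanTuple V d)
    (t' : SpanTuple W d) : Prop :=
  ∀ x (hV : x ∈ V) (hW : x ∈ W), t ⟨x, hV⟩ = t' ⟨x, hW⟩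

namespace SoftSpanner

variable {Γ X : Type} (Q : SoftSpanner Γ X)

open Classical in
/-- The unnormalized probability of `t`: the exponential of the sum of `w S` over all factor
spanners `S` and all tuples `t'` of `S(d)` that are joinable with `t`. -/
noncomputable def qHat (d : List Γ) (t : SpanTuple Q.P.vars d) : ℝ :=
  Real.exp (∑ S : {S // S ∈ Q.factors},
    ∑ t' : SpanTuple S.1.vars d with S.1.rel d t' ≠ 0 ∧ Joinable t t', Q.w S)

/-- The real-weighted automaton `A` computes `log Q̂`: it gives the weight `log Q̂(d,t)` to every
tuple `t` in `P(d)`, and no weight to the tuples that are not in `P(d)`. -/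
def CompiledBy (A : WVSA Γ Q.P.vars ℝ) : Prop :=
  ∀ (d : List Γ) (t : SpanTuple Q.P.vars d),
    (Q.P.rel d t ≠ 0 → A.sem d t = Real.log (Q.qHat d t)) ∧
    (Q.P.rel d t = 0 → A.sem d t = 0)

end SoftSpanner

/-! ## A machine model with unit-cost operations on semiring elements

Programs in a first-order functional language over binary trees, whose leaves are registers that
hold a natural number or an element of the semiring `K`.  Every elementary operation (building a
pair, following a pointer, a test, an addition, a multiplication of semiring elements, a function
call) costs one step.  Each of them takes constant time on a random access machine that can store
a semiring element in one register and add and multiply such elements in constant time. -/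

inductive Val (K : Type) : Type
  | num (n : ℕ)
  | wt (k : K)
  | pair (a b : Val K)

/-- Expressions.  Variables are de Bruijn indices; `call f e` applies the function with index `f`
of the program to the value of `e`. -/
inductive Expr : Type
  | var (i : ℕ)
  | num (n : ℕ)
  | add (e₁ e₂ : Expr)
  | sub (e₁ e₂ : Expr)
  | eq (e₁ e₂ : Expr)
  | lt (e₁ e₂ : Expr)
  | wzero
  | wone
  | wadd (e₁ e₂ : Expr)
  | wmul (e₁ e₂ : Expr)
  | pair (e₁ e₂ : Expr)
  | fst (e : Expr)
  | snd (e : Expr)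
  | isPair (e : Expr)
  | ite (c e₁ e₂ : Expr)
  | letIn (e₁ e₂ : Expr)
  | call (f : ℕ) (e : Expr)

/-- A program: the finite list of the bodies of its functions, each of which has one argument. -/
abbrev Program : Type := List Expr

/-- Whether a value is a pair. -/
def Val.isPair {K : Type} : Val K → Bool
  | .pair _ _ => true
  | _ => false

/-- `Eval P env e v n`: in the program `P`, with the values `env` of the variables, the expression
`e` evaluates to `v` in `n` steps. -/
inductive Eval {K : Type} [CommSemiring K] (P : Program) :
    List (Val K) → Expr → Val K → ℕ → Prop
  | var {env i v} : env[i]? = some v → Eval P env (.var i) v 1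
  | num {env k} : Eval P env (.num k) (.num k) 1
  | add {env e₁ e₂ a b m n} : Eval P env e₁ (.num a) m → Eval P env e₂ (.num b) n →
      Eval P env (.add e₁ e₂) (.num (a + b)) (m + n + 1)
  | sub {env e₁ e₂ a b m n} : Eval P env e₁ (.num a) m → Eval P env e₂ (.num b) n →
      Eval P env (.sub e₁ e₂) (.num (a - b)) (m + n + 1)
  | eq {env e₁ e₂ a b m n} : Eval P env e₁ (.num a) m → Eval P env e₂ (.num b) n →
      Eval P env (.eq e₁ e₂) (.num (if a = b then 1 else 0)) (m + n + 1)
  | lt {env e₁ e₂ a b m n} : Eval P env e₁ (.num a) m → Eval P env e₂ (.num b) n →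
      Eval P env (.lt e₁ e₂) (.num (if a < b then 1 else 0)) (m + n + 1)
  | wzero {env} : Eval P env .wzero (.wt 0) 1
  | wone {env} : Eval P env .wone (.wt 1) 1
  | wadd {env e₁ e₂ a b m n} : Eval P env e₁ (.wt a) m → Eval P env e₂ (.wt b) n →
      Eval P env (.wadd e₁ e₂) (.wt (a + b)) (m + n + 1)
  | wmul {env e₁ e₂ a b m n} : Eval P env e₁ (.wt a) m → Eval P env e₂ (.wt b) n →
      Eval P env (.wmul e₁ e₂) (.wt (a * b)) (m + n + 1)
  | pair {env e₁ e₂ a b m n} : Eval P env e₁ a m → Eval P env e₂ b n →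
      Eval P env (.pair e₁ e₂) (.pair a b) (m + n + 1)
  | fst {env e a b n} : Eval P env e (.pair a b) n → Eval P env (.fst e) a (n + 1)
  | snd {env e a b n} : Eval P env e (.pair a b) n → Eval P env (.snd e) b (n + 1)
  | isPair {env e a n} : Eval P env e a n →
      Eval P env (.isPair e) (.num (if a.isPair then 1 else 0)) (n + 1)
  | iteTrue {env c e₁ e₂ k v m n} : Eval P env c (.num (k + 1)) m → Eval P env e₁ v n →
      Eval P env (.ite c e₁ e₂) v (m + n + 1)
  | iteFalse {env c e₁ e₂ v m n} : Eval P env c (.num 0) m → Eval P env e₂ v n →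
      Eval P env (.ite c e₁ e₂) v (m + n + 1)
  | letIn {env e₁ e₂ a v m n} : Eval P env e₁ a m → Eval P (a :: env) e₂ v n →
      Eval P env (.letIn e₁ e₂) v (m + n + 1)
  | call {env f e body a v m n} : Eval P env e a m → P[f]? = some body → Eval P [a] body v n →
      Eval P env (.call f e) v (m + n + 1)

/-- The value and the number of steps are determined by the program and the environment. -/
theorem Eval.det {K : Type} [CommSemiring K] {P : Program} {env : List (Val K)} {e : Expr}
    {v : Val K} {n : ℕ} (h : Eval P env e v n) :
    ∀ {v' n'}, Eval P env e v' n' → v = v' ∧ n = n' := by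
  induction h <;> intro v' n' h' <;> cases h' <;> grind

/-- The program `P`, started on the input `x` (its function number `0` is called), stops after `n`
steps with the output `y`. -/
def Program.Outputs {K : Type} [CommSemiring K] (P : Program) (x y : Val K) (n : ℕ) : Prop :=
  Eval P [x] (.call 0 (.var 0)) y n

/-! ## Automata and soft spanners as inputs and outputs of programs -/

namespace Val

variable {K : Type}

/-- Lists as values; the empty list is the number `0`. -/
def ofList {α : Type*} (f : α → Val K) : List α → Val K
  | [] => num 0
  | a :: l => pair (f a) (ofList f l)

/-- Labels as values: a tag, and the number of the letter or variable. -/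
def ofLabel {Γ X : Type} [Encodable Γ] [Encodable X] {V : Finset X} :
    Label Γ {x // x ∈ V} → Val K
  | .letter a => pair (num 0) (num (Encodable.encode a))
  | .eps => pair (num 1) (num 0)
  | .opn v => pair (num 2) (num (Encodable.encode v.1))
  | .cls v => pair (num 3) (num (Encodable.encode v.1))

end Val

/-- A finite description of an automaton by lists, in any order and without repetitions: the
states are named by numbers, and the lists of initial weights, final weights and transitions
contain at least everything that has a nonzero weight. -/
structure Listing {Γ X K : Type} [CommSemiring K] {V : Finset X} (A : WVSA Γ V K) where
  name : A.Q → ℕ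
  name_inj : Function.Injective name
  vars : List {x // x ∈ V}
  vars_nodup : vars.Nodup
  mem_vars : ∀ v, v ∈ vars
  states : List A.Q
  states_nodup : states.Nodup
  mem_states : ∀ q, q ∈ states
  initial : List A.Q
  initial_nodup : initial.Nodup
  mem_initial : ∀ q, A.init q ≠ 0 → q ∈ initial
  final : List A.Q
  final_nodup : final.Nodup
  mem_final : ∀ q, A.final q ≠ 0 → q ∈ final
  trans : List (A.Q × Label Γ {x // x ∈ V} × A.Q)
  trans_nodup : trans.Nodup
  mem_trans : ∀ p o q, A.δ p o q ≠ 0 → (p, o, q) ∈ trans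

namespace Listing

variable {Γ X K : Type} [CommSemiring K] {V : Finset X} {A : WVSA Γ V K}

/-- The listing contains no initial weight, final weight or transition of weight zero. -/
def Exact (L : Listing A) : Prop :=
  (∀ q ∈ L.initial, A.init q ≠ 0) ∧ (∀ q ∈ L.final, A.final q ≠ 0) ∧
    ∀ e ∈ L.trans, A.δ e.1 e.2.1 e.2.2 ≠ 0

/-- The number of the listed states plus the number of the listed transitions. -/
def length (L : Listing A) : ℕ := L.states.length + L.trans.length

/-- A listing as a value; `enc` writes the weights. -/
def toVal {M : Type} [Encodable Γ] [Encodable X] (enc : K → Val M) (L : Listing A) : Val M :=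
  .pair (Val.ofList (fun v => .num (Encodable.encode v.1)) L.vars) <|
  .pair (Val.ofList (fun q => .num (L.name q)) L.states) <|
  .pair (Val.ofList (fun q => .pair (.num (L.name q)) (enc (A.init q))) L.initial) <|
  .pair (Val.ofList (fun q => .pair (.num (L.name q)) (enc (A.final q))) L.final) <|
  Val.ofList (fun e => .pair (.num (L.name e.1)) (.pair (Val.ofLabel e.2.1)
    (.pair (.num (L.name e.2.2)) (enc (A.δ e.1 e.2.1 e.2.2))))) L.trans

end Listing

/-- Boolean weights are written as the numbers `0` and `1`. -/
def BoolSR.toVal {M : Type} (b : BoolSR) : Val M := .num (if b = 0 then 0 else 1)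

/-- A representation of a soft spanner by unambiguous functional VSet-automata: an automaton for
each of its spanners with a description by lists, and an enumeration of the factor spanners. -/
structure SoftSpannerRep {Γ X : Type} (Q : SoftSpanner Γ X) where
  autP : WVSA Γ Q.P.vars BoolSR
  autP_represents : autP.Represents
  autP_functional : autP.Functional
  autP_unambiguous : autP.Unambiguous
  aut : (S : {S // S ∈ Q.factors}) → WVSA Γ S.1.vars BoolSR
  aut_represents : ∀ S, (aut S).Represents
  aut_functional : ∀ S, (aut S).Functional
  aut_unambiguous : ∀ S, (aut S).Unambiguous
  listP : Listing autP
  listP_exact : listP.Exact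
  list : (S : {S // S ∈ Q.factors}) → Listing (aut S)
  list_exact : ∀ S, (list S).Exact
  enum : List {S // S ∈ Q.factors}
  enum_nodup : enum.Nodup
  mem_enum : ∀ S, S ∈ enum

namespace SoftSpannerRep

variable {Γ X : Type} {Q : SoftSpanner Γ X} (R : SoftSpannerRep Q)

/-- The size of the represented soft spanner: the sizes of all automata, plus the number of the
factor spanners. -/
noncomputable def size : ℕ :=
  R.autP.size + ∑ S : {S // S ∈ Q.factors}, ((R.aut S).size + 1)

/-- The input of a program: the automaton of `P`, and the list of the automata of the factor
spanners with their real weights, each of which occupies one register. -/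
def toVal [Encodable Γ] [Encodable X] : Val ℝ :=
  .pair (R.listP.toVal BoolSR.toVal)
    (Val.ofList (fun S => .pair ((R.list S).toVal BoolSR.toVal) (.wt (Q.w S))) R.enum)

end SoftSpannerRep

/-! Taking the logarithm turns `qHat` into the sum of w(S) over all factors S and all t' in S(d)
that are joinable with t. If P and the factors are given by unambiguous functional automata, tuples
correspond to runs. It then suffices to run P beside one factor, with initial weight w(S) and weight
1 elsewhere, so that each joinable t' contributes exactly one joint run. An ordinary product does
not achieve this: the operations of S on variables outside P would become ε-moves, whose
interleavings with the moves of P multiply runs and whose cycles may become ε-cycles.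

The remedy is to keep, of the run of S, only its gap states: the states right before the letters,
and the last state. In a functional automaton, a state on an accepting run determines which
operations still lie ahead (`Functional.pending_iff`). So the gap states determine the position of
every operation, hence the tuple, and by unambiguity the run. For the same reason joinability can be
checked gap by gap, by comparing the pending operations on common variables (`joinable_iff`). In
`softJoin` the factor therefore moves only at letters, jumping over a whole gap by precomputed
reachability, while P runs normally. `softJoin_sem` is the resulting bijection between joinable
tuples and joint runs.

For arbitrary regular spanners, `exists_functional_unambiguous` supplies the automata required. A
product with the set of operations already done makes an automaton functional (`track`). A subset
construction on gap states (`det`), with the operations inside each gap performed in a fixed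
increasing order, leaves exactly one run per tuple.

For the time bound, the construction is written as a function `AutCode.compile` on lists. It is
composed of loops under which `PolyTime` is closed, the only search being graph reachability in as
many rounds as there are states. `exists_listing` shows that its output lists the states and
transitions of the joint automaton. -/

/-! ### Label sequences: gaps and positions of operations. -/

namespace Label

variable {Γ V : Type}

/-- The operation that opens (`false`) or closes (`true`) a variable. -/
def op : Bool → V → Label Γ V
  | false, v => opn v
  | true, v => cls v

@[simp] theorem letter?_op (b : Bool) (v : V) : (op b v : Label Γ V).letter? = none := by
  cases b <;> rfl

@[simp] theorem op_inj {b c : Bool} {v w : V} : (op b v : Label Γ V) = op c w ↔ b = c ∧ v = w := by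
  cases b <;> cases c <;> simp [op]

theorem cases_letter (o : Label Γ V) : (∃ a, o = letter a) ∨ o = eps ∨ ∃ b v, o = op b v := by
  cases o with
  | letter a => exact .inl ⟨a, rfl⟩
  | eps => exact .inr (.inl rfl)
  | opn v => exact .inr (.inr ⟨false, v, rfl⟩)
  | cls v => exact .inr (.inr ⟨true, v, rfl⟩)

theorem reads_cons (o : Label Γ V) (ls : List (Label Γ V)) :
    reads (o :: ls) = o.letter?.toList ++ reads ls := by
  cases o <;> simp [reads, letter?, List.filterMap_cons]

@[simp] theorem reads_nil : reads ([] : List (Label Γ V)) = [] := rfl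

theorem reads_append (l₁ l₂ : List (Label Γ V)) : reads (l₁ ++ l₂) = reads l₁ ++ reads l₂ := by
  simp [reads]

/-- The suffixes of a label sequence that start right before a letter, and the empty suffix. -/
def gapSuffixes : List (Label Γ V) → List (List (Label Γ V))
  | [] => [[]]
  | o :: ls => if o.letter?.isSome then (o :: ls) :: gapSuffixes ls else gapSuffixes ls

open Classical in
/-- The number of letters before the last occurrence of a label. -/
noncomputable def position (o : Label Γ V) : List (Label Γ V) → ℕ
  | [] => 0
  | l :: ls => if o ∈ ls then l.letter?.toList.length + position o ls else 0

theorem position_of_not_mem {o : Label Γ V} {ls : List (Label Γ V)} (h : o ∉ ls) :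
    position o ls = 0 := by
  cases ls with
  | nil => rfl
  | cons l ls => simp only [List.mem_cons, not_or] at h; simp [position, h.2]

/-- The suffix at gap i starts with letter number i, counted from 0, so an operation inside it has
at least i + 1 letters before it. Because `position` refers to the last occurrence, the equivalence
needs no validity; a missing label has position 0 and lies in no suffix. -/
theorem mem_gapSuffixes_iff {o : Label Γ V} (ho : o.letter? = none) (ls : List (Label Γ V)) (i : ℕ)
    (hi : i < (gapSuffixes ls).length) : o ∈ (gapSuffixes ls)[i] ↔ i < position o ls := by
  induction ls generalizing i with
  | nil => simp [gapSuffixes, position]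
  | cons l ls ih =>
    by_cases hl : l.letter?.isSome
    · have hne : o ≠ l := by rintro rfl; simp [ho] at hl
      obtain ⟨a, ha⟩ := Option.isSome_iff_exists.1 hl
      have e : gapSuffixes (l :: ls) = (l :: ls) :: gapSuffixes ls := by simp [gapSuffixes, hl]
      simp only [e] at hi ⊢
      cases i with
      | zero => by_cases h : o ∈ ls <;> simp [position, h, hne, ha]
      | succ i =>
        have := ih i (by simpa using hi)
        by_cases h : o ∈ ls
        · simp [position, h, ha, this]; omega
        · simp [position, h, this, position_of_not_mem]
    · have e : gapSuffixes (l :: ls) = gapSuffixes ls := by simp [gapSuffixes, hl]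
      simp only [e] at hi ⊢
      rw [ih i hi]
      simp only [Option.not_isSome_iff_eq_none] at hl
      by_cases h : o ∈ ls
      · simp [position, h, hl]
      · simp [position, h, position_of_not_mem]

theorem position_append {o : Label Γ V} (l₁ : List (Label Γ V)) {l₂ : List (Label Γ V)}
    (h : o ∉ l₂) : position o (l₁ ++ o :: l₂) = (reads l₁).length := by
  induction l₁ with
  | nil => simp [position, h]
  | cons l l₁ ih => simp [position, ih, reads_cons]

theorem position_le (o : Label Γ V) (ls : List (Label Γ V)) :
    position o ls ≤ (reads ls).length := by
  induction ls with
  | nil => simp [position]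
  | cons l ls ih =>
    simp only [position, reads_cons, List.length_append]
    split_ifs <;> omega

open Classical in
theorem Valid.count_eq_one {ls : List (Label Γ V)} (h : Valid ls) (b : Bool) (v : V) :
    ls.count (op b v) = 1 := by
  obtain ⟨l₁, l₂, l₃, rfl, ho, hc⟩ := h v
  simp only [List.mem_append, not_or] at ho hc
  cases b <;> simp [op, List.count_eq_zero_of_not_mem, ho, hc]

theorem Valid.op_mem {ls : List (Label Γ V)} (h : Valid ls) (b : Bool) (v : V) :
    op b v ∈ ls := by
  classical
  exact List.count_pos_iff.1 (by rw [h.count_eq_one]; exact one_pos)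

theorem Valid.op_not_mem {l₁ l₂ : List (Label Γ V)} (h : Valid (l₁ ++ l₂)) (b : Bool) (v : V) :
    op b v ∈ l₁ ↔ op b v ∉ l₂ := by
  classical
  have := h.count_eq_one b v
  rw [List.count_append] at this
  rw [← List.count_pos_iff, ← List.count_pos_iff]
  omega

/-- In a valid sequence the operation occurs once, so the last occurrence is the one that any
decomposition exhibits. This turns the existential conditions of `Selects` into equations between
numbers. -/
theorem Valid.position_eq {ls : List (Label Γ V)} (h : Valid ls) (b : Bool) (v : V) (k : ℕ) :
    (∃ l₁ l₂, ls = l₁ ++ op b v :: l₂ ∧ (reads l₁).length = k) ↔ position (op b v) ls = k := by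
  classical
  have key : ∀ l₁ l₂, ls = l₁ ++ op b v :: l₂ → position (op b v) ls = (reads l₁).length := by
    rintro l₁ l₂ rfl
    apply position_append
    have := h.count_eq_one b v
    simp at this
    exact List.count_eq_zero.1 (by omega)
  constructor
  · rintro ⟨l₁, l₂, h1, rfl⟩
    exact key _ _ h1
  · rintro rfl
    obtain ⟨l₁, l₂, e⟩ := List.append_of_mem (h.op_mem b v)
    exact ⟨l₁, l₂, e, (key _ _ e).symm⟩

theorem Valid.position_le_position {ls : List (Label Γ V)} (h : Valid ls) (v : V) :
    position (op false v) ls ≤ position (op true v) ls := by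
  obtain ⟨l₁, l₂, l₃, e, ho, hc⟩ := h v
  rw [(h.position_eq false v (reads l₁).length).1 ⟨l₁, _, e, rfl⟩,
    (h.position_eq true v (reads (l₁ ++ op false v :: l₂)).length).1
      ⟨l₁ ++ op false v :: l₂, l₃, by simpa [op] using e, rfl⟩, reads_append, List.length_append]
  omega

end Label

namespace BoolSR

theorem add_ne_zero {a b : BoolSR} : a + b ≠ 0 ↔ a ≠ 0 ∨ b ≠ 0 := by revert a b; decide

theorem mul_ne_zero {a b : BoolSR} : a * b ≠ 0 ↔ a ≠ 0 ∧ b ≠ 0 := by revert a b; decide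

theorem one_ne_zero : (1 : BoolSR) ≠ 0 := by decide

theorem eq_iff {a b : BoolSR} : a = b ↔ (a ≠ 0 ↔ b ≠ 0) := by revert a b; decide

theorem sum_ne_zero {ι : Type*} (s : Finset ι) (f : ι → BoolSR) :
    ∑ i ∈ s, f i ≠ 0 ↔ ∃ i ∈ s, f i ≠ 0 := by
  classical
  induction s using Finset.induction_on with
  | empty => simp
  | insert i s hi ih => rw [Finset.sum_insert hi, add_ne_zero, ih]; simp

end BoolSR

/-! ### Gap states of runs. -/

namespace WVSA

open Label

variable {Γ X K : Type} {V : Finset X} [CommSemiring K] (A : WVSA Γ V K)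

/-- The states of a path right before its letters, and its last state. -/
def gapStates : A.Q → List (Label Γ {x // x ∈ V} × A.Q) → List A.Q
  | q, [] => [q]
  | q, (o, q') :: π => if o.letter?.isSome then q :: gapStates q' π else gapStates q' π

/-- Some sequence of transitions that read no letter leads from one state to another. -/
def Gap : A.Q → A.Q → Prop :=
  Relation.ReflTransGen fun p q => ∃ o : Label Γ {x // x ∈ V}, o.letter? = none ∧ A.δ p o q ≠ 0

/-- Some sequence of transitions leads from one state to another. -/
def Reach : A.Q → A.Q → Prop :=
  Relation.ReflTransGen fun p q => ∃ o : Label Γ {x // x ∈ V}, A.δ p o q ≠ 0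

/-- Some path from the state `p` to a final state contains the label `o`. -/
def Pending (p : A.Q) (o : Label Γ {x // x ∈ V}) : Prop :=
  ∃ q q' f, A.Reach p q ∧ A.δ q o q' ≠ 0 ∧ A.Reach q' f ∧ A.final f ≠ 0

/-- Some transition has the label `o`. -/
def Mentions (o : Label Γ {x // x ∈ V}) : Prop := ∃ q q', A.δ q o q' ≠ 0

/-- Two states, of two automata, have the same pending operations on those common variables that
occur in both automata. -/
def Agree {K' : Type} [CommSemiring K'] {W : Finset X} (A : WVSA Γ V K) (B : WVSA Γ W K')
    (p : A.Q) (q : B.Q) : Prop :=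
  ∀ (b : Bool) (x : X) (hV : x ∈ V) (hW : x ∈ W), A.Mentions (op b ⟨x, hV⟩) →
    B.Mentions (op b ⟨x, hW⟩) → (A.Pending p (op b ⟨x, hV⟩) ↔ B.Pending q (op b ⟨x, hW⟩))

/-- The lists of states that can be the gap states of paths that read `d` and start with a letter,
without the first state. -/
def GapSeq : A.Q → List Γ → List A.Q → Prop
  | _, [], [] => True
  | p, a :: d, q :: σ => (∃ p', A.δ p (letter a) p' ≠ 0 ∧ A.Gap p' q) ∧ GapSeq q d σ
  | _, _, _ => False

variable {A}

@[simp] theorem lastState_append (p : A.Q) (π π' : List (Label Γ {x // x ∈ V} × A.Q)) :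
    A.lastState p (π ++ π') = A.lastState (A.lastState p π) π' := by
  induction π generalizing p with
  | nil => rfl
  | cons s π ih => exact ih _

@[simp] theorem isPath_append (p : A.Q) (π π' : List (Label Γ {x // x ∈ V} × A.Q)) :
    A.IsPath p (π ++ π') ↔ A.IsPath p π ∧ A.IsPath (A.lastState p π) π' := by
  induction π generalizing p with
  | nil => simp [IsPath, lastState]
  | cons s π ih => simp [IsPath, lastState, ih, and_assoc]

theorem reach_iff {p q : A.Q} : A.Reach p q ↔ ∃ π, A.IsPath p π ∧ A.lastState p π = q := by
  constructor
  · intro h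
    induction h with
    | refl => exact ⟨[], trivial, rfl⟩
    | @tail _ q _ h ih =>
      obtain ⟨π, h1, rfl⟩ := ih
      obtain ⟨o, h⟩ := h
      exact ⟨π ++ [(o, q)], by simp [h1, IsPath, h], by simp [lastState]⟩
  · rintro ⟨π, h1, rfl⟩
    induction π generalizing p with
    | nil => exact .refl
    | cons s π ih => exact .head ⟨s.1, h1.1⟩ (ih h1.2)

theorem IsPath.mentions {p : A.Q} {π : List (Label Γ {x // x ∈ V} × A.Q)} (h : A.IsPath p π)
    {o : Label Γ {x // x ∈ V}} (ho : o ∈ π.map Prod.fst) : A.Mentions o := by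
  induction π generalizing p with
  | nil => simp at ho
  | cons s π ih =>
    rcases List.mem_cons.1 ho with rfl | ho
    · exact ⟨_, _, h.1⟩
    · exact ih h.2 ho

theorem pending_iff {p : A.Q} {o : Label Γ {x // x ∈ V}} : A.Pending p o ↔
    ∃ π, A.IsPath p π ∧ A.final (A.lastState p π) ≠ 0 ∧ o ∈ π.map Prod.fst := by
  constructor
  · rintro ⟨q, q', f, h1, h2, h3, h4⟩
    obtain ⟨π, hπ, rfl⟩ := reach_iff.1 h1
    obtain ⟨π', hπ', rfl⟩ := reach_iff.1 h3
    exact ⟨π ++ (o, q') :: π', by simp [IsPath, *], by simpa [lastState] using h4, by simp⟩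
  · rintro ⟨π, h1, h2, h3⟩
    obtain ⟨⟨o', q⟩, h4, rfl⟩ := List.mem_map.1 h3
    obtain ⟨π₁, π₂, rfl⟩ := List.append_of_mem h4
    simp only [isPath_append, IsPath] at h1
    exact ⟨_, _, _, reach_iff.2 ⟨_, h1.1, rfl⟩, h1.2.1, reach_iff.2 ⟨_, h1.2.2, rfl⟩,
      by simpa [lastState] using h2⟩

theorem length_gapStates (p : A.Q) (π : List (Label Γ {x // x ∈ V} × A.Q)) :
    (A.gapStates p π).length = (reads (π.map Prod.fst)).length + 1 := by
  induction π generalizing p with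
  | nil => rfl
  | cons s π ih =>
    obtain ⟨o, q⟩ := s
    cases o <;> simp [gapStates, reads_cons, letter?, ih]

/-- A state function whose value tells the occurrence of a label in the rest of the run tells the
positions of this label. -/
theorem forall_gapStates {F : A.Q → List (Label Γ {x // x ∈ V} × A.Q) → Prop} {p : A.Q → Prop}
    {o : Label Γ {x // x ∈ V}} (h : ∀ q π, F q π → (p q ↔ o ∈ π.map Prod.fst))
    (h' : ∀ q s π, F q (s :: π) → F s.2 π) (q : A.Q) (π : List (Label Γ {x // x ∈ V} × A.Q))
    (hq : F q π) :
    List.Forall₂ (fun s l => p s ↔ o ∈ l) (A.gapStates q π) (gapSuffixes (π.map Prod.fst)) := by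
  induction π generalizing q with
  | nil => simpa [gapStates, gapSuffixes] using h q [] hq
  | cons s π ih =>
    obtain ⟨o', q'⟩ := s
    have h1 := ih q' (h' _ _ _ hq)
    have h2 := h _ _ hq
    cases o' <;> simp_all [gapStates, gapSuffixes, letter?]

theorem getElem_gapStates {F : A.Q → List (Label Γ {x // x ∈ V} × A.Q) → Prop} {p : A.Q → Prop}
    {o : Label Γ {x // x ∈ V}} (ho : o.letter? = none)
    (h : ∀ q π, F q π → (p q ↔ o ∈ π.map Prod.fst))
    (h' : ∀ q s π, F q (s :: π) → F s.2 π) (q : A.Q) (π : List (Label Γ {x // x ∈ V} × A.Q))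
    (hq : F q π) (i : ℕ) (hi : i < (A.gapStates q π).length) :
    p (A.gapStates q π)[i] ↔ i < position o (π.map Prod.fst) := by
  have h1 := forall_gapStates h h' q π hq
  have h2 := h1.get hi (by rw [← h1.length_eq]; exact hi)
  rw [← mem_gapSuffixes_iff ho _ _ (by rw [← h1.length_eq]; exact hi)]
  simpa using h2

/-- Fix a path from an initial state to the gap state. Each accepting continuation completes it to a
run, which is valid, so the operation occurs in exactly one of the two parts. Hence all accepting
continuations agree on whether they contain it, and the existential in `Pending` speaks about the
actual run. -/
theorem Functional.pending_iff (hA : A.Functional) {d : List Γ} {ρ : A.RunData}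
    (hρ : A.IsRun d ρ) (b : Bool) (v : {x // x ∈ V}) (i : ℕ)
    (hi : i < (A.gapStates ρ.1 ρ.2).length) :
    A.Pending (A.gapStates ρ.1 ρ.2)[i] (op b v) ↔ i < position (op b v) (A.labels ρ) := by
  refine getElem_gapStates (p := fun s => A.Pending s (op b v)) (F := fun q π => A.IsPath q π ∧ A.final (A.lastState q π) ≠ 0 ∧
    ∃ q₀ π₀, A.init q₀ ≠ 0 ∧ A.IsPath q₀ π₀ ∧ A.lastState q₀ π₀ = q) (letter?_op b v)
    ?_ ?_ _ _ ?_ i hi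
  · rintro _ π ⟨h1, h2, q₀, π₀, h3, h4, rfl⟩
    rw [WVSA.pending_iff]
    have val : ∀ π', A.IsPath (A.lastState q₀ π₀) π' →
        A.final (A.lastState (A.lastState q₀ π₀) π') ≠ 0 →
        (op b v ∈ π₀.map Prod.fst ↔ op b v ∉ π'.map Prod.fst) := by
      intro π' h5 h6
      refine Valid.op_not_mem ?_ b v
      have := hA _ (q₀, π₀ ++ π') ⟨h3, by simp [h4, h5], by simpa using h6, rfl⟩
      simpa [labels] using this
    constructor
    · rintro ⟨π', h5, h6, h7⟩
      have := val π' h5 h6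
      have := val π h1 h2
      tauto
    · exact fun h => ⟨π, h1, h2, h⟩
  · rintro q ⟨o, q'⟩ π ⟨h1, h2, q₀, π₀, h3, h4, rfl⟩
    exact ⟨h1.2, h2, q₀, π₀ ++ [(o, q')], h3, by simp [h4, IsPath, h1.1], by simp [lastState]⟩
  · exact ⟨hρ.2.1, hρ.2.2.1, ρ.1, [], hρ.1, trivial, rfl⟩

theorem selects_iff {d : List Γ} {ρ : A.RunData} (hv : Valid (A.labels ρ)) (t : SpanTuple V d) :
    A.Selects ρ t ↔ ∀ v, position (op false v) (A.labels ρ) = (t v).1.1 ∧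
      position (op true v) (A.labels ρ) = (t v).1.2 :=
  forall_congr' fun v => and_congr (hv.position_eq false v _) (hv.position_eq true v _)

theorem exists_selects {d : List Γ} {ρ : A.RunData} (hd : reads (A.labels ρ) = d)
    (hv : Valid (A.labels ρ)) : ∃ t : SpanTuple V d, A.Selects ρ t := by
  subst hd
  refine ⟨fun v => ⟨(⟨_, Nat.lt_succ_of_le (position_le (op false v) (A.labels ρ))⟩,
    ⟨_, Nat.lt_succ_of_le (position_le (op true v) (A.labels ρ))⟩),
    hv.position_le_position v⟩, ?_⟩
  exact (selects_iff hv _).2 fun v => ⟨rfl, rfl⟩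

theorem span_ext {d : List Γ} {s s' : Span d} (h1 : (s.1.1 : ℕ) = s'.1.1)
    (h2 : (s.1.2 : ℕ) = s'.1.2) : s = s' :=
  Subtype.ext (Prod.ext (Fin.ext h1) (Fin.ext h2))

/-- The joinability of the tuples of two runs shows in the gap states. -/
theorem joinable_iff {K' : Type} [CommSemiring K'] {W : Finset X} {B : WVSA Γ W K'}
    (hA : A.Functional) (hB : B.Functional) {d : List Γ} {ρ : A.RunData} {ρ' : B.RunData}
    (hρ : A.IsRun d ρ) (hρ' : B.IsRun d ρ') {t : SpanTuple V d} {t' : SpanTuple W d}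
    (ht : A.Selects ρ t) (ht' : B.Selects ρ' t') :
    Joinable t t' ↔ List.Forall₂ (A.Agree B) (A.gapStates ρ.1 ρ.2) (B.gapStates ρ'.1 ρ'.2) := by
  have hl : (A.gapStates ρ.1 ρ.2).length = d.length + 1 := by
    rw [length_gapStates]; exact congrArg (fun l => l.length + 1) hρ.2.2.2
  have hl' : (B.gapStates ρ'.1 ρ'.2).length = d.length + 1 := by
    rw [length_gapStates]; exact congrArg (fun l => l.length + 1) hρ'.2.2.2
  have hv := hA _ _ hρ
  have hv' := hB _ _ hρ'
  have hle : ∀ o, position o (A.labels ρ) ≤ d.length := fun o => by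
    rw [← hρ.2.2.2]; exact position_le _ _
  have hle' : ∀ o, position o (B.labels ρ') ≤ d.length := fun o => by
    rw [← hρ'.2.2.2]; exact position_le _ _
  have key : Joinable t t' ↔ ∀ (b : Bool) (x : X) (hV : x ∈ V) (hW : x ∈ W),
      position (op b ⟨x, hV⟩) (A.labels ρ) = position (op b ⟨x, hW⟩) (B.labels ρ') := by
    rw [selects_iff hv] at ht
    rw [selects_iff hv'] at ht'
    constructor
    · intro h b x hV hW
      have := h x hV hW
      cases b
      · rw [(ht _).1, (ht' _).1, this]
      · rw [(ht _).2, (ht' _).2, this]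
    · intro h x hV hW
      have h1 := h false x hV hW
      have h2 := h true x hV hW
      rw [(ht _).1, (ht' _).1] at h1
      rw [(ht _).2, (ht' _).2] at h2
      exact span_ext h1 h2
  rw [key, List.forall₂_iff_get]
  constructor
  · intro h
    refine ⟨by rw [hl, hl'], fun i hi hi' b x hV hW _ _ => ?_⟩
    simp only [List.get_eq_getElem]
    rw [hA.pending_iff hρ, hB.pending_iff hρ', h b x hV hW]
  · rintro ⟨-, h⟩ b x hV hW
    have h1 : ∀ i < d.length + 1, (i < position (op b ⟨x, hV⟩) (A.labels ρ) ↔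
        i < position (op b ⟨x, hW⟩) (B.labels ρ')) := by
      intro i hi
      -- Both runs are valid and hence perform every operation, so the `Mentions` guards in `Agree`
      -- hold here.
      have := h i (by omega) (by omega) b x hV hW (hρ.2.1.mentions (hv.op_mem b _))
        (hρ'.2.1.mentions (hv'.op_mem b _))
      simp only [List.get_eq_getElem] at this
      rwa [hA.pending_iff hρ, hB.pending_iff hρ'] at this
    have h2 := hle (op b ⟨x, hV⟩)
    have h3 := hle' (op b ⟨x, hW⟩)
    -- Both positions are at most |d|, so the smaller of two distinct positions is the number of a
    -- gap. At that gap one operation is done and the other is still pending.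
    by_contra hne
    rcases Nat.lt_or_gt_of_ne hne with hlt | hlt
    · have := h1 _ (by omega : position (op b ⟨x, hV⟩) (A.labels ρ) < _); omega
    · have := h1 _ (by omega : position (op b ⟨x, hW⟩) (B.labels ρ') < _); omega

theorem gapStates_ne_nil (p : A.Q) (π : List (Label Γ {x // x ∈ V} × A.Q)) :
    A.gapStates p π ≠ [] := by
  rw [← List.length_pos_iff, length_gapStates]; omega

theorem getLast_gapStates (p : A.Q) (π : List (Label Γ {x // x ∈ V} × A.Q)) :
    (A.gapStates p π).getLast (gapStates_ne_nil p π) = A.lastState p π := by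
  induction π generalizing p with
  | nil => rfl
  | cons s π ih =>
    obtain ⟨o, q⟩ := s
    rw [show A.lastState p ((o, q) :: π) = A.lastState q π from rfl, ← ih q]
    by_cases h : o.letter?.isSome
    · simp only [gapStates, h, if_true]
      rw [List.getLast_cons]
    · simp only [gapStates, h]; rfl

/-- The gap states of a path. -/
theorem gapSeq_of_isPath {p : A.Q} {π : List (Label Γ {x // x ∈ V} × A.Q)} (h : A.IsPath p π) :
    ∃ q σ, A.gapStates p π = q :: σ ∧ A.Gap p q ∧ A.GapSeq q (reads (π.map Prod.fst)) σ := by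
  induction π generalizing p with
  | nil => exact ⟨p, [], rfl, .refl, trivial⟩
  | cons s π ih =>
    obtain ⟨o, p'⟩ := s
    obtain ⟨q, σ, h1, h2, h3⟩ := ih h.2
    by_cases ho : ∃ a, o = letter a
    · obtain ⟨a, rfl⟩ := ho
      exact ⟨p, q :: σ, by simp [gapStates, letter?, h1], .refl, ⟨p', h.1, h2⟩, h3⟩
    · have ho' : o.letter? = none := by cases o <;> simp_all [letter?]
      exact ⟨q, σ, by simp [gapStates, ho', h1], .head ⟨o, ho', h.1⟩ h2,
        by simpa [reads_cons, ho'] using h3⟩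

/-- Transitions without letters put in front of a path change neither its gap states nor the string
it reads. -/
theorem Gap.exists_path {p q : A.Q} (h : A.Gap p q) (π : List (Label Γ {x // x ∈ V} × A.Q))
    (hπ : A.IsPath q π) : ∃ π', A.IsPath p π' ∧ A.gapStates p π' = A.gapStates q π ∧
      reads (π'.map Prod.fst) = reads (π.map Prod.fst) := by
  induction h using Relation.ReflTransGen.head_induction_on with
  | refl => exact ⟨π, hπ, rfl, rfl⟩
  | head h _ ih =>
    obtain ⟨o, ho, h⟩ := h
    obtain ⟨π', h1, h2, h3⟩ := ih
    exact ⟨(o, _) :: π', ⟨h, h1⟩, by simp [gapStates, ho, h2], by simp [reads_cons, ho, h3]⟩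

theorem GapSeq.exists_path {p : A.Q} {d : List Γ} {σ : List A.Q} (h : A.GapSeq p d σ) :
    ∃ π, A.IsPath p π ∧ A.gapStates p π = p :: σ ∧ reads (π.map Prod.fst) = d := by
  induction d generalizing p σ with
  | nil =>
    cases σ with
    | nil => exact ⟨[], trivial, rfl, rfl⟩
    | cons q σ => exact h.elim
  | cons a d ih =>
    cases σ with
    | nil => exact h.elim
    | cons q σ =>
      obtain ⟨⟨p', h1, h2⟩, h3⟩ := h
      obtain ⟨π, h4, h5, h6⟩ := ih h3
      obtain ⟨π', h7, h8, h9⟩ := h2.exists_path π h4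
      exact ⟨(letter a, p') :: π', ⟨h1, h7⟩, by simp [gapStates, letter?, h8, h5],
        by simp [reads_cons, letter?, h9, h6]⟩

/-- The runs on `d` with given gap states. -/
theorem exists_isRun_iff {d : List Γ} {q : A.Q} {σ : List A.Q} :
    (∃ ρ, A.IsRun d ρ ∧ A.gapStates ρ.1 ρ.2 = q :: σ) ↔
      (∃ p, A.init p ≠ 0 ∧ A.Gap p q) ∧ A.GapSeq q d σ ∧
        A.final ((q :: σ).getLast (List.cons_ne_nil _ _)) ≠ 0 := by
  constructor
  · rintro ⟨⟨p, π⟩, ⟨h1, h2, h3, h4⟩, h5⟩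
    obtain ⟨q', σ', h6, h7, h8⟩ := gapSeq_of_isPath h2
    simp only at h5
    rw [h5] at h6
    cases h6
    rw [← getLast_gapStates] at h3
    simp only [h5] at h3
    exact ⟨⟨p, h1, h7⟩, by rw [← h4]; exact h8, h3⟩
  · rintro ⟨⟨p, h1, h2⟩, h3, h4⟩
    obtain ⟨π, h5, h6, h7⟩ := h3.exists_path
    obtain ⟨π', h8, h9, h10⟩ := h2.exists_path π h5
    refine ⟨(p, π'), ⟨h1, h8, ?_, h10.trans h7⟩, h9.trans h6⟩
    rw [← getLast_gapStates]
    simp only [h9, h6]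
    exact h4

section Bool

variable {M : WVSA Γ V BoolSR}

theorem pathWeight_ne_zero {p : M.Q} {π : List (Label Γ {x // x ∈ V} × M.Q)}
    (h : M.IsPath p π) : M.pathWeight p π ≠ 0 := by
  induction π generalizing p with
  | nil => exact BoolSR.one_ne_zero
  | cons s π ih => exact BoolSR.mul_ne_zero.2 ⟨h.1, ih h.2⟩

theorem mem_runs {d : List Γ} {ρ : M.RunData} :
    ρ ∈ M.runs d ↔ M.IsRun d ρ ∧ Valid (M.labels ρ) :=
  ⟨fun h => ⟨h.1, h.2.1⟩, fun h => ⟨h.1, h.2, BoolSR.mul_ne_zero.2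
    ⟨BoolSR.mul_ne_zero.2 ⟨h.1.1, pathWeight_ne_zero h.1.2.1⟩, h.1.2.2.1⟩⟩⟩

theorem Functional.mem_runs (hM : M.Functional) {d : List Γ} {ρ : M.RunData} :
    ρ ∈ M.runs d ↔ M.IsRun d ρ :=
  WVSA.mem_runs.trans ⟨And.left, fun h => ⟨h, hM _ _ h⟩⟩

theorem sem_ne_zero [Finite Γ] {d : List Γ} {t : SpanTuple V d} :
    M.sem d t ≠ 0 ↔ ∃ ρ, M.IsRun d ρ ∧ Valid (M.labels ρ) ∧ M.Selects ρ t := by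
  -- Finiteness lets the `finsum` in `sem` be rewritten as an ordinary finite sum, which over the
  -- Boolean semiring is nonzero as soon as one term is.
  have hf : {ρ | ρ ∈ M.runs d ∧ M.Selects ρ t}.Finite := (M.finite_runs d).subset fun ρ h => h.1
  rw [sem, finsum_mem_eq_finite_toFinset_sum _ hf, BoolSR.sum_ne_zero]
  simp only [Set.Finite.mem_toFinset, Set.mem_ofPred_eq]
  constructor
  · rintro ⟨ρ, ⟨h1, h2⟩, -⟩
    exact ⟨ρ, h1.1, h1.2.1, h2⟩
  · rintro ⟨ρ, h1, h2, h3⟩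
    have := WVSA.mem_runs.2 ⟨h1, h2⟩
    exact ⟨ρ, ⟨this, h3⟩, this.2.2⟩

end Bool

end WVSA

/-! ### The joint automaton of P and the factors. -/

namespace WVSA

open Label

variable {Γ X : Type} {V : Finset X} {ι : Type} {W : ι → Finset X}

/-- The transitions of the gap states of a family of automata along a transition of another
automaton that starts in `p`. -/
inductive FactorStep (P : WVSA Γ V BoolSR) (S : ∀ i, WVSA Γ (W i) BoolSR) (p : P.Q) :
    Label Γ {x // x ∈ V} → (Σ i, (S i).Q) → (Σ i, (S i).Q) → Prop
  | stay {o u} : o.letter? = none → FactorStep P S p o u u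
  | move {i a} {s s' s'' : (S i).Q} : P.Agree (S i) p s → (S i).δ s (letter a) s' ≠ 0 →
      (S i).Gap s' s'' → FactorStep P S p (letter a) ⟨i, s⟩ ⟨i, s''⟩

open Classical in
/-- The automaton that runs `P` together with one of the automata `S i` of weight `w i`, of which
it only sees the gap states. -/
noncomputable def softJoin [Finite ι] (P : WVSA Γ V BoolSR) (S : ∀ i, WVSA Γ (W i) BoolSR)
    (w : ι → ℝ) : WVSA Γ V ℝ where
  Q := P.Q × Σ i, (S i).Q
  init x := if P.init x.1 ≠ 0 ∧ ∃ q, (S x.2.1).init q ≠ 0 ∧ (S x.2.1).Gap q x.2.2 then w x.2.1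
    else 0
  final x := if P.final x.1 ≠ 0 ∧ (S x.2.1).final x.2.2 ≠ 0 ∧ P.Agree (S x.2.1) x.1 x.2.2 then 1
    else 0
  δ x o y := if P.δ x.1 o y.1 ≠ 0 ∧ FactorStep P S x.1 o x.2 y.2 then 1 else 0
  -- An ε-transition of the joint automaton projects to one of P, so an ε-cycle would project to an
  -- ε-cycle of P.
  noEpsCycle x h := P.noEpsCycle x.1 (Relation.TransGen.lift (p := fun p p' => P.δ p Label.eps p' ≠ 0)
    Prod.fst (fun _ _ hab hc => hab (if_neg fun h => h.1 hc)) x x h)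

variable [Finite ι] {P : WVSA Γ V BoolSR} {S : ∀ i, WVSA Γ (W i) BoolSR} {w : ι → ℝ}

theorem softJoin_init_ne_zero {x : (softJoin P S w).Q} : (softJoin P S w).init x ≠ 0 ↔
    (P.init x.1 ≠ 0 ∧ ∃ q, (S x.2.1).init q ≠ 0 ∧ (S x.2.1).Gap q x.2.2) ∧ w x.2.1 ≠ 0 := by
  simp only [softJoin]; split_ifs with h <;> simp [h]

theorem softJoin_init_eq {x : (softJoin P S w).Q} (h : (softJoin P S w).init x ≠ 0) :
    (softJoin P S w).init x = w x.2.1 := by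
  simp only [softJoin] at h ⊢; split_ifs with h' <;> simp_all

theorem softJoin_final_ne_zero {x : (softJoin P S w).Q} : (softJoin P S w).final x ≠ 0 ↔
    P.final x.1 ≠ 0 ∧ (S x.2.1).final x.2.2 ≠ 0 ∧ P.Agree (S x.2.1) x.1 x.2.2 := by
  simp only [softJoin]; split_ifs with h <;> simp [h]

theorem softJoin_final_eq {x : (softJoin P S w).Q} (h : (softJoin P S w).final x ≠ 0) :
    (softJoin P S w).final x = 1 := by
  simp only [softJoin] at h ⊢; split_ifs with h' <;> simp_all

theorem softJoin_δ_ne_zero {x y : (softJoin P S w).Q} {o : Label Γ {x // x ∈ V}} :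
    (softJoin P S w).δ x o y ≠ 0 ↔ P.δ x.1 o y.1 ≠ 0 ∧ FactorStep P S x.1 o x.2 y.2 := by
  simp only [softJoin]; split_ifs with h <;> simp [h]

theorem softJoin_δ_eq {x y : (softJoin P S w).Q} {o : Label Γ {x // x ∈ V}}
    (h : (softJoin P S w).δ x o y ≠ 0) : (softJoin P S w).δ x o y = 1 := by
  simp only [softJoin] at h ⊢; split_ifs with h' <;> simp_all

theorem softJoin_pathWeight {x : (softJoin P S w).Q}
    {π : List (Label Γ {x // x ∈ V} × (softJoin P S w).Q)} (h : (softJoin P S w).IsPath x π) :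
    (softJoin P S w).pathWeight x π = 1 := by
  induction π generalizing x with
  | nil => rfl
  | cons s π ih => simp [pathWeight, softJoin_δ_eq h.1, ih h.2]

theorem softJoin_weight {d : List Γ} {ρ : (softJoin P S w).RunData}
    (h : (softJoin P S w).IsRun d ρ) : (softJoin P S w).weight ρ = w ρ.1.2.1 := by
  rw [weight, softJoin_init_eq h.1, softJoin_pathWeight h.2.1, softJoin_final_eq h.2.2.1]
  ring

/-- The part of a run of the joint automaton that runs `P`. -/
def projRun (ρ : (softJoin P S w).RunData) : P.RunData :=
  (ρ.1.1, ρ.2.map fun s => (s.1, s.2.1))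

theorem labels_projRun (ρ : (softJoin P S w).RunData) :
    P.labels (projRun ρ) = (softJoin P S w).labels ρ := by
  simp [projRun, labels, Function.comp_def]

/-- The component of a state of the joint automaton that belongs to the family of automata. -/
abbrev factorState (x : (softJoin P S w).Q) : Σ i, (S i).Q := x.2

/-- The factor component is constant between letters, so its current value is visible at the next
gap. -/
theorem head_gapStates_softJoin {x : (softJoin P S w).Q}
    {π : List (Label Γ {x // x ∈ V} × (softJoin P S w).Q)} (h : (softJoin P S w).IsPath x π) :
    (((softJoin P S w).gapStates x π).map factorState).head? = some x.2 := by
  induction π generalizing x with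
  | nil => rfl
  | cons s π ih =>
    obtain ⟨o, y⟩ := s
    have h1 := (softJoin_δ_ne_zero.1 h.1).2
    obtain ⟨x1, x2⟩ := x
    obtain ⟨y1, y2⟩ := y
    cases h1 with
    | stay ho => simpa [gapStates, ho] using ih h.2
    | move _ _ _ => rfl

/-- By `head_gapStates_softJoin` the factor component after each step can be read off from the gap
states of the remaining path, so nothing beyond the projection to P and these states is free. -/
theorem softJoin_path_ext {x : (softJoin P S w).Q}
    {π π' : List (Label Γ {x // x ∈ V} × (softJoin P S w).Q)}
    (h : (softJoin P S w).IsPath x π) (h' : (softJoin P S w).IsPath x π')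
    (h1 : (π.map fun s => (s.1, s.2.1)) = π'.map fun s => (s.1, s.2.1))
    (h2 : ((softJoin P S w).gapStates x π).map factorState =
      ((softJoin P S w).gapStates x π').map factorState) : π = π' := by
  induction π generalizing x π' with
  | nil =>
    cases π' with
    | nil => rfl
    | cons _ _ => simp at h1
  | cons s π ih =>
    cases π' with
    | nil => simp at h1
    | cons s' π' =>
      obtain ⟨o, y1, y2⟩ := s
      obtain ⟨o', y1', y2'⟩ := s'
      simp only [List.map_cons, List.cons.injEq, Prod.mk.injEq] at h1
      obtain ⟨⟨rfl, rfl⟩, h1⟩ := h1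
      have h3 : ((softJoin P S w).gapStates (y1, y2) π).map factorState =
          ((softJoin P S w).gapStates (y1, y2') π').map factorState := by
        by_cases ho : o.letter?.isSome
        · simpa [gapStates, ho] using h2
        · simpa [gapStates, ho] using h2
      obtain rfl : y2 = y2' := by
        have h4 := head_gapStates_softJoin h.2
        have h5 := head_gapStates_softJoin h'.2
        rw [h3, h5] at h4
        exact (Option.some.inj h4).symm
      rw [ih h.2 h'.2 h1 h3]

/-- Each gap is tested for agreement exactly once: in the state right before its closing letter, or
by the final weight in the case of the last gap. Thus an accepting joint path is an accepting path
of P together with a gap sequence of one factor that agrees with it everywhere;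
`exists_softJoin_path` is the converse. -/
theorem softJoin_path_split {p : P.Q} {i : ι} {s : (S i).Q}
    {π : List (Label Γ {x // x ∈ V} × (softJoin P S w).Q)}
    (h : (softJoin P S w).IsPath (p, ⟨i, s⟩) π)
    (hf : (softJoin P S w).final ((softJoin P S w).lastState (p, ⟨i, s⟩) π) ≠ 0) :
    P.IsPath p (π.map fun s => (s.1, s.2.1)) ∧
    P.final (P.lastState p (π.map fun s => (s.1, s.2.1))) ≠ 0 ∧
    ∃ σ, ((softJoin P S w).gapStates (p, ⟨i, s⟩) π).map factorState = (s :: σ).map (Sigma.mk i) ∧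
      (S i).GapSeq s (reads (π.map Prod.fst)) σ ∧
      (S i).final ((s :: σ).getLast (List.cons_ne_nil _ _)) ≠ 0 ∧
      List.Forall₂ (P.Agree (S i)) (P.gapStates p (π.map fun s => (s.1, s.2.1))) (s :: σ) := by
  induction π generalizing p s with
  | nil =>
    have hf := softJoin_final_ne_zero.1 hf
    exact ⟨trivial, hf.1, [], rfl, trivial, hf.2.1, .cons hf.2.2 .nil⟩
  | cons e π ih =>
    obtain ⟨o, p', u⟩ := e
    have h1 := softJoin_δ_ne_zero.1 h.1
    obtain ⟨h0, h1⟩ := h1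
    dsimp only at h0 h1
    cases h1 with
    | stay ho =>
      obtain ⟨h2, h3, σ, h4, h5, h6, h7⟩ := ih h.2 hf
      exact ⟨⟨h0, h2⟩, h3, σ, by simpa [gapStates, ho] using h4,
        by simpa [reads_cons, ho] using h5, h6, by simpa [gapStates, ho] using h7⟩
    | @move _ a _ s' s'' ha hδ hg =>
      obtain ⟨h2, h3, σ, h4, h5, h6, h7⟩ := ih h.2 hf
      exact ⟨⟨h0, h2⟩, h3, s'' :: σ, congrArg (List.cons _) h4,
        ⟨⟨s', hδ, hg⟩, h5⟩, by simpa using h6, by simpa [gapStates, letter?] using ⟨ha, h7⟩⟩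

theorem exists_softJoin_path {p : P.Q} {i : ι} {s : (S i).Q}
    {π : List (Label Γ {x // x ∈ V} × P.Q)} {σ : List (S i).Q} (h : P.IsPath p π)
    (hf : P.final (P.lastState p π) ≠ 0) (hσ : (S i).GapSeq s (reads (π.map Prod.fst)) σ)
    (hf' : (S i).final ((s :: σ).getLast (List.cons_ne_nil _ _)) ≠ 0)
    (ha : List.Forall₂ (P.Agree (S i)) (P.gapStates p π) (s :: σ)) :
    ∃ π', (softJoin P S w).IsPath (p, ⟨i, s⟩) π' ∧
      (softJoin P S w).final ((softJoin P S w).lastState (p, ⟨i, s⟩) π') ≠ 0 ∧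
      (π'.map fun s => (s.1, s.2.1)) = π ∧
      ((softJoin P S w).gapStates (p, ⟨i, s⟩) π').map factorState = (s :: σ).map (Sigma.mk i) := by
  induction π generalizing p s σ with
  | nil =>
    cases σ with
    | nil =>
      exact ⟨[], trivial, softJoin_final_ne_zero.2 ⟨hf, hf', (List.forall₂_cons.1 ha).1⟩, rfl, rfl⟩
    | cons _ _ => exact hσ.elim
  | cons e π ih =>
    obtain ⟨o, p'⟩ := e
    by_cases ho : ∃ a, o = letter a
    · obtain ⟨a, rfl⟩ := ho
      cases σ with
      | nil => exact hσ.elim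
      | cons s'' σ =>
        obtain ⟨⟨s', h1, h2⟩, h3⟩ := hσ
        simp only [gapStates, letter?, Option.isSome_some, if_true, List.forall₂_cons] at ha
        obtain ⟨π', h4, h5, rfl, h6⟩ := ih (s := s'') h.2 hf h3 (by simpa using hf')
          ha.2
        exact ⟨(letter a, (p', ⟨i, s''⟩)) :: π',
          ⟨softJoin_δ_ne_zero.2 ⟨h.1, .move ha.1 h1 h2⟩, h4⟩, h5, rfl,
          congrArg (List.cons _) h6⟩
    · have ho' : o.letter? = none := by cases o <;> simp_all [letter?]
      obtain ⟨π', h4, h5, rfl, h6⟩ := ih (s := s) (σ := σ) h.2 hf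
        (by simpa [reads_cons, ho'] using hσ) hf' (by simpa [gapStates, ho'] using ha)
      exact ⟨(o, (p', ⟨i, s⟩)) :: π', ⟨softJoin_δ_ne_zero.2 ⟨h.1, .stay ho'⟩, h4⟩, h5, rfl,
        by simpa [gapStates, ho'] using h6⟩

theorem Agree.refl {K : Type} [CommSemiring K] {A : WVSA Γ V K} (q : A.Q) : A.Agree A q q :=
  fun _ _ _ _ _ _ => Iff.rfl

/-- Runs of a functional automaton with the same gap states select the same tuple. -/
theorem Functional.selects_unique {K : Type} [CommSemiring K] {A : WVSA Γ V K}
    (hA : A.Functional) {d : List Γ} {ρ ρ' : A.RunData} (hρ : A.IsRun d ρ) (hρ' : A.IsRun d ρ')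
    {t t' : SpanTuple V d} (ht : A.Selects ρ t) (ht' : A.Selects ρ' t')
    (h : A.gapStates ρ.1 ρ.2 = A.gapStates ρ'.1 ρ'.2) : t = t' := by
  have := (joinable_iff hA hA hρ hρ' ht ht').2
    (by rw [h]; exact List.forall₂_same.2 fun _ _ => Agree.refl _)
  exact funext fun v => this v.1 v.2 v.2

/-- The runs of the joint automaton that select t are in bijection with the joinable tuples of
factors of nonzero weight, and each such run weighs w(i). The condition w(i) ≠ 0 is forced because a
run needs a nonzero initial weight. -/
theorem softJoin_sem [Finite Γ] [Fintype ι] (hP : P.Functional) (hPu : P.Unambiguous)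
    (hS : ∀ i, (S i).Functional) (hSu : ∀ i, (S i).Unambiguous) (d : List Γ)
    (t : SpanTuple V d) (ht : P.sem d t ≠ 0) :
    (softJoin P S w).sem d t = ∑ᶠ (x : Σ i, SpanTuple (W i) d)
      (_ : x ∈ {x | (S x.1).sem d x.2 ≠ 0 ∧ Joinable t x.2 ∧ w x.1 ≠ 0}), w x.1 := by
  set A := softJoin P S w
  let T : Set A.RunData := {ρ | ρ ∈ A.runs d ∧ A.Selects ρ t}
  let I : Set (Σ i, SpanTuple (W i) d) :=
    {x | (S x.1).sem d x.2 ≠ 0 ∧ Joinable t x.2 ∧ w x.1 ≠ 0}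
  let Corr : (Σ i, SpanTuple (W i) d) → A.RunData → Prop := fun x ρ =>
    ∃ ρ' : (S x.1).RunData, (S x.1).IsRun d ρ' ∧ (S x.1).Selects ρ' x.2 ∧
      (A.gapStates ρ.1 ρ.2).map factorState = ((S x.1).gapStates ρ'.1 ρ'.2).map (Sigma.mk x.1)
  obtain ⟨ρP, ⟨hρP, hρPt⟩, huP⟩ := hPu d t ht
  rw [hP.mem_runs] at hρP
  -- Unambiguity of P fixes the first component of all joint runs over t.
  have proj : ∀ ρ ∈ T, projRun ρ = ρP := by
    intro ρ hρ
    obtain ⟨⟨⟨h1, h2, h3, h4⟩, hv, -⟩, hsel⟩ := hρ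
    have h5 := softJoin_path_split h2 h3
    refine huP _ ⟨hP.mem_runs.2 ⟨(softJoin_init_ne_zero.1 h1).1.1, h5.1, h5.2.1, ?_⟩, ?_⟩
    · rw [labels_projRun]; exact h4
    · unfold Selects at hsel ⊢; rw [labels_projRun]; exact hsel
  have fwd : ∀ x ∈ I, ∃ ρ ∈ T, Corr x ρ := by
    rintro ⟨i, t'⟩ ⟨h1, h2, h3⟩
    obtain ⟨ρ', h4, -, h5⟩ := sem_ne_zero.1 h1
    obtain ⟨q, σ, h6⟩ : ∃ q σ, (S i).gapStates ρ'.1 ρ'.2 = q :: σ :=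
      List.exists_cons_of_ne_nil (gapStates_ne_nil _ _)
    obtain ⟨h7, h8, h9⟩ := exists_isRun_iff.1 ⟨ρ', h4, h6⟩
    have h10 := (joinable_iff hP (hS i) hρP h4 hρPt h5).1 h2
    rw [h6] at h10
    obtain ⟨π, h11, h12, h13, h14⟩ := exists_softJoin_path (w := w) hρP.2.1 hρP.2.2.1
      (show (S i).GapSeq q (reads (P.labels ρP)) σ by rw [hρP.2.2.2]; exact h8) h9 h10
    have hl : A.labels ((ρP.1, ⟨i, q⟩), π) = P.labels ρP := by
      rw [← labels_projRun]; simp only [projRun]; rw [h13]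
    have hrun : A.IsRun d ((ρP.1, ⟨i, q⟩), π) :=
      ⟨softJoin_init_ne_zero.2 ⟨⟨hρP.1, h7⟩, h3⟩, h11, h12, by rw [hl]; exact hρP.2.2.2⟩
    refine ⟨_, ⟨⟨hrun, ?_, ?_⟩, ?_⟩, ρ', h4, h5, ?_⟩
    · rw [hl]; exact hP _ _ hρP
    · rw [softJoin_weight hrun]; exact h3
    · unfold Selects; rw [hl]; exact hρPt
    · simp only [h6]; exact h14
  have bwd : ∀ ρ ∈ T, ∃ x ∈ I, Corr x ρ := by
    intro ρ hρ
    have hpr := proj ρ hρ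
    obtain ⟨⟨⟨h1, h2, h3, h4⟩, hv, -⟩, hsel⟩ := hρ
    obtain ⟨⟨p, i, s⟩, π⟩ := ρ
    obtain ⟨-, -, σ, h5, h6, h7, h8⟩ := softJoin_path_split h2 h3
    have h9 := softJoin_init_ne_zero.1 h1
    obtain ⟨ρ', h10, h11⟩ := exists_isRun_iff.2 ⟨h9.1.2, h6, h7⟩
    rw [show reads (π.map Prod.fst) = d from h4] at h10
    obtain ⟨t', ht'⟩ := exists_selects h10.2.2.2 (hS i _ _ h10)
    refine ⟨⟨i, t'⟩, ⟨sem_ne_zero.2 ⟨ρ', h10, hS i _ _ h10, ht'⟩, ?_, h9.2⟩, ρ', h10, ht', ?_⟩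
    · refine (joinable_iff hP (hS i) hρP h10 hρPt ht').2 ?_
      rw [h11, ← hpr]; exact h8
    · rw [h11]; exact h5
  -- The first gap state reveals which factor runs; then equal gap states force equal tuples by
  -- functionality.
  have uniq_l : ∀ x y ρ, Corr x ρ → Corr y ρ → x = y := by
    rintro ⟨i, t'⟩ ⟨j, t''⟩ ρ ⟨ρ', h1, h2, h3⟩ ⟨ρ'', h4, h5, h6⟩
    have h7 := h3.symm.trans h6
    dsimp only at h7
    obtain rfl : i = j := by
      obtain ⟨q, σ, h8⟩ := List.exists_cons_of_ne_nil (gapStates_ne_nil ρ'.1 ρ'.2)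
      obtain ⟨q', σ', h9⟩ := List.exists_cons_of_ne_nil (gapStates_ne_nil ρ''.1 ρ''.2)
      rw [h8, h9] at h7
      simp only [List.map_cons, List.cons.injEq] at h7
      exact congrArg Sigma.fst h7.1
    have h8 := List.map_injective_iff.2 sigma_mk_injective h7
    exact congrArg (Sigma.mk i) ((hS i).selects_unique h1 h4 h2 h5 h8)
  -- Unambiguity of the factor gives both joint runs the same factor gap states, and `proj` gives
  -- them the same projection to P.
  have uniq_r : ∀ x, ∀ ρ₁ ∈ T, ∀ ρ₂ ∈ T, Corr x ρ₁ → Corr x ρ₂ → ρ₁ = ρ₂ := by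
    rintro ⟨i, t'⟩ ρ₁ hρ₁ ρ₂ hρ₂ ⟨ρ', h1, h2, h3⟩ ⟨ρ'', h4, h5, h6⟩
    have h7 := hS i _ _ h1
    obtain ⟨ρ₀, -, hu⟩ := hSu i d t' (sem_ne_zero.2 ⟨ρ', h1, h7, h2⟩)
    obtain rfl : ρ' = ρ'' := (hu _ ⟨(hS i).mem_runs.2 h1, h2⟩).trans
      (hu _ ⟨(hS i).mem_runs.2 h4, h5⟩).symm
    have h8 : projRun ρ₁ = projRun ρ₂ := (proj _ hρ₁).trans (proj _ hρ₂).symm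
    have h9 := h3.trans h6.symm
    have p1 := hρ₁.1.1.2.1
    have p2 := hρ₂.1.1.2.1
    have e1 := head_gapStates_softJoin p1
    have e2 := head_gapStates_softJoin p2
    rw [h9, e2] at e1
    obtain ⟨⟨x1, x2⟩, π⟩ := ρ₁
    obtain ⟨⟨y1, y2⟩, π'⟩ := ρ₂
    simp only [projRun, Prod.mk.injEq] at h8
    obtain ⟨rfl, h8⟩ := h8
    obtain rfl : y2 = x2 := Option.some.inj e1
    exact congrArg (Prod.mk _) (softJoin_path_ext p1 p2 h8 h9)
  symm
  rcases I.eq_empty_or_nonempty with hI | ⟨x₀, hx₀⟩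
  · rw [show {x : Σ i, SpanTuple (W i) d | (S x.1).sem d x.2 ≠ 0 ∧ Joinable t x.2 ∧ w x.1 ≠ 0} = ∅
      from hI, finsum_mem_empty]
    refine (finsum_mem_eq_zero_of_forall_eq_zero fun ρ hρ => ?_).symm
    obtain ⟨x, hx, -⟩ := bwd ρ hρ
    rw [hI] at hx
    exact hx.elim
  -- Choosing a total map of tuples to runs needs some run as a default value, which is why the
  -- empty case was treated separately.
  have : Nonempty A.RunData := ⟨(fwd x₀ hx₀).choose⟩
  choose! e he using fwd
  refine finsum_mem_eq_of_bijOn e ⟨fun x hx => (he x hx).1, ?_, ?_⟩ ?_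
  · intro x hx y hy hxy
    exact uniq_l x y (e x) (he x hx).2 (by rw [hxy]; exact (he y hy).2)
  · intro ρ hρ
    obtain ⟨x, hx, hxρ⟩ := bwd ρ hρ
    exact ⟨x, hx, uniq_r x _ (he x hx).1 _ hρ (he x hx).2 hxρ⟩
  · intro x hx
    obtain ⟨h1, ρ', h2, h3, h4⟩ := he x hx
    rw [softJoin_weight h1.1.1]
    have e1 := head_gapStates_softJoin h1.1.1.2.1
    obtain ⟨q, σ, h8⟩ := List.exists_cons_of_ne_nil (gapStates_ne_nil ρ'.1 ρ'.2)
    rw [h4, h8] at e1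
    rw [← Option.some.inj e1]

/-- A joint run carries the labels of its projection to P, so it would witness that P selects t. -/
theorem softJoin_sem_eq_zero [Finite Γ] (d : List Γ) (t : SpanTuple V d) (ht : P.sem d t = 0) :
    (softJoin P S w).sem d t = 0 := by
  refine finsum_mem_eq_zero_of_forall_eq_zero fun ρ hρ => ?_
  exfalso
  obtain ⟨⟨⟨h1, h2, h3, h4⟩, hv, -⟩, hsel⟩ := hρ
  have h5 := softJoin_path_split h2 h3
  refine sem_ne_zero.2 ⟨projRun ρ, ⟨(softJoin_init_ne_zero.1 h1).1.1, h5.1, h5.2.1, ?_⟩, ?_, ?_⟩ ht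
  · rw [labels_projRun]; exact h4
  · rw [labels_projRun]; exact hv
  · unfold Selects at hsel ⊢; rw [labels_projRun]; exact hsel

end WVSA

theorem SoftSpanner.compiledBy_softJoin {Γ X : Type} [Finite Γ] (Q : SoftSpanner Γ X)
    {P : WVSA Γ Q.P.vars BoolSR} {S : ∀ i : {S // S ∈ Q.factors}, WVSA Γ i.1.vars BoolSR}
    (hP : P.Functional) (hPu : P.Unambiguous) (hPr : P.Represents)
    (hS : ∀ i, (S i).Functional) (hSu : ∀ i, (S i).Unambiguous) (hSr : ∀ i, (S i).Represents) :
    Q.CompiledBy (WVSA.softJoin P S Q.w) := by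
  classical
  intro d t
  refine ⟨fun ht => ?_, fun ht => WVSA.softJoin_sem_eq_zero d t (by rw [hPr]; exact ht)⟩
  rw [WVSA.softJoin_sem hP hPu hS hSu d t (by rw [hPr]; exact ht), qHat, Real.log_exp]
  have hfin : ∀ i, Finite (SpanTuple (i : {S // S ∈ Q.factors}).1.vars d) := fun i => inferInstance
  rw [finsum_mem_eq_finite_toFinset_sum _ (Set.toFinite _), Finset.sum_sigma']
  -- The pairs missing from the sum over runs are those with w(S) = 0, which contribute nothing to
  -- the exponent.
  refine Finset.sum_subset_zero_on_sdiff ?_ ?_ fun _ _ => rfl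
  · rintro ⟨i, t'⟩ h
    simp only [Set.Finite.mem_toFinset, Set.mem_ofPred_eq] at h
    simpa [← hSr i d t'] using ⟨h.1, h.2.1⟩
  · rintro ⟨i, t'⟩ h
    simp only [Finset.mem_sdiff, Finset.mem_sigma, Finset.mem_univ, Finset.mem_filter, true_and,
      Set.Finite.mem_toFinset, Set.mem_ofPred_eq, ← hSr i d t'] at h
    by_contra hw
    exact h.2 ⟨h.1.1, h.1.2, hw⟩

/-! ### Validity checked step by step through the set of operations done. -/

namespace Label

variable {Γ V : Type}

/-- An operation may follow when exactly the operations in `c` are done. -/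
def Allowed (c : Set (Bool × V)) (x : Bool × V) : Prop := x ∉ c ∧ (x.1 = true → (false, x.2) ∈ c)

/-- The effect of a label on the set of the operations that are done. -/
def ConfStep (c : Set (Bool × V)) (o : Label Γ V) (c' : Set (Bool × V)) : Prop :=
  match o with
  | letter _ => c' = c
  | eps => c' = c
  | opn v => Allowed c (false, v) ∧ c' = insert (false, v) c
  | cls v => Allowed c (true, v) ∧ c' = insert (true, v) c

theorem confStep_op {c c' : Set (Bool × V)} {b : Bool} {v : V} :
    ConfStep c (op b v : Label Γ V) c' ↔ Allowed c (b, v) ∧ c' = insert (b, v) c := by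
  cases b <;> rfl

theorem confStep_cases {c c' : Set (Bool × V)} {o : Label Γ V} (h : ConfStep c o c') :
    ((∀ b v, o ≠ op b v) ∧ c' = c) ∨
      ∃ b v, o = op b v ∧ Allowed c (b, v) ∧ c' = insert (b, v) c := by
  rcases cases_letter o with ⟨a, rfl⟩ | rfl | ⟨b, v, rfl⟩
  · exact .inl ⟨fun b v => by cases b <;> simp [op], h⟩
  · exact .inl ⟨fun b v => by cases b <;> simp [op], h⟩
  · exact .inr ⟨b, v, rfl, confStep_op.1 h⟩

theorem ConfStep.subset {c c' : Set (Bool × V)} {o : Label Γ V} (h : ConfStep c o c') :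
    c ⊆ c' := by
  rcases confStep_cases h with ⟨-, rfl⟩ | ⟨b, v, -, -, rfl⟩
  · exact subset_rfl
  · exact Set.subset_insert _ _

theorem ConfStep.closed {c c' : Set (Bool × V)} {o : Label Γ V} (h : ConfStep c o c')
    (hc : ∀ v, (true, v) ∈ c → (false, v) ∈ c) (v : V) (hv : (true, v) ∈ c') :
    (false, v) ∈ c' := by
  rcases confStep_cases h with ⟨-, rfl⟩ | ⟨b, v', -, ha, rfl⟩
  · exact hc v hv
  · rcases hv with hv | hv
    · cases hv; exact .inr (ha.2 rfl)
    · exact .inr (hc v hv)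

/-- A label sequence that completes the operations in `c` to a valid sequence. -/
def Completes : Set (Bool × V) → List (Label Γ V) → Prop
  | c, [] => c = Set.univ
  | c, o :: ls => ∃ c', ConfStep c o c' ∧ Completes c' ls

/-- An operation enters the set only when it is performed, is then never allowed again, and must
have been performed by the end. -/
theorem Completes.op_mem_iff {c : Set (Bool × V)} {ls : List (Label Γ V)} (h : Completes c ls)
    (b : Bool) (v : V) : (b, v) ∉ c ↔ op b v ∈ ls := by
  induction ls generalizing c with
  | nil => cases (show c = Set.univ from h); simp
  | cons o ls ih =>
    obtain ⟨c', h1, h2⟩ := h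
    have := ih h2
    rcases confStep_cases h1 with ⟨hne, rfl⟩ | ⟨b', v', rfl, ha, rfl⟩
    · rw [this, List.mem_cons]
      exact ⟨.inr, fun h => h.resolve_left fun h => hne _ _ h.symm⟩
    · rw [List.mem_cons, ← this, op_inj, Set.mem_insert_iff, Prod.mk.injEq]
      by_cases hbv : b = b' ∧ v = v'
      · obtain ⟨rfl, rfl⟩ := hbv
        simp [ha.1]
      · tauto

theorem Completes.exists_cls {c : Set (Bool × V)} {ls : List (Label Γ V)} (h : Completes c ls)
    {v : V} (ho : (false, v) ∈ c) (hc : (true, v) ∉ c) :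
    ∃ l₂ l₃, ls = l₂ ++ cls v :: l₃ ∧ opn v ∉ l₂ ++ l₃ ∧ cls v ∉ l₂ ++ l₃ := by
  induction ls generalizing c with
  | nil => cases (show c = Set.univ from h); simp at hc
  | cons o ls ih =>
    have h0 := h
    obtain ⟨c', h1, h2⟩ := h
    have hopn : opn v ∉ o :: ls := fun hm => (h0.op_mem_iff false v).2 hm ho
    simp only [List.mem_cons, not_or] at hopn
    by_cases ho' : o = cls v
    · subst ho'
      have := (confStep_op (b := true)).1 h1
      have hcls : cls v ∉ ls := fun hm => (h2.op_mem_iff true v).2 hm (by rw [this.2]; simp)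
      exact ⟨[], ls, rfl, hopn.2, hcls⟩
    · have hc' : (true, v) ∉ c' := by
        rcases confStep_cases h1 with ⟨-, rfl⟩ | ⟨b', v', rfl, ha, rfl⟩
        · exact hc
        · rw [Set.mem_insert_iff, not_or]
          refine ⟨fun e => ho' ?_, hc⟩
          cases e; rfl
      obtain ⟨l₂, l₃, rfl, h3, h4⟩ := ih h2 (h1.subset ho) hc'
      refine ⟨o :: l₂, l₃, rfl, ?_, ?_⟩
      · rw [List.cons_append, List.mem_cons, not_or]; exact ⟨hopn.1, h3⟩
      · rw [List.cons_append, List.mem_cons, not_or]; exact ⟨fun e => ho' e.symm, h4⟩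

theorem Completes.exists_opn {c : Set (Bool × V)} {ls : List (Label Γ V)} (h : Completes c ls)
    {v : V} (ho : (false, v) ∉ c) (hc : (true, v) ∉ c) :
    ∃ l₁ l₂ l₃, ls = l₁ ++ opn v :: (l₂ ++ cls v :: l₃) ∧
      opn v ∉ l₁ ++ l₂ ++ l₃ ∧ cls v ∉ l₁ ++ l₂ ++ l₃ := by
  induction ls generalizing c with
  | nil => cases (show c = Set.univ from h); simp at hc
  | cons o ls ih =>
    obtain ⟨c', h1, h2⟩ := h
    by_cases ho' : o = opn v
    · subst ho'
      obtain ⟨ha, rfl⟩ := (confStep_op (b := false)).1 h1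
      obtain ⟨l₂, l₃, rfl, h3, h4⟩ := h2.exists_cls (v := v) (by simp) (by simp [hc])
      exact ⟨[], l₂, l₃, rfl, h3, h4⟩
    · have ho'' : o ≠ cls v := by
        rintro rfl
        exact ho (((confStep_op (b := true)).1 h1).1.2 rfl)
      have key : ∀ b, (b, v) ∉ c → (b, v) ∉ c' := by
        intro b hb
        rcases confStep_cases h1 with ⟨-, rfl⟩ | ⟨b', v', rfl, ha, rfl⟩
        · exact hb
        · rw [Set.mem_insert_iff, not_or]
          refine ⟨fun e => ?_, hb⟩
          cases e
          cases b
          · exact ho' rfl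
          · exact ho'' rfl
      obtain ⟨l₁, l₂, l₃, rfl, h3, h4⟩ := ih h2 (key _ ho) (key _ hc)
      refine ⟨o :: l₁, l₂, l₃, rfl, ?_, ?_⟩
      · simp only [List.cons_append, List.mem_cons, not_or]; exact ⟨fun e => ho' e.symm, h3⟩
      · simp only [List.cons_append, List.mem_cons, not_or]; exact ⟨fun e => ho'' e.symm, h4⟩

theorem Completes.valid {ls : List (Label Γ V)} (h : Completes ∅ ls) : Valid ls :=
  fun _ => h.exists_opn (Set.notMem_empty _) (Set.notMem_empty _)

/-- The induction needs the configuration in explicit form: after a prefix it consists of the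
operations occurring in that prefix. -/
theorem Valid.completes_suffix (l₀ ls : List (Label Γ V)) (h : Valid (l₀ ++ ls)) :
    Completes {x | op x.1 x.2 ∈ l₀} ls := by
  induction ls generalizing l₀ with
  | nil =>
    refine Set.eq_univ_of_forall fun x => ?_
    simpa using h.op_mem x.1 x.2
  | cons o ls ih =>
    have h' := ih (l₀ ++ [o]) (by simpa using h)
    refine ⟨_, ?_, h'⟩
    rcases cases_letter o with ⟨a, rfl⟩ | rfl | ⟨b, v, rfl⟩
    · have : ∀ b v, (op b v : Label Γ V) ≠ letter a := fun b v => by cases b <;> simp [op]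
      simp [ConfStep, this]
    · have : ∀ b v, (op b v : Label Γ V) ≠ eps := fun b v => by cases b <;> simp [op]
      simp [ConfStep, this]
    · refine confStep_op.2 ⟨⟨?_, ?_⟩, ?_⟩
      · intro hm
        exact (h.op_not_mem b v).1 hm (by simp)
      · intro hb
        dsimp only at hb
        subst hb
        obtain ⟨l₁, l₂, l₃, e, h1, h2⟩ := h v
        have h3 : cls v ∉ l₁ ++ opn v :: l₂ := by
          simp only [List.mem_append, List.mem_cons, not_or] at h2 ⊢
          exact ⟨h2.1.1, by simp, h2.1.2⟩
        have h4 : cls v ∉ l₀ := fun hm => (h.op_not_mem true v).1 hm (by simp [op])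
        -- Validity places the opening of v before its only closing. Cutting both decompositions at
        -- that closing identifies the two prefixes, so the opening lies in `l₀`.
        have h5 : l₀ ++ cls v :: ls = (l₁ ++ opn v :: l₂) ++ cls v :: l₃ := by
          rw [show cls v = op true v from rfl, e]; simp [op]
        have h6 : l₀ = l₁ ++ opn v :: l₂ := by
          have := congrArg (List.takeWhile (fun o => open Classical in decide (o ≠ cls v))) h5
          rw [List.takeWhile_append_of_pos, List.takeWhile_append_of_pos] at this
          · simpa using this
          · intro o ho; simpa using fun e : o = cls v => h3 (e ▸ ho)
          · intro o ho; simpa using fun e : o = cls v => h4 (e ▸ ho)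
        show op false v ∈ l₀
        rw [h6]; simp [op]
      · ext ⟨b', v'⟩
        simp [or_comm]

theorem Valid.completes {ls : List (Label Γ V)} (h : Valid ls) : Completes ∅ ls := by
  simpa using Valid.completes_suffix [] ls h

end Label

/-! ### Automata whose states know the operations done. -/

namespace WVSA

open Label

variable {Γ X K : Type} {V : Finset X} [CommSemiring K]

/-- The states of the automaton know the set of the operations that are done. -/
structure Tracks (A : WVSA Γ V K) (conf : A.Q → Set (Bool × {x // x ∈ V})) : Prop where
  init : ∀ q, A.init q ≠ 0 → conf q = ∅
  final : ∀ q, A.final q ≠ 0 → conf q = Set.univ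
  step : ∀ p o q, A.δ p o q ≠ 0 → ConfStep (conf p) o (conf q)

namespace Tracks

variable {A : WVSA Γ V K} {conf : A.Q → Set (Bool × {x // x ∈ V})}

theorem completes (h : A.Tracks conf) {q : A.Q} {π : List (Label Γ {x // x ∈ V} × A.Q)}
    (hπ : A.IsPath q π) (hf : A.final (A.lastState q π) ≠ 0) :
    Completes (conf q) (π.map Prod.fst) := by
  induction π generalizing q with
  | nil => exact h.final _ hf
  | cons s π ih => exact ⟨_, h.step _ _ _ hπ.1, ih hπ.2 hf⟩

theorem functional (h : A.Tracks conf) : A.Functional := by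
  intro d ρ hρ
  have := h.completes hρ.2.1 hρ.2.2.1
  rw [h.init _ hρ.1] at this
  exact this.valid

/-- The counterpart of `Functional.pending_iff`: here the state itself records what is done, and the
rest of an accepted path performs precisely what is missing. -/
theorem conf_gapStates (h : A.Tracks conf) {d : List Γ} {ρ : A.RunData} (hρ : A.IsRun d ρ)
    (b : Bool) (v : {x // x ∈ V}) (i : ℕ) (hi : i < (A.gapStates ρ.1 ρ.2).length) :
    (b, v) ∉ conf (A.gapStates ρ.1 ρ.2)[i] ↔ i < position (op b v) (A.labels ρ) := by
  refine getElem_gapStates (p := fun s => (b, v) ∉ conf s)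
    (F := fun q π => A.IsPath q π ∧ A.final (A.lastState q π) ≠ 0) (letter?_op b v)
    (fun q π hq => (h.completes hq.1 hq.2).op_mem_iff b v) (fun q s π hq => ⟨hq.1.2, hq.2⟩) _ _
    ⟨hρ.2.1, hρ.2.2.1⟩ i hi

theorem conf_subset_of_gap (h : A.Tracks conf) {p q : A.Q} (hg : A.Gap p q) :
    conf p ⊆ conf q := by
  induction hg with
  | refl => exact subset_rfl
  | tail _ hs ih => obtain ⟨o, -, hs⟩ := hs; exact ih.trans (h.step _ _ _ hs).subset

theorem closed_of_gap (h : A.Tracks conf) {p q : A.Q} (hg : A.Gap p q)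
    (hc : ∀ v, (true, v) ∈ conf p → (false, v) ∈ conf p) :
    ∀ v, (true, v) ∈ conf q → (false, v) ∈ conf q := by
  induction hg with
  | refl => exact hc
  | tail _ hs ih => obtain ⟨o, -, hs⟩ := hs; exact (h.step _ _ _ hs).closed ih

/-- Two runs of tracking automata select the same tuple if the same operations are done in their
gap states. -/
theorem selects_iff {B : WVSA Γ V K} {conf' : B.Q → Set (Bool × {x // x ∈ V})}
    (h : A.Tracks conf) (h' : B.Tracks conf') {d : List Γ} {ρ : A.RunData} {ρ' : B.RunData}
    (hρ : A.IsRun d ρ) (hρ' : B.IsRun d ρ') {t : SpanTuple V d} (ht : A.Selects ρ t) :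
    B.Selects ρ' t ↔
      (A.gapStates ρ.1 ρ.2).map conf = (B.gapStates ρ'.1 ρ'.2).map conf' := by
  have hl : (A.gapStates ρ.1 ρ.2).length = d.length + 1 := by
    rw [length_gapStates]; exact congrArg (fun l => l.length + 1) hρ.2.2.2
  have hl' : (B.gapStates ρ'.1 ρ'.2).length = d.length + 1 := by
    rw [length_gapStates]; exact congrArg (fun l => l.length + 1) hρ'.2.2.2
  have hle : ∀ o, position o (A.labels ρ) ≤ d.length := fun o => by
    rw [← hρ.2.2.2]; exact position_le _ _
  have hle' : ∀ o, position o (B.labels ρ') ≤ d.length := fun o => by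
    rw [← hρ'.2.2.2]; exact position_le _ _
  rw [WVSA.selects_iff (h.functional _ _ hρ)] at ht
  rw [WVSA.selects_iff (h'.functional _ _ hρ')]
  have key : (∀ v, position (op false v) (B.labels ρ') = (t v).1.1 ∧
      position (op true v) (B.labels ρ') = (t v).1.2) ↔
      ∀ b v, position (op b v) (A.labels ρ) = position (op b v) (B.labels ρ') := by
    constructor
    · intro h1 b v
      cases b
      · rw [(h1 v).1, (ht v).1]
      · rw [(h1 v).2, (ht v).2]
    · intro h1 v
      rw [← h1, ← h1]; exact ht v
  rw [key]
  constructor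
  · intro h1
    refine List.ext_getElem (by simp [hl, hl']) fun i hi hi' => ?_
    simp only [List.getElem_map]
    simp only [List.length_map] at hi hi'
    ext ⟨b, v⟩
    rw [← not_iff_not, h.conf_gapStates hρ, h'.conf_gapStates hρ', h1]
  · intro h1 b v
    have h2 : ∀ i < d.length + 1, (i < position (op b v) (A.labels ρ) ↔
        i < position (op b v) (B.labels ρ')) := by
      intro i hi
      rw [← h.conf_gapStates hρ b v i (by omega), ← h'.conf_gapStates hρ' b v i (by omega)]
      have := List.getElem_of_eq h1 (show i < _ by simp [hl, hi])
      simp only [List.getElem_map] at this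
      rw [this]
    -- Testing the equivalence at the two positions themselves excludes that either is smaller.
    have h2' := h2 (position (op b v) (A.labels ρ)) (Nat.lt_succ_of_le (hle _))
    have h3' := h2 (position (op b v) (B.labels ρ')) (Nat.lt_succ_of_le (hle' _))
    omega

end Tracks

/-! ### Making an automaton functional. -/

section Track

open Classical in
/-- The product of an automaton with the sets of the operations that are done. -/
noncomputable def track (M : WVSA Γ V K) : WVSA Γ V K where
  Q := M.Q × Set (Bool × {x // x ∈ V})
  init x := if x.2 = ∅ then M.init x.1 else 0
  final x := if x.2 = Set.univ then M.final x.1 else 0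
  δ x o y := if ConfStep x.2 o y.2 then M.δ x.1 o y.1 else 0
  noEpsCycle x h := M.noEpsCycle x.1 (Relation.TransGen.lift (p := fun p p' => M.δ p Label.eps p' ≠ 0)
    Prod.fst (fun _ _ hab hc => hab (by rw [hc, ite_self])) x x h)

variable {M : WVSA Γ V K}

theorem track_init {x : M.track.Q} : M.track.init x ≠ 0 ↔ x.2 = ∅ ∧ M.init x.1 ≠ 0 := by
  simp only [track]; split_ifs with h <;> simp [h]

theorem track_final {x : M.track.Q} : M.track.final x ≠ 0 ↔ x.2 = Set.univ ∧ M.final x.1 ≠ 0 := by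
  simp only [track]; split_ifs with h <;> simp [h]

theorem track_δ {x y : M.track.Q} {o : Label Γ {x // x ∈ V}} :
    M.track.δ x o y ≠ 0 ↔ ConfStep x.2 o y.2 ∧ M.δ x.1 o y.1 ≠ 0 := by
  simp only [track]; split_ifs with h <;> simp [h]

theorem tracks_track (M : WVSA Γ V K) : M.track.Tracks Prod.snd where
  init _ h := (track_init.1 h).1
  final _ h := (track_final.1 h).1
  step _ _ _ h := (track_δ.1 h).1

theorem track_path {x : M.track.Q} {π : List (Label Γ {x // x ∈ V} × M.track.Q)}
    (h : M.track.IsPath x π) (hf : M.track.final (M.track.lastState x π) ≠ 0) :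
    M.IsPath x.1 (π.map fun s => (s.1, s.2.1)) ∧
      M.final (M.lastState x.1 (π.map fun s => (s.1, s.2.1))) ≠ 0 := by
  induction π generalizing x with
  | nil => exact ⟨trivial, (track_final.1 hf).2⟩
  | cons s π ih =>
    have := ih h.2 hf
    exact ⟨⟨(track_δ.1 h.1).2, this.1⟩, this.2⟩

theorem exists_track_path {q : M.Q} {c : Set (Bool × {x // x ∈ V})}
    {π : List (Label Γ {x // x ∈ V} × M.Q)} (h : M.IsPath q π)
    (hf : M.final (M.lastState q π) ≠ 0) (hc : Completes c (π.map Prod.fst)) :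
    ∃ π', M.track.IsPath (q, c) π' ∧ M.track.final (M.track.lastState (q, c) π') ≠ 0 ∧
      π'.map Prod.fst = π.map Prod.fst := by
  induction π generalizing q c with
  | nil => exact ⟨[], trivial, track_final.2 ⟨hc, hf⟩, rfl⟩
  | cons s π ih =>
    obtain ⟨c', h1, h2⟩ := hc
    obtain ⟨π', h3, h4, h5⟩ := ih h.2 hf h2
    exact ⟨(s.1, (s.2, c')) :: π', ⟨track_δ.2 ⟨h1, h.1⟩, h3⟩, h4, by
      rw [List.map_cons, List.map_cons, h5]⟩

/-- Valid runs of the original automaton are exactly those that can be annotated with configurations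
from ∅ to the full set; the annotation changes no label. -/
theorem track_sem_ne_zero [Finite Γ] {M : WVSA Γ V BoolSR} {d : List Γ} {t : SpanTuple V d} :
    M.track.sem d t ≠ 0 ↔ M.sem d t ≠ 0 := by
  rw [sem_ne_zero, sem_ne_zero]
  constructor
  · rintro ⟨⟨x, π⟩, ⟨h1, h2, h3, h4⟩, h5, h6⟩
    have h7 := track_path h2 h3
    have e : M.labels (x.1, π.map fun s => (s.1, s.2.1)) = M.track.labels (x, π) := by
      simp [labels, Function.comp_def]
    refine ⟨(x.1, π.map fun s => (s.1, s.2.1)), ⟨(track_init.1 h1).2, h7.1, h7.2, ?_⟩, ?_, ?_⟩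
    · rw [e]; exact h4
    · rw [e]; exact h5
    · unfold Selects at h6 ⊢; rw [e]; exact h6
  · rintro ⟨⟨q, π⟩, ⟨h1, h2, h3, h4⟩, h5, h6⟩
    obtain ⟨π', h7, h8, h9⟩ := exists_track_path h2 h3 h5.completes
    have e : M.track.labels ((q, ∅), π') = M.labels (q, π) := h9
    refine ⟨((q, ∅), π'), ⟨track_init.2 ⟨rfl, h1⟩, h7, h8, ?_⟩, ?_, ?_⟩
    · rw [e]; exact h4
    · rw [e]; exact h5
    · unfold Selects at h6 ⊢; rw [e]; exact h6

end Track

/-! ### Making a tracking automaton unambiguous. -/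

section Determinize

/-- The gap states reached by a letter. -/
def gapNext (F : WVSA Γ V K) (conf : F.Q → Set (Bool × {x // x ∈ V})) (T : Set F.Q)
    (c : Set (Bool × {x // x ∈ V})) (a : Γ) : Set F.Q :=
  {q' | ∃ q ∈ T, conf q = c ∧ ∃ q₁, F.δ q (letter a) q₁ ≠ 0 ∧ F.Gap q₁ q'}

/-- The steps of the subset automaton: operations between two letters come in increasing order,
and letters act on sets of gap states.  The components of a state are the set of the possible gap
states, the set of the operations that are done, and the set of those among them that were done
after the last letter. -/
inductive DetStep (F : WVSA Γ V K) (conf : F.Q → Set (Bool × {x // x ∈ V}))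
    (idx : Bool × {x // x ∈ V} → ℕ) :
    Set F.Q × Set (Bool × {x // x ∈ V}) × Set (Bool × {x // x ∈ V}) → Label Γ {x // x ∈ V} →
    Set F.Q × Set (Bool × {x // x ∈ V}) × Set (Bool × {x // x ∈ V}) → Prop
  | op {T c G b v} : Allowed c (b, v) → (∀ o ∈ G, idx o < idx (b, v)) →
      DetStep F conf idx (T, c, G) (op b v) (T, insert (b, v) c, insert (b, v) G)
  | letter {T c G} (a : Γ) :
      DetStep F conf idx (T, c, G) (letter a) (F.gapNext conf T c a, c, ∅)

open Classical in
/-- The subset automaton. -/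
noncomputable def det (F : WVSA Γ V BoolSR) (conf : F.Q → Set (Bool × {x // x ∈ V}))
    (idx : Bool × {x // x ∈ V} → ℕ) : WVSA Γ V BoolSR where
  Q := Set F.Q × Set (Bool × {x // x ∈ V}) × Set (Bool × {x // x ∈ V})
  init x := if x = ({q | ∃ p, F.init p ≠ 0 ∧ F.Gap p q}, ∅, ∅) then 1 else 0
  final x := if x.2.1 = Set.univ ∧ ∃ q ∈ x.1, F.final q ≠ 0 then 1 else 0
  δ x o y := if DetStep F conf idx x o y then 1 else 0
  noEpsCycle x h := by
    have : ∀ y z, ¬ DetStep F conf idx y eps z := by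
      intro y z h
      generalize ho : (eps : Label Γ {x // x ∈ V}) = o at h
      cases h with
      | @op _ _ _ b _ _ _ => cases b <;> simp [Label.op] at ho
      | letter => simp at ho
    obtain ⟨y, h, -⟩ := Relation.TransGen.head'_iff.1 h
    exact h (if_neg (this _ _))

variable {F : WVSA Γ V BoolSR} {conf : F.Q → Set (Bool × {x // x ∈ V})}
  {idx : Bool × {x // x ∈ V} → ℕ}

theorem det_init {x : (F.det conf idx).Q} : (F.det conf idx).init x ≠ 0 ↔
    x = ({q | ∃ p, F.init p ≠ 0 ∧ F.Gap p q}, ∅, ∅) := by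
  simp only [det]; split_ifs with h <;> simp [h, BoolSR.one_ne_zero]

theorem det_final {x : (F.det conf idx).Q} : (F.det conf idx).final x ≠ 0 ↔
    x.2.1 = Set.univ ∧ ∃ q ∈ x.1, F.final q ≠ 0 := by
  simp only [det]; split_ifs with h <;> simp [h, BoolSR.one_ne_zero]

theorem det_δ {x y : (F.det conf idx).Q} {o : Label Γ {x // x ∈ V}} :
    (F.det conf idx).δ x o y ≠ 0 ↔ DetStep F conf idx x o y := by
  simp only [det]; split_ifs with h <;> simp [h, BoolSR.one_ne_zero]

theorem tracks_det : (F.det conf idx).Tracks (fun x => x.2.1) where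
  init x h := by rw [det_init.1 h]
  final x h := (det_final.1 h).1
  step x o y h := by
    cases det_δ.1 h with
    | op h1 h2 => exact confStep_op.2 ⟨h1, rfl⟩
    | letter => rfl

/-- Between letters the subset component rests. The third component collects the operations of the
current gap, so whatever is added later has a larger index than all of them. -/
theorem det_gap_cases {x y : (F.det conf idx).Q} (h : (F.det conf idx).Gap x y) :
    y.1 = x.1 ∧ ∀ o ∈ y.2.1, o ∈ x.2.1 ∨ ∀ o' ∈ x.2.2, idx o' < idx o := by
  induction h using Relation.ReflTransGen.head_induction_on with
  | refl => exact ⟨rfl, fun o ho => .inl ho⟩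
  | head h _ ih =>
    obtain ⟨o, ho, h⟩ := h
    cases det_δ.1 h with
    | @op T c G b v h1 h2 =>
      refine ⟨ih.1, fun o ho => ?_⟩
      rcases ih.2 o ho with (rfl | h) | h
      · exact .inr h2
      · exact .inl h
      · exact .inr fun o' ho' => h o' (.inr ho')
    | letter => simp [letter?] at ho

/-- The subset component holds candidates for the next gap state whatever their configuration; the
filter by configuration is applied when the next letter is read. A run of `F` is therefore recovered
from the end of the document backwards. At the end no filter is needed, since final states of `F`
have the full configuration. -/
theorem det_sound (hF : F.Tracks conf) {d : List Γ} {x : (F.det conf idx).Q}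
    {ξ : List (F.det conf idx).Q} (h : (F.det conf idx).GapSeq x d ξ)
    (hf : (F.det conf idx).final ((x :: ξ).getLast (List.cons_ne_nil _ _)) ≠ 0) :
    ∃ q ∈ x.1, ∃ σ, F.GapSeq q d σ ∧ F.final ((q :: σ).getLast (List.cons_ne_nil _ _)) ≠ 0 ∧
      (q :: σ).map conf = (x :: ξ).map fun x => x.2.1 := by
  induction d generalizing x ξ with
  | nil =>
    cases ξ with
    | nil =>
      obtain ⟨h1, q, hq, h2⟩ := det_final.1 hf
      simp only [List.getLast_singleton] at h1 hq
      exact ⟨q, hq, [], trivial, h2, by simp [h1, hF.final q h2]⟩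
    | cons _ _ => exact h.elim
  | cons a d ih =>
    cases ξ with
    | nil => exact h.elim
    | cons y ξ =>
      obtain ⟨⟨x', h1, h2⟩, h3⟩ := h
      obtain ⟨q', hq', σ, h4, h5, h6⟩ := ih h3 (by simpa using hf)
      rw [(det_gap_cases h2).1] at hq'
      have h1 := det_δ.1 h1
      generalize ho : (letter a : Label Γ {x // x ∈ V}) = o at h1
      cases h1 with
      | @op _ _ _ b _ _ _ => cases b <;> simp [Label.op] at ho
      | letter a' =>
        obtain rfl : a = a' := by simpa using ho
        obtain ⟨q, hq, hc, q₁, h7, h8⟩ := hq'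
        exact ⟨q, hq, q' :: σ, ⟨⟨q₁, h7, h8⟩, h4⟩, by simpa using h5, by
          rw [List.map_cons, h6, hc]; rfl⟩

/-- The missing operations are performed in increasing order of index, the smallest first. -/
theorem det_gap (hinj : Function.Injective idx) (hidx : ∀ v, idx (false, v) < idx (true, v))
    {T : Set F.Q} {C : Set (Bool × {x // x ∈ V})} (hC : ∀ v, (true, v) ∈ C → (false, v) ∈ C)
    (n : ℕ) : ∀ (c G : Set (Bool × {x // x ∈ V})), c ⊆ C → (C \ c).ncard = n →
      (∀ o ∈ C \ c, ∀ o' ∈ G, idx o' < idx o) →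
      ∃ G', (F.det conf idx).Gap (T, c, G) (T, C, G') := by
  induction n with
  | zero =>
    intro c G hc hn _
    rw [Set.ncard_eq_zero (Set.toFinite _), Set.sdiff_eq_empty] at hn
    rw [subset_antisymm hc hn]
    exact ⟨G, .refl⟩
  | succ n ih =>
    intro c G hc hn ho
    have hne : (C \ c).Nonempty := by
      rw [← Set.ncard_pos (Set.toFinite _)]; omega
    obtain ⟨⟨b, v⟩, hm, hmin⟩ := Set.exists_min_image (C \ c) idx (Set.toFinite _) hne
    have e : C \ insert (b, v) c = (C \ c) \ {(b, v)} := by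
      ext o; simp only [Set.mem_sdiff, Set.mem_insert_iff, Set.mem_singleton_iff]; tauto
    obtain ⟨G', hG'⟩ := ih (insert (b, v) c) (insert (b, v) G)
      (Set.insert_subset hm.1 hc)
      (by rw [e, Set.ncard_sdiff_singleton_of_mem hm, hn]; rfl)
      (by
        intro o ho1 o' ho2
        rw [e] at ho1
        rcases ho2 with rfl | ho2
        · exact lt_of_le_of_ne (hmin o ho1.1) fun h => ho1.2 (hinj h).symm
        · exact ho o ho1.1 o' ho2)
    refine ⟨G', .head ⟨op b v, letter?_op b v, det_δ.2 (.op ⟨hm.2, ?_⟩ (ho _ hm))⟩ hG'⟩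
    rintro rfl
    -- If a closing is the smallest missing operation, its opening has a smaller index and belongs
    -- to the closed set C, so it is already done and the closing is allowed.
    by_contra hcon
    have := hmin (false, v) ⟨hC v hm.1, hcon⟩
    have := hidx v
    omega

/-- At each letter the subset automaton makes its forced move and then performs the operations by
which the next gap state of `F` exceeds the present one. That state lies in the new subset, so the
invariant q ∈ T persists up to the final test. -/
theorem det_complete (hF : F.Tracks conf) (hinj : Function.Injective idx)
    (hidx : ∀ v, idx (false, v) < idx (true, v)) {d : List Γ} {q : F.Q} {σ : List F.Q}
    (h : F.GapSeq q d σ) (hf : F.final ((q :: σ).getLast (List.cons_ne_nil _ _)) ≠ 0)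
    (hc : ∀ v, (true, v) ∈ conf q → (false, v) ∈ conf q) {T : Set F.Q} (hq : q ∈ T)
    (G : Set (Bool × {x // x ∈ V})) :
    ∃ ξ, (F.det conf idx).GapSeq (T, conf q, G) d ξ ∧
      (F.det conf idx).final (((T, conf q, G) :: ξ).getLast (List.cons_ne_nil _ _)) ≠ 0 ∧
      σ.map conf = ξ.map fun x => x.2.1 := by
  induction d generalizing q σ T G with
  | nil =>
    cases σ with
    | nil => exact ⟨[], trivial, det_final.2 ⟨hF.final _ hf, q, hq, hf⟩, rfl⟩
    | cons _ _ => exact h.elim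
  | cons a d ih =>
    cases σ with
    | nil => exact h.elim
    | cons q' σ =>
      obtain ⟨⟨q₁, h1, h2⟩, h3⟩ := h
      have e : conf q₁ = conf q := hF.step _ _ _ h1
      have hc' := hF.closed_of_gap h2 (by rw [e]; exact hc)
      have hsub := hF.conf_subset_of_gap h2
      rw [e] at hsub
      obtain ⟨G', hG'⟩ := det_gap (F := F) (conf := conf) hinj hidx
        (T := F.gapNext conf T (conf q) a) hc' _ (conf q) ∅ hsub rfl
        (fun _ _ _ h => h.elim)
      obtain ⟨ξ, h4, h5, h6⟩ := ih h3 (by simpa using hf) hc'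
        (show q' ∈ F.gapNext conf T (conf q) a from ⟨q, hq, rfl, q₁, h1, h2⟩) G'
      exact ⟨_ :: ξ, ⟨⟨_, det_δ.2 (.letter a), hG'⟩, h4⟩,
        h5, by
        rw [List.map_cons, h6]; rfl⟩

/-- Consider the first difference of two paths. If only one of them performs an operation there, the
configurations at the next gap differ. If they perform different operations, each must still perform
the other's operation within the same gap, and both index inequalities would hold. Letters act
deterministically, so they cause no difference. -/
theorem det_path_unique {x : (F.det conf idx).Q}
    {π π' : List (Label Γ {x // x ∈ V} × (F.det conf idx).Q)}
    (h : (F.det conf idx).IsPath x π) (h' : (F.det conf idx).IsPath x π')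
    (hr : reads (π.map Prod.fst) = reads (π'.map Prod.fst))
    (hc : ((F.det conf idx).gapStates x π).map (fun x => x.2.1) =
      ((F.det conf idx).gapStates x π').map fun x => x.2.1) : π = π' := by
  have head : ∀ {x : (F.det conf idx).Q} {π}, (F.det conf idx).IsPath x π → ∃ y σ,
      (F.det conf idx).gapStates x π = y :: σ ∧ (F.det conf idx).Gap x y := by
    intro x π h
    obtain ⟨y, σ, h1, h2, -⟩ := gapSeq_of_isPath h
    exact ⟨y, σ, h1, h2⟩
  -- the first gap state after an operation contains the operation
  have after : ∀ {x : (F.det conf idx).Q} {π} {b v} {T c G}, (F.det conf idx).IsPath x π →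
      x = (T, insert (b, v) c, G) → ∃ C l, ((F.det conf idx).gapStates x π).map (fun x => x.2.1) =
        C :: l ∧ (b, v) ∈ C ∧ ∀ o ∈ C, o ∈ insert (b, v) c ∨ ∀ o' ∈ G, idx o' < idx o := by
    rintro x π b v T c G h rfl
    obtain ⟨y, σ, h1, h2⟩ := head h
    exact ⟨_, _, by rw [h1]; rfl, tracks_det.conf_subset_of_gap h2 (.inl rfl),
      (det_gap_cases h2).2⟩
  induction π generalizing x π' with
  | nil =>
    cases π' with
    | nil => rfl
    | cons s' π' =>
      exfalso
      obtain ⟨o', y'⟩ := s'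
      cases det_δ.1 h'.1 with
      | letter a => simp [reads_cons, letter?] at hr
      | @op T c G b v h1 h2 =>
        obtain ⟨C, l, h3, h4, -⟩ := after h'.2 rfl
        simp only [gapStates, letter?_op] at hc
        have hc := hc.trans h3
        exact h1.1 ((List.cons.inj hc).1.ge h4)
  | cons s π ih =>
    obtain ⟨o, y⟩ := s
    cases π' with
    | nil =>
      exfalso
      cases det_δ.1 h.1 with
      | letter a => simp [reads_cons, letter?] at hr
      | @op T c G b v h1 h2 =>
        obtain ⟨C, l, h3, h4, -⟩ := after h.2 rfl
        simp only [gapStates, letter?_op] at hc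
        have hc := hc.symm.trans h3
        exact h1.1 ((List.cons.inj hc).1.ge h4)
    | cons s' π' =>
      obtain ⟨o', y'⟩ := s'
      have hs := det_δ.1 h.1
      have hs' := det_δ.1 h'.1
      cases hs with
      | letter a =>
        cases hs' with
        | letter a' =>
          simp only [List.map_cons, reads_cons, letter?, Option.toList_some, List.cons_append,
            List.nil_append, List.cons.injEq] at hr
          obtain ⟨rfl, hr⟩ := hr
          rw [ih h.2 h'.2 hr (List.cons.inj hc).2]
        | @op T c G b v h1 h2 =>
          exfalso
          obtain ⟨C, l, h3, h4, -⟩ := after h'.2 rfl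
          simp only [gapStates, letter?_op] at hc
          have hc := hc.trans h3
          exact h1.1 ((List.cons.inj hc).1.ge h4)
      | @op T c G b v h1 h2 =>
        cases hs' with
        | letter a' =>
          exfalso
          obtain ⟨C, l, h3, h4, -⟩ := after h.2 rfl
          simp only [gapStates, letter?_op] at hc
          have hc := hc.symm.trans h3
          exact h1.1 ((List.cons.inj hc).1.ge h4)
        | @op _ _ _ b' v' h1' h2' =>
          obtain ⟨C, l, h3, h4, h5⟩ := after h.2 rfl
          obtain ⟨C', l', h3', h4', h5'⟩ := after h'.2 rfl
          have hc' : ((F.det conf idx).gapStates (T, insert (b, v) c, insert (b, v) G) π).map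
              (fun x => x.2.1) = ((F.det conf idx).gapStates
              (T, insert (b', v') c, insert (b', v') G) π').map (fun x => x.2.1) := by
            simpa [gapStates] using hc
          have hr' : reads (π.map Prod.fst) = reads (π'.map Prod.fst) := by
            simpa [reads_cons] using hr
          obtain ⟨rfl, -⟩ := List.cons.inj (h3.symm.trans (hc'.trans h3'))
          have e : (b, v) = (b', v') := by
            rcases h5 _ h4' with (e | hm) | hm
            · exact e.symm
            · exact (h1'.1 hm).elim
            · rcases h5' _ h4 with (e | hm') | hm'
              · exact e
              · exact (h1.1 hm').elim
              · have := hm _ (.inl rfl)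
                have := hm' _ (.inl rfl)
                omega
          cases e
          rw [ih h.2 h'.2 hr' hc']

theorem det_sem_ne_zero [Finite Γ] (hF : F.Tracks conf) (hinj : Function.Injective idx)
    (hidx : ∀ v, idx (false, v) < idx (true, v)) {d : List Γ} {t : SpanTuple V d} :
    (F.det conf idx).sem d t ≠ 0 ↔ F.sem d t ≠ 0 := by
  have hD := tracks_det (F := F) (conf := conf) (idx := idx)
  rw [sem_ne_zero, sem_ne_zero]
  constructor
  · rintro ⟨ρ, h1, h2, h3⟩
    obtain ⟨x, ξ, h4⟩ := List.exists_cons_of_ne_nil (gapStates_ne_nil ρ.1 ρ.2)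
    obtain ⟨⟨x₀, h5, h6⟩, h7, h8⟩ := exists_isRun_iff.1 ⟨ρ, h1, h4⟩
    obtain ⟨q, hq, σ, h9, h10, h11⟩ := det_sound hF h7 h8
    rw [(det_gap_cases h6).1, det_init.1 h5] at hq
    obtain ⟨ρ', h12, h13⟩ := exists_isRun_iff.2 ⟨hq, h9, h10⟩
    exact ⟨ρ', h12, hF.functional _ _ h12, (hD.selects_iff hF h1 h12 h3).2
      (by rw [h4, h13, h11])⟩
  · rintro ⟨ρ, h1, h2, h3⟩
    obtain ⟨q, σ, h4⟩ := List.exists_cons_of_ne_nil (gapStates_ne_nil ρ.1 ρ.2)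
    obtain ⟨⟨p, h5, h6⟩, h7, h8⟩ := exists_isRun_iff.1 ⟨ρ, h1, h4⟩
    have hc := hF.closed_of_gap h6 (by rw [hF.init p h5]; simp)
    obtain ⟨G, hG⟩ := det_gap (F := F) (conf := conf) hinj hidx
      (T := {q | ∃ p, F.init p ≠ 0 ∧ F.Gap p q}) hc _ ∅ ∅ (Set.empty_subset _) rfl
      (fun _ _ _ h => h.elim)
    obtain ⟨ξ, h9, h10, h11⟩ := det_complete hF hinj hidx h7 h8 hc
      (show q ∈ {q | ∃ p, F.init p ≠ 0 ∧ F.Gap p q} from ⟨p, h5, h6⟩) G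
    obtain ⟨ρ', h12, h13⟩ := exists_isRun_iff.2 ⟨⟨_, det_init.2 rfl, hG⟩, h9, h10⟩
    exact ⟨ρ', h12, hD.functional _ _ h12, (hF.selects_iff hD h1 h12 h3).2
      (by rw [h4, h13, List.map_cons, h11]; rfl)⟩

theorem det_unambiguous [Finite Γ] : (F.det conf idx).Unambiguous := by
  have hD := tracks_det (F := F) (conf := conf) (idx := idx)
  intro d t ht
  obtain ⟨ρ, h1, h2, h3⟩ := sem_ne_zero.1 ht
  refine ⟨ρ, ⟨mem_runs.2 ⟨h1, h2⟩, h3⟩, ?_⟩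
  rintro ρ' ⟨h4, h5⟩
  have h4 := (mem_runs.1 h4).1
  have h6 := (hD.selects_iff hD h4 h1 h5).1 h3
  obtain ⟨x, π⟩ := ρ
  obtain ⟨x', π'⟩ := ρ'
  obtain rfl : x = x' := (det_init.1 h1.1).trans (det_init.1 h4.1).symm
  exact congrArg (Prod.mk _) (det_path_unique h4.2.1 h1.2.1 (h4.2.2.2.trans h1.2.2.2.symm) h6)

end Determinize

/-- Every Boolean automaton is equivalent to an unambiguous functional one. -/
theorem exists_functional_unambiguous [Finite Γ] (M : WVSA Γ V BoolSR) :
    ∃ D : WVSA Γ V BoolSR, D.Functional ∧ D.Unambiguous ∧ ∀ d t, D.sem d t = M.sem d t := by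
  let e := Fintype.equivFin {x // x ∈ V}
  -- Openings get even and closings odd numbers, so every opening precedes its closing and the
  -- numbering is injective.
  let idx : Bool × {x // x ∈ V} → ℕ := fun o => 2 * (e o.2 : ℕ) + o.1.toNat
  have hinj : Function.Injective idx := by
    rintro ⟨b, v⟩ ⟨b', v'⟩ h
    have hb := Bool.toNat_le b
    have hb' := Bool.toNat_le b'
    simp only [idx] at h
    have h1 : (e v : ℕ) = e v' := by omega
    have h2 : b.toNat = b'.toNat := by omega
    rw [e.injective (Fin.ext h1), show b = b' by cases b <;> cases b' <;> simp_all]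
  have hidx : ∀ v, idx (false, v) < idx (true, v) := fun v => by simp [idx]
  refine ⟨M.track.det Prod.snd idx, tracks_det.functional, det_unambiguous, fun d t => ?_⟩
  rw [BoolSR.eq_iff, det_sem_ne_zero M.tracks_track hinj hidx, track_sem_ne_zero]

end WVSA

theorem SoftSpanner.exists_compiledBy {Γ X : Type} [Finite Γ] (Q : SoftSpanner Γ X)
    (hP : Q.P.Regular) (hS : ∀ S ∈ Q.factors, S.Regular) :
    ∃ A : WVSA Γ Q.P.vars ℝ, Q.CompiledBy A := by
  obtain ⟨P, hP⟩ := hP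
  obtain ⟨P', h1, h2, h3⟩ := P.exists_functional_unambiguous
  have : ∀ i : {S // S ∈ Q.factors}, ∃ D : WVSA Γ i.1.vars BoolSR, D.Functional ∧
      D.Unambiguous ∧ D.Represents := by
    intro i
    obtain ⟨M, hM⟩ := hS i.1 i.2
    obtain ⟨D, h1, h2, h3⟩ := M.exists_functional_unambiguous
    exact ⟨D, h1, h2, fun d t => (h3 d t).trans (hM d t)⟩
  choose S h4 h5 h6 using this
  exact ⟨_, Q.compiledBy_softJoin h1 h2 (fun d t => (h3 d t).trans (hP d t)) h4 h5 h6⟩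

/-! ## Functions computed by programs in polynomial time -/

namespace Expr

/-- The expression with all function indices moved by `k`. -/
def shift (k : ℕ) : Expr → Expr
  | var i => var i
  | num n => num n
  | add e₁ e₂ => add (e₁.shift k) (e₂.shift k)
  | sub e₁ e₂ => sub (e₁.shift k) (e₂.shift k)
  | eq e₁ e₂ => eq (e₁.shift k) (e₂.shift k)
  | lt e₁ e₂ => lt (e₁.shift k) (e₂.shift k)
  | wzero => wzero
  | wone => wone
  | wadd e₁ e₂ => wadd (e₁.shift k) (e₂.shift k)
  | wmul e₁ e₂ => wmul (e₁.shift k) (e₂.shift k)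
  | pair e₁ e₂ => pair (e₁.shift k) (e₂.shift k)
  | fst e => fst (e.shift k)
  | snd e => snd (e.shift k)
  | isPair e => isPair (e.shift k)
  | ite c e₁ e₂ => ite (c.shift k) (e₁.shift k) (e₂.shift k)
  | letIn e₁ e₂ => letIn (e₁.shift k) (e₂.shift k)
  | call f e => call (f + k) (e.shift k)

theorem shift_zero (e : Expr) : e.shift 0 = e := by
  induction e <;> simp_all [shift]

end Expr

/-- Functions are called by index, so a program can be placed inside a longer one once its call
indices are moved along with it. Step counts are unaffected. -/
theorem Eval.shift {K : Type} [CommSemiring K] {P P' : Program} {k : ℕ}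
    (hP : ∀ f body, P[f]? = some body → P'[f + k]? = some (body.shift k)) {env : List (Val K)}
    {e : Expr} {v : Val K} {n : ℕ} (h : Eval P env e v n) : Eval P' env (e.shift k) v n := by
  induction h with
  | var h => exact .var h
  | num => exact .num
  | add _ _ h₁ h₂ => exact .add h₁ h₂
  | sub _ _ h₁ h₂ => exact .sub h₁ h₂
  | eq _ _ h₁ h₂ => exact .eq h₁ h₂
  | lt _ _ h₁ h₂ => exact .lt h₁ h₂
  | wzero => exact .wzero
  | wone => exact .wone
  | wadd _ _ h₁ h₂ => exact .wadd h₁ h₂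
  | wmul _ _ h₁ h₂ => exact .wmul h₁ h₂
  | pair _ _ h₁ h₂ => exact .pair h₁ h₂
  | fst _ h => exact .fst h
  | snd _ h => exact .snd h
  | isPair _ h => exact .isPair h
  | iteTrue _ _ h₁ h₂ => exact .iteTrue h₁ h₂
  | iteFalse _ _ h₁ h₂ => exact .iteFalse h₁ h₂
  | letIn _ _ h₁ h₂ => exact .letIn h₁ h₂
  | call _ hf _ h₁ h₂ => exact .call h₁ (hP _ _ hf) h₂

theorem Eval.append {K : Type} [CommSemiring K] {P : Program} (P' : Program) {env : List (Val K)}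
    {e : Expr} {v : Val K} {n : ℕ} (h : Eval P env e v n) : Eval (P ++ P') env e v n := by
  rw [← e.shift_zero]
  refine h.shift fun f body hf => ?_
  rw [body.shift_zero, add_zero, List.getElem?_append_left (List.getElem?_eq_some_iff.1 hf).1, hf]

theorem Eval.cast {K : Type} [CommSemiring K] {P : Program} {env : List (Val K)}
    {e : Expr} {v v' : Val K} {n : ℕ} (h : Eval P env e v n) (hv : v = v') : Eval P env e v' n :=
  hv ▸ h

theorem Polynomial.eval_mono_nat (p : Polynomial ℕ) {a b : ℕ} (h : a ≤ b) :
    p.eval a ≤ p.eval b := by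
  rw [Polynomial.eval_eq_sum_range, Polynomial.eval_eq_sum_range]
  gcongr

/-- Types with a representation by values, and with a size that counts registers. -/
class Coded (α : Type) where
  enc : α → Val ℝ
  size : α → ℕ

namespace Coded

instance : Coded ℕ := ⟨.num, fun _ => 1⟩
instance : Coded Bool := ⟨fun b => .num (if b then 1 else 0), fun _ => 1⟩
-- Weights and variable lists are only copied, never inspected. Counting such a value as one
-- register keeps the bounds independent of the number of variables.
instance : Coded (Val ℝ) := ⟨id, fun _ => 1⟩

variable {α β γ δ : Type} [Coded α] [Coded β] [Coded γ] [Coded δ]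

instance : Coded (α × β) := ⟨fun x => .pair (enc x.1) (enc x.2), fun x => size x.1 + size x.2 + 1⟩
instance : Coded (List α) := ⟨Val.ofList enc, fun l => (l.map fun x => size x + 1).sum + 1⟩

@[simp] theorem size_nat (n : ℕ) : size n = 1 := rfl
@[simp] theorem size_bool (b : Bool) : size b = 1 := rfl
@[simp] theorem size_val (v : Val ℝ) : size v = 1 := rfl
@[simp] theorem size_prod (x : α × β) : size x = size x.1 + size x.2 + 1 := rfl
@[simp] theorem size_nil : size ([] : List α) = 1 := rfl
@[simp] theorem size_cons (x : α) (l : List α) : size (x :: l) = size x + 1 + size l := by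
  simp only [size, List.map_cons, List.sum_cons]; omega

theorem size_append (l m : List α) : size (l ++ m) + 1 = size l + size m := by
  induction l with
  | nil => simp; omega
  | cons x l ih => simp; omega

theorem length_lt_size (l : List α) : l.length < size l := by
  induction l with
  | nil => simp
  | cons x l ih => simp; omega

theorem size_lt_of_mem {x : α} {l : List α} (h : x ∈ l) : size x < size l := by
  obtain ⟨l₁, l₂, rfl⟩ := List.append_of_mem h
  have := size_append l₁ (x :: l₂)
  have := length_lt_size l₁
  have := length_lt_size l₂
  simp at *; omega

theorem size_filter_le (p : α → Bool) (l : List α) : size (l.filter p) ≤ size l := by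
  induction l with
  | nil => simp
  | cons x l ih => rw [List.filter_cons]; split_ifs <;> simp <;> omega

end Coded

/-! ### Closure properties of polynomial-time functions. -/

section PolyTime

open Coded

variable {α β γ δ : Type} [Coded α] [Coded β] [Coded γ] [Coded δ]

/-- The function with number `i` of the program computes `f` in at most `p (size x)` steps. -/
def Program.Computes (P : Program) (i : ℕ) (f : α → β) (p : Polynomial ℕ) : Prop :=
  ∃ body, P[i]? = some body ∧
    ∀ x, ∃ n ≤ p.eval (size x), Eval P [enc x] body (enc (f x)) n

theorem Program.Computes.shift {P P' : Program} {k i : ℕ} {f : α → β} {p q : Polynomial ℕ}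
    (h : P.Computes i f p)
    (hP : ∀ f body, P[f]? = some body → P'[f + k]? = some (body.shift k))
    (hpq : ∀ n, p.eval n ≤ q.eval n) : P'.Computes (i + k) f q := by
  obtain ⟨body, h1, h2⟩ := h
  refine ⟨_, hP _ _ h1, fun x => ?_⟩
  obtain ⟨n, h3, h4⟩ := h2 x
  exact ⟨n, h3.trans (hpq _), h4.shift hP⟩

theorem Program.Computes.append {P : Program} {i : ℕ} {f : α → β} {p q : Polynomial ℕ}
    (h : P.Computes i f p) (P' : Program) (hpq : ∀ n, p.eval n ≤ q.eval n) :
    (P ++ P').Computes i f q := by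
  obtain ⟨body, h1, h2⟩ := h
  refine ⟨body, by rw [List.getElem?_append_left (List.getElem?_eq_some_iff.1 h1).1, h1],
    fun x => ?_⟩
  obtain ⟨n, h3, h4⟩ := h2 x
  exact ⟨n, h3.trans (hpq _), h4.append P'⟩

theorem Program.Computes.call {P : Program} {i : ℕ} {f : α → β} {p : Polynomial ℕ}
    (h : P.Computes i f p) {x : α} {env : List (Val ℝ)} {e : Expr} {m : ℕ}
    (he : Eval P env e (enc x) m) :
    ∃ n ≤ m + p.eval (size x) + 1, Eval P env (.call i e) (enc (f x)) n := by
  obtain ⟨body, h1, h2⟩ := h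
  obtain ⟨n, h3, h4⟩ := h2 x
  exact ⟨m + n + 1, by omega, .call he h1 h4⟩

/-- `f` is computed by a program in polynomially many steps, and the size of the values of `f` is
polynomially bounded. -/
def PolyTime (f : α → β) : Prop :=
  ∃ (P : Program) (i : ℕ) (p : Polynomial ℕ), P.Computes i f p ∧ ∀ x, size (f x) ≤ p.eval (size x)

namespace PolyTime

/-- The body is placed behind P. It may call all functions of P and, under the index `P.length`,
itself. One polynomial then serves for steps and output size. -/
theorem of_body {f : α → β} (P : Program) (body : Expr) (p q : Polynomial ℕ)
    (h : ∀ x, ∃ n ≤ p.eval (size x), Eval (P ++ [body]) [enc x] body (enc (f x)) n)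
    (hs : ∀ x, size (f x) ≤ q.eval (size x)) : PolyTime f := by
  refine ⟨P ++ [body], P.length, p + q, ⟨body, by simp, fun x => ?_⟩, fun x => ?_⟩
  · obtain ⟨n, h1, h2⟩ := h x
    exact ⟨n, by rw [Polynomial.eval_add]; omega, h2⟩
  · have := hs x
    rw [Polynomial.eval_add]; omega

/-- A function whose result is an explicit expression that makes no calls. -/
theorem of_expr {f : α → β} (body : Expr) (k : ℕ) (q : Polynomial ℕ)
    (h : ∀ x, ∃ n ≤ k, ∀ P : Program, Eval P [enc x] body (enc (f x)) n)
    (hs : ∀ x, size (f x) ≤ q.eval (size x)) : PolyTime f :=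
  of_body [] body (Polynomial.C k) q (fun x => by
    obtain ⟨n, h1, h2⟩ := h x
    exact ⟨n, by simpa using h1, h2 _⟩) hs

theorem combine {f : α → β} {g : γ → δ} (hf : PolyTime f) (hg : PolyTime g) :
    ∃ (P : Program) (i j : ℕ) (p : Polynomial ℕ), P.Computes i f p ∧ P.Computes j g p ∧
      (∀ x, size (f x) ≤ p.eval (size x)) ∧ ∀ x, size (g x) ≤ p.eval (size x) := by
  obtain ⟨P, i, p, h1, h2⟩ := hf
  obtain ⟨P', j, p', h1', h2'⟩ := hg
  refine ⟨P ++ P'.map (Expr.shift P.length), i, j + P.length, p + p',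
    h1.append _ fun n => by simp, h1'.shift (fun f body hf => ?_) fun n => by simp,
    fun x => (h2 x).trans (by simp), fun x => (h2' x).trans (by simp)⟩
  rw [List.getElem?_append_right (by omega), Nat.add_sub_cancel, List.getElem?_map, hf]
  rfl

theorem id : PolyTime (fun x : α => x) :=
  of_expr (.var 0) 1 Polynomial.X (fun _ => ⟨1, le_rfl, fun _ => .var rfl⟩) (by simp)

theorem constNat (k : ℕ) : PolyTime (fun _ : α => k) :=
  of_expr (.num k) 1 1 (fun _ => ⟨1, le_rfl, fun _ => .num⟩) (by simp)

theorem constFalse : PolyTime (fun _ : α => false) :=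
  of_expr (.num 0) 1 1 (fun _ => ⟨1, le_rfl, fun _ => .num⟩) (by simp)

theorem constTrue : PolyTime (fun _ : α => true) :=
  of_expr (.num 1) 1 1 (fun _ => ⟨1, le_rfl, fun _ => .num⟩) (by simp)

theorem constOne : PolyTime (fun _ : α => (Val.wt 1 : Val ℝ)) :=
  of_expr .wone 1 1 (fun _ => ⟨1, le_rfl, fun _ => .wone⟩) (by simp)

theorem nil : PolyTime (fun _ : α => ([] : List β)) :=
  of_expr (.num 0) 1 1 (fun _ => ⟨1, le_rfl, fun _ => .num⟩) (by simp)

theorem comp {g : β → γ} {f : α → β} (hg : PolyTime g) (hf : PolyTime f) :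
    PolyTime (fun x => g (f x)) := by
  obtain ⟨P, i, j, p, h1, h2, h3, h4⟩ := combine hg hf
  have h1 := h1.append [.call i (.call j (.var 0))] (fun n => le_refl (p.eval n))
  have h2 := h2.append [.call i (.call j (.var 0))] (fun n => le_refl (p.eval n))
  -- The constant 3 pays for reading the argument and for the two calls. The bound on the size of f
  -- x turns the cost of g into a composition of polynomials.
  refine of_body P (.call i (.call j (.var 0))) (p.comp p + p + 3) (p.comp p) (fun x => ?_)
    fun x => ?_
  · obtain ⟨n, h5, h6⟩ := h2.call (Eval.var (P := _) (env := [enc x]) (i := 0) rfl)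
    obtain ⟨m, h7, h8⟩ := h1.call h6
    refine ⟨m, ?_, h8⟩
    have := p.eval_mono_nat (h4 x)
    simp only [Polynomial.eval_add, Polynomial.eval_comp, Polynomial.eval_ofNat]
    omega
  · rw [Polynomial.eval_comp]
    exact (h3 _).trans (p.eval_mono_nat (h4 x))

theorem pair {f : α → β} {g : α → γ} (hf : PolyTime f) (hg : PolyTime g) :
    PolyTime (fun x => (f x, g x)) := by
  obtain ⟨P, i, j, p, h1, h2, h3, h4⟩ := combine hf hg
  set body := Expr.pair (.call i (.var 0)) (.call j (.var 0))
  have h1 := h1.append [body] (fun n => le_refl (p.eval n))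
  have h2 := h2.append [body] (fun n => le_refl (p.eval n))
  refine of_body P body (p + p + 5) (p + p + 1) (fun x => ?_) fun x => ?_
  · obtain ⟨n, h5, h6⟩ := h1.call (Eval.var (P := _) (env := [enc x]) (i := 0) rfl)
    obtain ⟨m, h7, h8⟩ := h2.call (Eval.var (P := _) (env := [enc x]) (i := 0) rfl)
    refine ⟨_, ?_, .pair h6 h8⟩
    simp only [Polynomial.eval_add, Polynomial.eval_ofNat]
    omega
  · have := h3 x
    have := h4 x
    simp only [Polynomial.eval_add, Polynomial.eval_one, size_prod]
    omega

theorem fst_fun : PolyTime (fun x : α × β => x.1) :=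
  of_expr (.fst (.var 0)) 2 Polynomial.X (fun x => ⟨2, le_rfl, fun _ => .fst (.var rfl)⟩)
    (fun x => by simp; omega)

theorem snd_fun : PolyTime (fun x : α × β => x.2) :=
  of_expr (.snd (.var 0)) 2 Polynomial.X (fun x => ⟨2, le_rfl, fun _ => .snd (.var rfl)⟩)
    (fun x => by simp; omega)

theorem fst {f : α → β × γ} (hf : PolyTime f) : PolyTime (fun x => (f x).1) := fst_fun.comp hf

theorem snd {f : α → β × γ} (hf : PolyTime f) : PolyTime (fun x => (f x).2) := snd_fun.comp hf

/-- A nonempty list is encoded as the pair of its head and tail, so the program has nothing to do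
beyond forming the pair. -/
theorem cons {f : α → β} {g : α → List β} (hf : PolyTime f) (hg : PolyTime g) :
    PolyTime (fun x => f x :: g x) :=
  (of_expr (f := fun x : β × List β => x.1 :: x.2) (.var 0) 1 Polynomial.X
    (fun x => ⟨1, le_rfl, fun _ => .var rfl⟩) (fun x => by simp; omega)).comp (hf.pair hg)

theorem natSucc {f : α → ℕ} (hf : PolyTime f) : PolyTime (fun x => f x + 1) :=
  (of_expr (f := fun n : ℕ => n + 1) (.add (.var 0) (.num 1)) 3 1
    (fun x => ⟨3, le_rfl, fun _ => .add (.var rfl) .num⟩) (by simp)).comp hf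

theorem natBEq : PolyTime (fun x : ℕ × ℕ => x.1 == x.2) :=
  of_expr (.eq (.fst (.var 0)) (.snd (.var 0))) 5 1
    (fun x => ⟨5, le_rfl, fun _ => (Eval.eq (.fst (.var rfl)) (.snd (.var rfl))).cast
      (by by_cases h : x.1 = x.2 <;> simp [enc, h])⟩) (by simp)

/-- The condition and the first branch are packed into one pair-valued function so that `combine`,
which merges two programs, suffices. Evaluating f in any case is harmless because it is total and
cheap. -/
theorem cond {c : α → Bool} {f g : α → β} (hc : PolyTime c) (hf : PolyTime f)
    (hg : PolyTime g) : PolyTime (fun x => if c x then f x else g x) := by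
  obtain ⟨P, i, j, p, h1, h2, h3, h4⟩ := combine (hc.pair hf) hg
  set body := Expr.ite (.fst (.call i (.var 0))) (.snd (.call i (.var 0))) (.call j (.var 0))
  have h1 := h1.append [body] (fun n => le_refl (p.eval n))
  have h2 := h2.append [body] (fun n => le_refl (p.eval n))
  refine of_body P body (p + p + 10) (p + p) (fun x => ?_) fun x => ?_
  · obtain ⟨n, h5, h6⟩ := h1.call (Eval.var (P := _) (env := [enc x]) (i := 0) rfl)
    obtain ⟨m, h7, h8⟩ := h2.call (Eval.var (P := _) (env := [enc x]) (i := 0) rfl)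
    by_cases h : c x
    · refine ⟨_, ?_, (Eval.iteTrue (k := 0) ((Eval.fst h6).cast (by simp [enc, h]))
        (.snd h6)).cast (by simp [h])⟩
      simp only [Polynomial.eval_add, Polynomial.eval_ofNat]
      omega
    · refine ⟨_, ?_, (Eval.iteFalse ((Eval.fst h6).cast (by simp [enc, h])) h8).cast
        (by simp [h])⟩
      simp only [Polynomial.eval_add, Polynomial.eval_ofNat]
      omega
  · have := h3 x
    have := h4 x
    simp only [Polynomial.eval_add, size_prod, size_bool] at *
    split_ifs <;> omega

theorem and {p q : α → Bool} (hp : PolyTime p) (hq : PolyTime q) :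
    PolyTime (fun x => p x && q x) := by
  have := hp.cond hq constFalse
  convert this using 2 with x
  cases p x <;> rfl

theorem not {p : α → Bool} (hp : PolyTime p) : PolyTime (fun x => !p x) := by
  have := hp.cond constFalse constTrue
  convert this using 2 with x
  cases p x <;> rfl

theorem or {p q : α → Bool} (hp : PolyTime p) (hq : PolyTime q) :
    PolyTime (fun x => p x || q x) := by
  have := hp.cond constTrue hq
  convert this using 2 with x
  cases p x <;> rfl

theorem beqBool {p q : α → Bool} (hp : PolyTime p) (hq : PolyTime q) :
    PolyTime (fun x => p x == q x) := by
  have := hp.cond hq hq.not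
  convert this using 2 with x
  cases p x <;> cases q x <;> rfl

theorem beqNat {f g : α → ℕ} (hf : PolyTime f) (hg : PolyTime g) :
    PolyTime (fun x => f x == g x) := natBEq.comp (hf.pair hg)

omit [Coded β] [Coded γ] in
theorem beqProd [BEq β] [BEq γ] {f g : α → β × γ}
    (h1 : PolyTime fun x => (f x).1 == (g x).1) (h2 : PolyTime fun x => (f x).2 == (g x).2) :
    PolyTime (fun x => f x == g x) := h1.and h2

/-- Loops over lists with an accumulator of polynomially bounded size. -/
theorem foldl_fun {f : α → β → γ → β} (hf : PolyTime fun x : α × β × γ => f x.1 x.2.1 x.2.2)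
    (q : Polynomial ℕ) (hq : ∀ a b (l : List γ), size (l.foldl (f a) b) ≤ q.eval (size (a, b, l))) :
    PolyTime (fun x : α × β × List γ => x.2.2.foldl (f x.1) x.2.1) := by
  obtain ⟨P, i, p, h1, h2⟩ := hf
  let v : Expr := .var 0
  set body := Expr.ite (.isPair (.snd (.snd v)))
    (.call P.length (.pair (.fst v) (.pair
      (.call i (.pair (.fst v) (.pair (.fst (.snd v)) (.fst (.snd (.snd v))))))
      (.snd (.snd (.snd v)))))) (.fst (.snd v)) with hbody
  have h1 := h1.append [body] (fun n => le_refl (p.eval n))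
  have hself : (P ++ [body])[P.length]? = some body := by simp
  -- B bounds the cost of the loop body for every accumulator that occurs, and 40 generously covers
  -- the bookkeeping of one round; there are `l.length` rounds and the final test.
  have key : ∀ (a : α) (B : ℕ) (l : List γ) (b : β),
      (∀ l₁ c l₂, l = l₁ ++ c :: l₂ → p.eval (size (a, l₁.foldl (f a) b, c)) ≤ B) →
      ∃ n ≤ (l.length + 1) * (B + 40),
        Eval (P ++ [body]) [enc (a, b, l)] body (enc (l.foldl (f a) b)) n := by
    intro a B l
    induction l with
    | nil =>
      intro b _
      refine ⟨_, ?_, .iteFalse ((Eval.isPair (.snd (.snd (.var rfl)))).cast rfl)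
        (.fst (.snd (.var rfl)))⟩
      simp only [List.length_nil]
      omega
    | cons c l ih =>
      intro b hB
      have hv : Eval (P ++ [body]) [enc (a, b, c :: l)] v
          (.pair (enc a) (.pair (enc b) (.pair (enc c) (enc l)))) 1 := .var rfl
      obtain ⟨n, h3, h4⟩ := h1.call (x := (a, b, c))
        (Eval.pair (.fst hv) (.pair (.fst (.snd hv)) (.fst (.snd (.snd hv)))))
      obtain ⟨m, h5, h6⟩ := ih (f a b c) (by
        rintro l₁ c' l₂ rfl
        exact hB (c :: l₁) c' l₂ rfl)
      refine ⟨_, ?_, Eval.iteTrue (k := 0) ((Eval.isPair (.snd (.snd hv))).cast rfl)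
        (.call (.pair (.fst hv) (.pair h4 (.snd (.snd (.snd hv))))) hself h6)⟩
      have := hB [] c l rfl
      simp only [List.foldl_nil] at this
      simp only [List.length_cons]
      rw [add_mul (l.length + 1) 1]
      omega
  -- Accumulators are folds over prefixes of the list, so q evaluated at the size of the whole input
  -- bounds each of them. This makes the argument of the loop body at most the input size plus that
  -- bound plus 2.
  refine of_body P body ((Polynomial.X + 1) * (p.comp (Polynomial.X + q + 2) + 40)) q ?_
    fun x => hq _ _ _
  rintro ⟨a, b, l⟩
  obtain ⟨n, h3, h4⟩ := key a (p.eval (size (a, b, l) + q.eval (size (a, b, l)) + 2)) l b (by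
    rintro l₁ c l₂ rfl
    refine p.eval_mono_nat ?_
    have e := size_append l₁ (c :: l₂)
    have h3 := (hq a b l₁).trans (q.eval_mono_nat (b := size (a, b, l₁ ++ c :: l₂)) (by
      have := length_lt_size l₂
      simp only [size_prod, size_cons] at *; omega))
    generalize q.eval (size (a, b, l₁ ++ c :: l₂)) = z at *
    have := length_lt_size l₁
    simp only [size_prod, size_cons] at *
    omega)
  refine ⟨n, h3.trans ?_, h4⟩
  simp only [Polynomial.eval_mul, Polynomial.eval_add, Polynomial.eval_comp, Polynomial.eval_X,
    Polynomial.eval_one, Polynomial.eval_ofNat]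
  refine Nat.mul_le_mul_right _ ?_
  have := length_lt_size l
  simp only [size_prod] at *
  omega

theorem foldl {f : α → β → γ → β} {b : α → β} {l : α → List γ}
    (hf : PolyTime fun x : α × β × γ => f x.1 x.2.1 x.2.2) (hb : PolyTime b) (hl : PolyTime l)
    (q : Polynomial ℕ) (hq : ∀ a b (l : List γ), size (l.foldl (f a) b) ≤ q.eval (size (a, b, l))) :
    PolyTime (fun x => (l x).foldl (f x) (b x)) :=
  (foldl_fun hf q hq).comp (id.pair (hb.pair hl))

theorem reverseAux {f g : α → List β} (hf : PolyTime f) (hg : PolyTime g) :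
    PolyTime (fun x => (f x).reverse ++ g x) := by
  have key : ∀ l b : List β, l.foldl (fun b c => c :: b) b = l.reverse ++ b := by
    intro l
    induction l with
    | nil => simp
    | cons x l ih => intro b; simp [ih]
  have hsz : ∀ l b : List β, size (l.foldl (fun b c => c :: b) b) + 1 = size l + size b := by
    intro l
    induction l with
    | nil => intro b; simp; omega
    | cons x l ih => intro b; rw [List.foldl_cons, ih, size_cons, size_cons]; omega
  have := foldl (α := α) (f := fun _ (b : List β) c => c :: b) (snd_fun.snd.cons snd_fun.fst) hg hf
    Polynomial.X (fun a b l => by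
      have := hsz l b
      rw [Polynomial.eval_X, size_prod, size_prod]; dsimp only; omega)
  simpa only [key] using this

theorem reverse {f : α → List β} (hf : PolyTime f) : PolyTime (fun x => (f x).reverse) := by
  simpa using reverseAux hf nil

theorem append {f g : α → List β} (hf : PolyTime f) (hg : PolyTime g) :
    PolyTime (fun x => f x ++ g x) := by
  simpa using reverseAux hf.reverse hg

theorem flatMap {f : α → γ → List β} {l : α → List γ} (hl : PolyTime l)
    (hf : PolyTime fun x : α × γ => f x.1 x.2) : PolyTime (fun x => (l x).flatMap (f x)) := by
  have key : ∀ (a : α) (l : List γ) (b : List β),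
      l.foldl (fun b c => b ++ f a c) b = b ++ l.flatMap (f a) := by
    intro a l
    induction l with
    | nil => simp
    | cons x l ih => intro b; simp [ih]
  have hf' := hf
  obtain ⟨_, _, p, -, hp⟩ := hf'
  have hsz : ∀ (a : α) (B : ℕ) (l : List γ), (∀ c ∈ l, size (f a c) ≤ B) →
      size (l.flatMap (f a)) ≤ l.length * B + 1 := by
    intro a B l
    induction l with
    | nil => simp
    | cons x l ih =>
      intro h
      have h1 := h x (by simp)
      have h2 := ih fun c hc => h c (by simp [hc])
      have h3 := size_append (f a x) (l.flatMap (f a))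
      simp only [List.flatMap_cons, List.length_cons, add_mul, one_mul]
      omega
  have := foldl (f := fun a b c => b ++ f a c)
    (append snd_fun.fst (hf.comp (fst_fun.pair snd_fun.snd))) nil hl
    -- The start value has size at most X, and at most X list elements contribute at most p(X) each.
    (Polynomial.X + Polynomial.X * p + 1) (fun a b l => by
      have h1 := hsz a (p.eval (size (a, b, l))) l (fun c hc => by
        refine (hp (a, c)).trans (p.eval_mono_nat ?_)
        have := size_lt_of_mem hc
        simp only [size_prod]; omega)
      have h2 := size_append b (l.flatMap (f a))
      have h3 : l.length * p.eval (size (a, b, l)) ≤ size (a, b, l) * p.eval (size (a, b, l)) := by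
        refine Nat.mul_le_mul_right _ ?_
        have := length_lt_size l
        simp only [size_prod]; omega
      have h4 : size b ≤ size (a, b, l) := by simp only [size_prod]; omega
      rw [key]
      simp only [Polynomial.eval_add, Polynomial.eval_mul, Polynomial.eval_X, Polynomial.eval_one]
      omega)
  simpa [key] using this

theorem map {f : α → γ → β} {l : α → List γ} (hl : PolyTime l)
    (hf : PolyTime fun x : α × γ => f x.1 x.2) : PolyTime (fun x => (l x).map (f x)) := by
  have := hl.flatMap (f := fun x c => [f x c]) (hf.cons nil)
  simpa [List.flatMap_singleton', ← List.map_eq_flatMap] using this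

theorem filter {p : α → γ → Bool} {l : α → List γ} (hl : PolyTime l)
    (hp : PolyTime fun x : α × γ => p x.1 x.2) : PolyTime (fun x => (l x).filter (p x)) := by
  have := hl.flatMap (f := fun x c => if p x c then [c] else []) (hp.cond (snd_fun.cons nil) nil)
  convert this using 2 with x
  induction l x with
  | nil => rfl
  | cons c l ih => rw [List.filter_cons, List.flatMap_cons, ← ih]; split_ifs <;> rfl

theorem any {p : α → γ → Bool} {l : α → List γ} (hl : PolyTime l)
    (hp : PolyTime fun x : α × γ => p x.1 x.2) : PolyTime (fun x => (l x).any (p x)) := by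
  have key : ∀ (a : α) (l : List γ) (b : Bool),
      l.foldl (fun b c => b || p a c) b = (b || l.any (p a)) := by
    intro a l
    induction l with
    | nil => simp
    | cons x l ih => intro b; simp [ih, Bool.or_assoc]
  have := foldl (f := fun a b c => b || p a c)
    (or snd_fun.fst (hp.comp (fst_fun.pair snd_fun.snd))) constFalse hl 1 (fun a b l => by simp)
  simpa [key] using this

theorem all {p : α → γ → Bool} {l : α → List γ} (hl : PolyTime l)
    (hp : PolyTime fun x : α × γ => p x.1 x.2) : PolyTime (fun x => (l x).all (p x)) := by
  have := (hl.any (p := fun x c => !p x c) hp.not).not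
  convert this using 2 with x
  induction l x with
  | nil => rfl
  | cons c l ih => simp [ih]

theorem findIdx {p : α → γ → Bool} {l : α → List γ} (hl : PolyTime l)
    (hp : PolyTime fun x : α × γ => p x.1 x.2) : PolyTime (fun x => (l x).findIdx (p x)) := by
  -- The flag tells whether an element has been found; from then on the counter is frozen.
  let step : α → Bool × ℕ → γ → Bool × ℕ := fun a b c =>
    if b.1 || p a c then (true, b.2) else (false, b.2 + 1)
  have key : ∀ (a : α) (l : List γ) (k : ℕ), l.foldl (step a) (true, k) = (true, k) := by
    intro a l k
    induction l with
    | nil => rfl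
    | cons x l ih => simpa [step] using ih
  have key' : ∀ (a : α) (l : List γ) (k : ℕ),
      (l.foldl (step a) (false, k)).2 = k + l.findIdx (p a) := by
    intro a l
    induction l with
    | nil => intro k; simp
    | cons x l ih =>
      intro k
      rw [List.foldl_cons, List.findIdx_cons]
      cases h : p a x
      · have e : step a (false, k) x = (false, k + 1) := by simp [step, h]
        rw [e, ih]; simp; omega
      · have e : step a (false, k) x = (true, k) := by simp [step, h]
        rw [e, key]; simp
  have hstep : PolyTime fun x : α × (Bool × ℕ) × γ => step x.1 x.2.1 x.2.2 :=
    cond (or snd_fun.fst.fst (hp.comp (fst_fun.pair snd_fun.snd)))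
      (constTrue.pair snd_fun.fst.snd) (constFalse.pair snd_fun.fst.snd.natSucc)
  have := (foldl hstep (constFalse.pair (constNat 0)) hl 3 (fun a b l => by simp)).snd
  simpa [key'] using this

/-- The elements of a list with their positions, in reversed order. -/
theorem reverse_zipIdx {l : α → List β} (hl : PolyTime l) :
    PolyTime (fun x => ((l x).zipIdx.map Prod.swap).reverse) := by
  let step : ℕ × List (ℕ × β) → β → ℕ × List (ℕ × β) := fun b c => (b.1 + 1, (b.1, c) :: b.2)
  have key : ∀ (l : List β) (k : ℕ) (b : List (ℕ × β)),
      (l.foldl step (k, b)).2 = ((l.zipIdx k).map Prod.swap).reverse ++ b := by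
    intro l
    induction l with
    | nil => simp
    | cons x l ih => intro k b; simp [step, ih]
  have hsz : ∀ (l : List β) (b : ℕ × List (ℕ × β)),
      size (l.foldl step b) ≤ size b + 3 * size l := by
    intro l
    induction l with
    | nil => intro b; simp
    | cons x l ih => intro b; refine (ih _).trans ?_; simp [step]; omega
  have hstep : PolyTime fun x : α × (ℕ × List (ℕ × β)) × β => step x.2.1 x.2.2 :=
    pair snd_fun.fst.fst.natSucc (cons (pair snd_fun.fst.fst snd_fun.snd) snd_fun.fst.snd)
  have := (foldl (f := fun _ => step) hstep ((constNat 0).pair nil) hl (3 * Polynomial.X)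
    (fun a b l => (hsz l b).trans (by simp; omega))).snd
  simpa [key] using this

end PolyTime

end PolyTime

section Compile

open Coded

/-! ## The compilation on list representations -/

/-- The form of a listed automaton as a value: variables, states, initial and final states with
weights, and transitions. -/
abbrev AutCode : Type :=
  Val ℝ × List ℕ × List (ℕ × Val ℝ) × List (ℕ × Val ℝ) × List (ℕ × (ℕ × ℕ) × ℕ × Val ℝ)

namespace AutCode

abbrev vars (M : AutCode) : Val ℝ := M.1
abbrev states (M : AutCode) : List ℕ := M.2.1
abbrev initial (M : AutCode) : List (ℕ × Val ℝ) := M.2.2.1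
abbrev final (M : AutCode) : List (ℕ × Val ℝ) := M.2.2.2.1
abbrev trans (M : AutCode) : List (ℕ × (ℕ × ℕ) × ℕ × Val ℝ) := M.2.2.2.2

/-- One round of a reachability search. -/
def searchStep (S : List ℕ) (E : List (ℕ × ℕ)) (L : List ℕ) : List ℕ :=
  S.filter fun x => L.any (fun y => y == x) || E.any fun e => e.2 == x && L.any fun y => y == e.1

/-- The states in `S` that can be reached from `x` along the edges in `E`. -/
def search (S : List ℕ) (E : List (ℕ × ℕ)) (x : ℕ) : List ℕ :=
  S.foldl (fun L _ => searchStep S E L) [x]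

def reach (M : AutCode) (x y : ℕ) : Bool :=
  (search M.states (M.trans.map fun t => (t.1, t.2.2.1)) x).any fun z => z == y

def gap (M : AutCode) (x y : ℕ) : Bool :=
  (search M.states ((M.trans.filter fun t => !(t.2.1.1 == 0)).map fun t => (t.1, t.2.2.1)) x).any
    fun z => z == y

def pending (M : AutCode) (x : ℕ) (o : ℕ × ℕ) : Bool :=
  M.trans.any fun t => t.2.1 == o && M.reach x t.1 && M.final.any fun f => M.reach t.2.2.1 f.1

def mentions (M : AutCode) (o : ℕ × ℕ) : Bool := M.trans.any fun t => t.2.1 == o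

/-- Candidates for common operations are taken from the transitions of P, with tags 0 (letters) and
1 (ε) skipped. Thus variable lists need not be read, which matches the `Mentions` guards of
`WVSA.Agree`. -/
def agree (P M : AutCode) (p s : ℕ) : Bool :=
  P.trans.all fun t => t.2.1.1 == 0 || t.2.1.1 == 1 || !M.mentions t.2.1 ||
    P.pending p t.2.1 == M.pending s t.2.1

/-- The factors with different numbers. -/
def numbered (F : List (AutCode × Val ℝ)) : List (ℕ × AutCode × Val ℝ) :=
  (F.zipIdx.map Prod.swap).reverse

def joinStates (P : AutCode) (F : List (ℕ × AutCode × Val ℝ)) : List (ℕ × ℕ × ℕ) :=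
  P.states.flatMap fun p => F.flatMap fun f => f.2.1.states.map fun s => (p, f.1, s)

def joinInitial (P : AutCode) (F : List (ℕ × AutCode × Val ℝ)) : List ((ℕ × ℕ × ℕ) × Val ℝ) :=
  P.initial.flatMap fun p => F.flatMap fun f =>
    (f.2.1.states.filter fun s => f.2.1.initial.any fun i => f.2.1.gap i.1 s).map fun s =>
      ((p.1, f.1, s), f.2.2)

def joinFinal (P : AutCode) (F : List (ℕ × AutCode × Val ℝ)) : List ((ℕ × ℕ × ℕ) × Val ℝ) :=
  P.final.flatMap fun p => F.flatMap fun f =>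
    (f.2.1.final.filter fun s => P.agree f.2.1 p.1 s.1).map fun s =>
      ((p.1, f.1, s.1), Val.wt 1)

/-- Whether a factor can move from the gap state `s` to the gap state `s'` along a transition. -/
def factorStep (P M : AutCode) (t : ℕ × (ℕ × ℕ) × ℕ × Val ℝ) (s s' : ℕ) : Bool :=
  if t.2.1.1 == 0 then
    P.agree M t.1 s && M.trans.any fun u => u.1 == s && u.2.1 == t.2.1 && M.gap u.2.2.1 s'
  else s == s'

def joinTrans (P : AutCode) (F : List (ℕ × AutCode × Val ℝ)) :
    List ((ℕ × ℕ × ℕ) × (ℕ × ℕ) × (ℕ × ℕ × ℕ) × Val ℝ) :=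
  P.trans.flatMap fun t => F.flatMap fun f => f.2.1.states.flatMap fun s =>
    (f.2.1.states.filter fun s' => P.factorStep f.2.1 t s s').map fun s' =>
      ((t.1, f.1, s), t.2.1, (t.2.2.1, f.1, s'), Val.wt 1)

/-- The number of a state. -/
def index (N : List (ℕ × ℕ × ℕ)) (x : ℕ × ℕ × ℕ) : ℕ := N.findIdx fun y => y == x

/-- The representation of the automaton that is compiled from a soft spanner. -/
def compile (I : AutCode × List (AutCode × Val ℝ)) : AutCode :=
  (I.1.vars,
    (joinStates I.1 (numbered I.2)).map (index (joinStates I.1 (numbered I.2))),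
    (joinInitial I.1 (numbered I.2)).map (fun x =>
      (index (joinStates I.1 (numbered I.2)) x.1, x.2)),
    (joinFinal I.1 (numbered I.2)).map (fun x =>
      (index (joinStates I.1 (numbered I.2)) x.1, x.2)),
    (joinTrans I.1 (numbered I.2)).map (fun x =>
      (index (joinStates I.1 (numbered I.2)) x.1, x.2.1,
        index (joinStates I.1 (numbered I.2)) x.2.2.1, x.2.2.2)))

end AutCode

/-! ### The compilation runs in polynomial time. -/

namespace PolyTime

open AutCode

variable {α : Type} [Coded α]

theorem beqPair {f g : α → ℕ × ℕ} (hf : PolyTime f) (hg : PolyTime g) :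
    PolyTime (fun x => f x == g x) :=
  beqProd (beqNat hf.fst hg.fst) (beqNat hf.snd hg.snd)

theorem beqTriple {f g : α → ℕ × ℕ × ℕ} (hf : PolyTime f) (hg : PolyTime g) :
    PolyTime (fun x => f x == g x) :=
  beqProd (beqNat hf.fst hg.fst) (beqPair hf.snd hg.snd)

theorem searchStep {S : α → List ℕ} {E : α → List (ℕ × ℕ)} {L : α → List ℕ} (hS : PolyTime S)
    (hE : PolyTime E) (hL : PolyTime L) :
    PolyTime fun x => AutCode.searchStep (S x) (E x) (L x) :=
  hS.filter (or ((hL.comp fst_fun).any (beqNat snd_fun fst_fun.snd))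
    ((hE.comp fst_fun).any (and (beqNat snd_fun.snd fst_fun.snd)
      ((hL.comp fst_fun.fst).any (beqNat snd_fun fst_fun.snd.fst)))))

/-- Every round filters the state list S, so the accumulator never outgrows S or its start value;
this is the size bound that a loop requires. -/
theorem search {S : α → List ℕ} {E : α → List (ℕ × ℕ)} {y : α → ℕ} (hS : PolyTime S)
    (hE : PolyTime E) (hy : PolyTime y) : PolyTime fun x => AutCode.search (S x) (E x) (y x) := by
  have key : ∀ (S : List ℕ) (E : List (ℕ × ℕ)) (l L : List ℕ),
      size (l.foldl (fun L _ => AutCode.searchStep S E L) L) ≤ max (size S) (size L) := by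
    intro S E l
    induction l with
    | nil => intro L; exact le_max_right _ _
    | cons x l ih =>
      intro L
      exact (ih _).trans (max_le (le_max_left _ _) ((size_filter_le _ _).trans (le_max_left _ _)))
  have h : PolyTime fun x : List ℕ × List (ℕ × ℕ) × ℕ => AutCode.search x.1 x.2.1 x.2.2 :=
    foldl (f := fun x L _ => AutCode.searchStep x.1 x.2.1 L)
      (searchStep fst_fun.fst fst_fun.snd.fst snd_fun.fst) (snd_fun.snd.cons nil) fst_fun
      Polynomial.X (fun a b l => (key _ _ _ _).trans (by
        simp only [size_prod, Polynomial.eval_X]; omega))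
  exact h.comp (hS.pair (hE.pair hy))

variable {M N : α → AutCode} {x y : α → ℕ} {o : α → ℕ × ℕ}

theorem reach (hM : PolyTime M) (hx : PolyTime x) (hy : PolyTime y) :
    PolyTime fun a => (M a).reach (x a) (y a) :=
  any (search hM.snd.fst (hM.snd.snd.snd.snd.map (snd_fun.fst.pair snd_fun.snd.snd.fst)) hx)
    (beqNat snd_fun (hy.comp fst_fun))

theorem gap (hM : PolyTime M) (hx : PolyTime x) (hy : PolyTime y) :
    PolyTime fun a => (M a).gap (x a) (y a) :=
  any (search hM.snd.fst ((hM.snd.snd.snd.snd.filter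
    (p := fun _ t => !(t.2.1.1 == 0)) (not (beqNat snd_fun.snd.fst.fst (constNat 0)))).map
      (snd_fun.fst.pair snd_fun.snd.snd.fst)) hx)
    (beqNat snd_fun (hy.comp fst_fun))

theorem pending (hM : PolyTime M) (hx : PolyTime x) (ho : PolyTime o) :
    PolyTime fun a => (M a).pending (x a) (o a) :=
  hM.snd.snd.snd.snd.any (and (and (beqPair snd_fun.snd.fst (ho.comp fst_fun))
    (reach (hM.comp fst_fun) (hx.comp fst_fun) snd_fun.fst))
    ((hM.comp fst_fun).snd.snd.snd.fst.any (reach (hM.comp fst_fun.fst) fst_fun.snd.snd.snd.fst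
      snd_fun.fst)))

theorem mentions (hM : PolyTime M) (ho : PolyTime o) :
    PolyTime fun a => (M a).mentions (o a) :=
  hM.snd.snd.snd.snd.any (beqPair snd_fun.snd.fst (ho.comp fst_fun))

theorem agree (hM : PolyTime M) (hN : PolyTime N) (hx : PolyTime x) (hy : PolyTime y) :
    PolyTime fun a => (M a).agree (N a) (x a) (y a) :=
  all hM.snd.snd.snd.snd (or (or (or (beqNat snd_fun.snd.fst.fst (constNat 0))
    (beqNat snd_fun.snd.fst.fst (constNat 1))) (not (mentions (hN.comp fst_fun) snd_fun.snd.fst)))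
    (beqBool (pending (hM.comp fst_fun) (hx.comp fst_fun) snd_fun.snd.fst)
      (pending (hN.comp fst_fun) (hy.comp fst_fun) snd_fun.snd.fst)))

variable {F : α → List (ℕ × AutCode × Val ℝ)}

theorem joinStates (hM : PolyTime M) (hF : PolyTime F) :
    PolyTime fun a => (M a).joinStates (F a) :=
  hM.snd.fst.flatMap ((hF.comp fst_fun).flatMap
    (snd_fun.snd.fst.snd.fst.map (fst_fun.fst.snd.pair (fst_fun.snd.fst.pair snd_fun))))

theorem joinInitial (hM : PolyTime M) (hF : PolyTime F) :
    PolyTime fun a => (M a).joinInitial (F a) :=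
  hM.snd.snd.fst.flatMap ((hF.comp fst_fun).flatMap
    ((snd_fun.snd.fst.snd.fst.filter (fst_fun.snd.snd.fst.snd.snd.fst.any
      (gap fst_fun.fst.snd.snd.fst snd_fun.fst fst_fun.snd))).map
      ((fst_fun.fst.snd.fst.pair (fst_fun.snd.fst.pair snd_fun)).pair fst_fun.snd.snd.snd)))

theorem joinFinal (hM : PolyTime M) (hF : PolyTime F) :
    PolyTime fun a => (M a).joinFinal (F a) :=
  hM.snd.snd.snd.fst.flatMap ((hF.comp fst_fun).flatMap
    ((snd_fun.snd.fst.snd.snd.snd.fst.filter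
      (agree (hM.comp fst_fun.fst.fst) fst_fun.snd.snd.fst fst_fun.fst.snd.fst snd_fun.fst)).map
      ((fst_fun.fst.snd.fst.pair (fst_fun.snd.fst.pair snd_fun.fst)).pair constOne)))

theorem factorStep {t : α → ℕ × (ℕ × ℕ) × ℕ × Val ℝ} (hM : PolyTime M) (hN : PolyTime N)
    (ht : PolyTime t) (hx : PolyTime x) (hy : PolyTime y) :
    PolyTime fun a => (M a).factorStep (N a) (t a) (x a) (y a) :=
  cond (beqNat ht.snd.fst.fst (constNat 0))
    (and (agree hM hN ht.fst hx) (hN.snd.snd.snd.snd.any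
      (and (and (beqNat snd_fun.fst (hx.comp fst_fun))
        (beqPair snd_fun.snd.fst (ht.comp fst_fun).snd.fst))
        (gap (hN.comp fst_fun) snd_fun.snd.snd.fst (hy.comp fst_fun)))))
    (beqNat hx hy)

theorem joinTrans (hM : PolyTime M) (hF : PolyTime F) :
    PolyTime fun a => (M a).joinTrans (F a) :=
  hM.snd.snd.snd.snd.flatMap ((hF.comp fst_fun).flatMap
    (snd_fun.snd.fst.snd.fst.flatMap
      ((fst_fun.snd.snd.fst.snd.fst.filter
        (factorStep (hM.comp fst_fun.fst.fst.fst) fst_fun.fst.snd.snd.fst fst_fun.fst.fst.snd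
          fst_fun.snd snd_fun)).map
        ((fst_fun.fst.fst.snd.fst.pair (fst_fun.fst.snd.fst.pair fst_fun.snd)).pair
          (fst_fun.fst.fst.snd.snd.fst.pair
            ((fst_fun.fst.fst.snd.snd.snd.fst.pair (fst_fun.fst.snd.fst.pair snd_fun)).pair
              constOne))))))

theorem index {N : α → List (ℕ × ℕ × ℕ)} {x : α → ℕ × ℕ × ℕ} (hN : PolyTime N)
    (hx : PolyTime x) : PolyTime fun a => AutCode.index (N a) (x a) :=
  hN.findIdx (beqTriple snd_fun (hx.comp fst_fun))

theorem compile : PolyTime AutCode.compile :=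
  have hF : PolyTime fun I : AutCode × List (AutCode × Val ℝ) => numbered I.2 :=
    reverse_zipIdx snd_fun
  have hS := joinStates fst_fun hF
  fst_fun.fst.pair ((hS.map (index (hS.comp fst_fun) snd_fun)).pair
    (((joinInitial fst_fun hF).map ((index (hS.comp fst_fun) snd_fun.fst).pair snd_fun.snd)).pair
    (((joinFinal fst_fun hF).map ((index (hS.comp fst_fun) snd_fun.fst).pair snd_fun.snd)).pair
    ((joinTrans fst_fun hF).map ((index (hS.comp fst_fun) snd_fun.fst).pair (snd_fun.snd.fst.pair
      ((index (hS.comp fst_fun) snd_fun.snd.snd.fst).pair snd_fun.snd.snd.snd)))))))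

end PolyTime

/-! ### Correctness of the reachability search. -/

namespace AutCode

theorem searchStep_mem {S : List ℕ} {E : List (ℕ × ℕ)} {L : List ℕ} {x : ℕ} :
    x ∈ searchStep S E L ↔ x ∈ S ∧ (x ∈ L ∨ ∃ y ∈ L, (y, x) ∈ E) := by
  simp only [searchStep, List.mem_filter, Bool.or_eq_true, List.any_eq_true, beq_iff_eq,
    exists_eq_right, Bool.and_eq_true]
  refine and_congr_right fun _ => or_congr Iff.rfl ?_
  constructor
  · rintro ⟨⟨y, x'⟩, h1, rfl, h2⟩
    exact ⟨y, h2, h1⟩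
  · rintro ⟨y, h1, h2⟩
    exact ⟨(y, x), h2, rfl, h1⟩

/-- Each round either finds the set already closed under edges or enlarges it. After |S| rounds
without closure there would be more than |S| distinct elements inside S. -/
theorem mem_search {S : List ℕ} {E : List (ℕ × ℕ)} (hE : ∀ e ∈ E, e.2 ∈ S) {x y : ℕ}
    (hx : x ∈ S) : y ∈ search S E x ↔ Relation.ReflTransGen (fun a b => (a, b) ∈ E) x y := by
  have sound : ∀ (l L : List ℕ), (∀ z ∈ L, Relation.ReflTransGen (fun a b => (a, b) ∈ E) x z) →
      ∀ z ∈ l.foldl (fun L _ => searchStep S E L) L,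
        Relation.ReflTransGen (fun a b => (a, b) ∈ E) x z := by
    intro l
    induction l with
    | nil => exact fun L h => h
    | cons c l ih =>
      intro L h
      refine ih _ fun z hz => ?_
      rcases (searchStep_mem.1 hz).2 with hz | ⟨y, hy, hz⟩
      · exact h z hz
      · exact (h y hy).tail hz
  have complete : ∀ (l L : List ℕ) (k : ℕ), x ∈ L → L ⊆ S →
      ((∀ y ∈ L, ∀ z, (y, z) ∈ E → z ∈ L) ∨ k < L.toFinset.card) →
      let L' := l.foldl (fun L _ => searchStep S E L) L
      x ∈ L' ∧ L' ⊆ S ∧ ((∀ y ∈ L', ∀ z, (y, z) ∈ E → z ∈ L') ∨ k + l.length < L'.toFinset.card) := by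
    intro l
    induction l with
    | nil => exact fun L k h1 h2 h3 => ⟨h1, h2, h3⟩
    | cons c l ih =>
      intro L k h1 h2 h3
      have hsub : L ⊆ searchStep S E L := fun z hz => searchStep_mem.2 ⟨h2 hz, .inl hz⟩
      have := ih (searchStep S E L) (k + 1) (hsub h1) (fun z hz => (searchStep_mem.1 hz).1) (by
        by_cases hc : searchStep S E L ⊆ L
        · left
          intro y hy z hz
          exact searchStep_mem.2 ⟨hE _ hz, .inr ⟨y, hc hy, hz⟩⟩
        · rcases h3 with h3 | h3
          · refine (hc fun z hz => ?_).elim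
            rcases (searchStep_mem.1 hz).2 with hz | ⟨y, hy, hz⟩
            · exact hz
            · exact h3 y hy z hz
          · right
            have : L.toFinset ⊂ (searchStep S E L).toFinset :=
              ⟨fun z hz => List.mem_toFinset.2 (hsub (List.mem_toFinset.1 hz)),
                fun h => hc fun z hz => List.mem_toFinset.1 (h (List.mem_toFinset.2 hz))⟩
            have := Finset.card_lt_card this
            omega)
      rw [List.length_cons, ← add_assoc, add_right_comm]
      exact this
  constructor
  · exact sound S [x] (by simpa using .refl) y
  · intro h
    -- The start set has one element, so the strict bound holds with counter 0.
    obtain ⟨h1, h2, h3⟩ := complete S [x] 0 (by simp) (by simpa using hx) (.inr (by simp))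
    rcases h3 with h3 | h3
    · induction h with
      | refl => exact h1
      | tail _ hz ih => exact h3 _ ih _ hz
    · exfalso
      have h4 := Finset.card_le_card (s := (search S E x).toFinset) (t := S.toFinset)
        fun z hz => List.mem_toFinset.2 (h2 (List.mem_toFinset.1 hz))
      have h5 := S.toFinset_card_le
      simp only [search] at h4
      omega

end AutCode

theorem Val.ofList_map {α β : Type*} {K : Type} (f : β → Val K) (g : α → β) (l : List α) :
    Val.ofList f (l.map g) = Val.ofList (fun x => f (g x)) l := by
  induction l with
  | nil => rfl
  | cons x l ih => simp [Val.ofList, ih]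

/-! ### Labels and listed automata as numbers and lists. -/

namespace Label

variable {Γ X : Type} [Encodable Γ] [Encodable X] {V W : Finset X}

/-- Labels as pairs of a tag and the number of the letter or variable. -/
def code : Label Γ {x // x ∈ V} → ℕ × ℕ
  | letter a => (0, Encodable.encode a)
  | eps => (1, 0)
  | opn v => (2, Encodable.encode v.1)
  | cls v => (3, Encodable.encode v.1)

theorem enc_code (o : Label Γ {x // x ∈ V}) : enc o.code = Val.ofLabel o := by
  cases o <;> rfl

theorem code_injective : Function.Injective (code : Label Γ {x // x ∈ V} → ℕ × ℕ) := by
  intro o o' h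
  cases o <;> cases o' <;> simp [code] at h <;>
    first
      | rfl
      | exact congrArg _ h

theorem code_fst_eq_zero {o : Label Γ {x // x ∈ V}} : o.code.1 = 0 ↔ o.letter?.isSome := by
  cases o <;> simp [code, letter?]

theorem code_op_ne (b : Bool) (v : {x // x ∈ V}) :
    (op b v : Label Γ {x // x ∈ V}).code.1 ≠ 0 ∧ (op b v : Label Γ {x // x ∈ V}).code.1 ≠ 1 := by
  cases b <;> simp [op, code]

theorem exists_op_of_code {o : Label Γ {x // x ∈ V}} (h0 : o.code.1 ≠ 0) (h1 : o.code.1 ≠ 1) :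
    ∃ b v, o = op b v := by
  rcases cases_letter o with ⟨a, rfl⟩ | rfl | h
  · exact (h0 rfl).elim
  · exact (h1 rfl).elim
  · exact h

/-- Codes use the variable in X rather than its membership in V or W, so equality of codes
identifies common variables of automata with different variable sets. -/
theorem code_op_eq_iff {b : Bool} {v : {x // x ∈ V}} {o : Label Γ {x // x ∈ W}} :
    o.code = (op b v : Label Γ {x // x ∈ V}).code ↔ ∃ hW : v.1 ∈ W, o = op b ⟨v.1, hW⟩ := by
  constructor
  · intro h
    obtain ⟨x, hV⟩ := v
    cases b <;> cases o <;> simp [op, code] at h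
    all_goals
      rename_i w
      obtain ⟨y, hW⟩ := w
      dsimp only at h
      subst h
      exact ⟨hW, rfl⟩
  · rintro ⟨hW, rfl⟩
    cases b <;> rfl

theorem code_letter_eq_iff {a : Γ} {o : Label Γ {x // x ∈ W}} :
    o.code = (letter a : Label Γ {x // x ∈ V}).code ↔ o = letter a := by
  cases o <;> simp [code]

end Label

namespace Listing

open Label

variable {Γ X K : Type} [CommSemiring K] {V : Finset X} [Encodable Γ] [Encodable X]

/-- The list representation of an automaton. -/
def code {A : WVSA Γ V K} (e : K → Val ℝ) (L : Listing A) : AutCode :=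
  (Val.ofList (fun v => .num (Encodable.encode v.1)) L.vars,
    L.states.map L.name,
    L.initial.map (fun q => (L.name q, e (A.init q))),
    L.final.map (fun q => (L.name q, e (A.final q))),
    L.trans.map (fun t => (L.name t.1, t.2.1.code, L.name t.2.2, e (A.δ t.1 t.2.1 t.2.2))))

theorem enc_code {A : WVSA Γ V K} (e : K → Val ℝ) (L : Listing A) :
    enc (L.code e) = L.toVal e := by
  simp only [code, enc, toVal, Val.ofList_map, ← Label.enc_code]
  rfl

section Bool

variable {M : WVSA Γ V BoolSR} (L : Listing M) (hL : L.Exact)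
include hL

theorem mem_code_initial {x : ℕ × Val ℝ} : x ∈ (L.code BoolSR.toVal).initial ↔
    ∃ q, M.init q ≠ 0 ∧ x = (L.name q, BoolSR.toVal (M.init q)) := by
  simp only [code, AutCode.initial, List.mem_map]
  exact exists_congr fun q => and_congr ⟨hL.1 q, L.mem_initial q⟩ eq_comm

theorem mem_code_final {x : ℕ × Val ℝ} : x ∈ (L.code BoolSR.toVal).final ↔
    ∃ q, M.final q ≠ 0 ∧ x = (L.name q, BoolSR.toVal (M.final q)) := by
  simp only [code, AutCode.final, List.mem_map]
  exact exists_congr fun q => and_congr ⟨hL.2.1 q, L.mem_final q⟩ eq_comm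

theorem mem_code_trans {t : ℕ × (ℕ × ℕ) × ℕ × Val ℝ} : t ∈ (L.code BoolSR.toVal).trans ↔
    ∃ p o q, M.δ p o q ≠ 0 ∧ t = (L.name p, o.code, L.name q, BoolSR.toVal (M.δ p o q)) := by
  simp only [code, AutCode.trans, List.mem_map]
  constructor
  · rintro ⟨e, he, rfl⟩
    exact ⟨e.1, e.2.1, e.2.2, hL.2.2 e he, rfl⟩
  · rintro ⟨p, o, q, h, rfl⟩
    exact ⟨(p, o, q), L.mem_trans p o q h, rfl⟩

omit hL in
theorem mem_code_states {x : ℕ} : x ∈ (L.code BoolSR.toVal).states ↔ ∃ q, x = L.name q := by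
  simp only [code, AutCode.states, List.mem_map]
  exact exists_congr fun q => ⟨fun h => h.2.symm, fun h => ⟨L.mem_states q, h.symm⟩⟩

-- Edges are given through state names. By injectivity of the names, consecutive edges fit together
-- as transitions between states, and the path of names lifts.
omit hL in
theorem mem_search_iff {E : List (ℕ × ℕ)} {r : M.Q → M.Q → Prop}
    (hE : ∀ a b, (a, b) ∈ E ↔ ∃ p q, r p q ∧ a = L.name p ∧ b = L.name q) (p q : M.Q) :
    L.name q ∈ AutCode.search (L.code BoolSR.toVal).states E (L.name p) ↔
      Relation.ReflTransGen r p q := by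
  rw [AutCode.mem_search]
  · constructor
    · intro h
      obtain ⟨q', h1, h2⟩ : ∃ q', L.name q = L.name q' ∧ Relation.ReflTransGen r p q' := by
        generalize L.name q = y at h
        induction h with
        | refl => exact ⟨p, rfl, .refl⟩
        | tail _ h ih =>
          obtain ⟨q', rfl, h2⟩ := ih
          obtain ⟨p₁, q₁, h3, h4, rfl⟩ := (hE _ _).1 h
          rw [← L.name_inj h4] at h3
          exact ⟨q₁, rfl, h2.tail h3⟩
      rwa [L.name_inj h1]
    · intro h
      exact h.lift L.name fun a b hab => (hE _ _).2 ⟨a, b, hab, rfl, rfl⟩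
  · rintro ⟨a, b⟩ he
    obtain ⟨p, q, -, -, rfl⟩ := (hE _ _).1 he
    exact L.mem_code_states.2 ⟨q, rfl⟩
  · exact L.mem_code_states.2 ⟨p, rfl⟩

theorem code_reach {p q : M.Q} :
    (L.code BoolSR.toVal).reach (L.name p) (L.name q) = true ↔ M.Reach p q := by
  simp only [AutCode.reach, List.any_eq_true, beq_iff_eq, exists_eq_right]
  refine L.mem_search_iff (fun a b => ?_) p q
  rw [List.mem_map]
  constructor
  · rintro ⟨t, ht, h⟩
    obtain ⟨p, o, q, h1, rfl⟩ := (L.mem_code_trans hL).1 ht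
    cases h
    exact ⟨p, q, ⟨o, h1⟩, rfl, rfl⟩
  · rintro ⟨p, q, ⟨o, h⟩, rfl, rfl⟩
    exact ⟨_, (L.mem_code_trans hL).2 ⟨p, o, q, h, rfl⟩, rfl⟩

theorem code_gap {p q : M.Q} :
    (L.code BoolSR.toVal).gap (L.name p) (L.name q) = true ↔ M.Gap p q := by
  simp only [AutCode.gap, List.any_eq_true, beq_iff_eq, exists_eq_right]
  refine L.mem_search_iff (fun a b => ?_) p q
  have key : ∀ o : Label Γ {x // x ∈ V}, (!(o.code.1 == 0)) = true ↔ o.letter? = none := by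
    intro o
    rw [Bool.not_eq_true', beq_eq_false_iff_ne, Ne, code_fst_eq_zero]
    simp
  rw [List.mem_map]
  constructor
  · rintro ⟨t, ht, h⟩
    rw [List.mem_filter] at ht
    obtain ⟨p, o, q, h1, rfl⟩ := (L.mem_code_trans hL).1 ht.1
    cases h
    exact ⟨p, q, ⟨o, (key o).1 ht.2, h1⟩, rfl, rfl⟩
  · rintro ⟨p, q, ⟨o, ho, h⟩, rfl, rfl⟩
    exact ⟨_, List.mem_filter.2 ⟨(L.mem_code_trans hL).2 ⟨p, o, q, h, rfl⟩, (key o).2 ho⟩, rfl⟩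

theorem code_mentions {c : ℕ × ℕ} :
    (L.code BoolSR.toVal).mentions c = true ↔ ∃ o, o.code = c ∧ M.Mentions o := by
  simp only [AutCode.mentions, List.any_eq_true, beq_iff_eq]
  constructor
  · rintro ⟨t, ht, rfl⟩
    obtain ⟨p, o, q, h1, rfl⟩ := (L.mem_code_trans hL).1 ht
    exact ⟨o, rfl, p, q, h1⟩
  · rintro ⟨o, rfl, p, q, h⟩
    exact ⟨_, (L.mem_code_trans hL).2 ⟨p, o, q, h, rfl⟩, rfl⟩

theorem code_pending {p : M.Q} {o : Label Γ {x // x ∈ V}} :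
    (L.code BoolSR.toVal).pending (L.name p) o.code = true ↔ M.Pending p o := by
  simp only [AutCode.pending, List.any_eq_true, beq_iff_eq, Bool.and_eq_true]
  constructor
  · rintro ⟨t, ht, ⟨h1, h2⟩, f, hf, h3⟩
    obtain ⟨q, o', q', h4, rfl⟩ := (L.mem_code_trans hL).1 ht
    obtain ⟨f, h5, rfl⟩ := (L.mem_code_final hL).1 hf
    obtain rfl := code_injective h1
    exact ⟨q, q', f, (L.code_reach hL).1 h2, h4, (L.code_reach hL).1 h3, h5⟩
  · rintro ⟨q, q', f, h1, h2, h3, h4⟩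
    exact ⟨_, (L.mem_code_trans hL).2 ⟨q, o, q', h2, rfl⟩, ⟨rfl, (L.code_reach hL).2 h1⟩, _,
      (L.mem_code_final hL).2 ⟨f, h4, rfl⟩, (L.code_reach hL).2 h3⟩

theorem code_agree {W : Finset X} {S : WVSA Γ W BoolSR} {L' : Listing S} (hL' : L'.Exact)
    {p : M.Q} {s : S.Q} :
    AutCode.agree (L.code BoolSR.toVal) (L'.code BoolSR.toVal) (L.name p) (L'.name s) = true ↔
      M.Agree S p s := by
  simp only [AutCode.agree, List.all_eq_true, Bool.or_eq_true, beq_iff_eq, Bool.not_eq_true',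
    Bool.eq_false_iff]
  constructor
  · rintro h b x hV hW ⟨q, q', h1⟩ h2
    have h3 := h _ ((L.mem_code_trans hL).2 ⟨q, _, q', h1, rfl⟩)
    have h4 := code_op_ne (Γ := Γ) b ⟨x, hV⟩
    have h5 : (L'.code BoolSR.toVal).mentions (op b ⟨x, hV⟩ : Label Γ {x // x ∈ V}).code = true :=
      (L'.code_mentions hL').2 ⟨_, code_op_eq_iff.2 ⟨hW, rfl⟩, h2⟩
    have h6 : (op b ⟨x, hV⟩ : Label Γ {x // x ∈ V}).code =
        (op b ⟨x, hW⟩ : Label Γ {x // x ∈ W}).code := (code_op_eq_iff.2 ⟨hW, rfl⟩).symm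
    rcases h3 with ((h3 | h3) | h3) | h3
    · exact (h4.1 h3).elim
    · exact (h4.2 h3).elim
    · exact (h3 h5).elim
    · rw [← L.code_pending hL, ← L'.code_pending hL', ← h6, h3]
  · intro h t ht
    obtain ⟨q, o, q', h1, rfl⟩ := (L.mem_code_trans hL).1 ht
    dsimp only
    by_cases h0 : o.code.1 = 0
    · exact .inl (.inl (.inl h0))
    by_cases h0' : o.code.1 = 1
    · exact .inl (.inl (.inr h0'))
    by_cases hm : (L'.code BoolSR.toVal).mentions o.code = true
    · right
      obtain ⟨b, v, rfl⟩ := exists_op_of_code h0 h0'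
      obtain ⟨o', h2, h3⟩ := (L'.code_mentions hL').1 hm
      obtain ⟨hW, rfl⟩ := code_op_eq_iff.1 h2
      have := h b v.1 v.2 hW ⟨q, q', h1⟩ h3
      rw [Bool.eq_iff_iff, L.code_pending hL, ← h2, L'.code_pending hL']
      exact this
    · exact .inl (.inr hm)

end Bool

/-- Every list of values of a function is the image of a list. -/
theorem exists_map_eq {α β : Type*} {f : α → β} {l : List β} (h : ∀ y ∈ l, ∃ x, f x = y) :
    ∃ l' : List α, l'.map f = l := by
  induction l with
  | nil => exact ⟨[], rfl⟩
  | cons y l ih =>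
    obtain ⟨x, hx⟩ := h y (by simp)
    obtain ⟨l', hl'⟩ := ih fun z hz => h z (by simp [hz])
    exact ⟨x :: l', by simp [hx, hl']⟩

/-- Every output reveals the key of the element that produced it, so blocks of different elements
are disjoint. -/
theorem nodup_flatMap_of_key {α β κ : Type*} {l : List α} {f : α → List β} (k : α → κ)
    (k' : β → κ) (hl : (l.map k).Nodup) (hf : ∀ a ∈ l, (f a).Nodup)
    (hk : ∀ a ∈ l, ∀ b ∈ f a, k' b = k a) : (l.flatMap f).Nodup := by
  rw [List.nodup_flatMap]
  refine ⟨hf, ?_⟩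
  rw [List.Nodup, List.pairwise_map] at hl
  refine hl.imp_of_mem fun {a b} ha hb hab => ?_
  intro y hy hy'
  exact hab ((hk a ha y hy).symm.trans (hk b hb y hy'))

end Listing

namespace AutCode

theorem mem_numbered {F : List (AutCode × Val ℝ)} {f : ℕ × AutCode × Val ℝ} :
    f ∈ numbered F ↔ F[f.1]? = some f.2 := by
  simp only [numbered, List.mem_reverse, List.mem_map]
  constructor
  · rintro ⟨⟨x, i⟩, h, rfl⟩
    exact List.mem_zipIdx_iff_getElem?.1 h
  · intro h
    exact ⟨(f.2, f.1), List.mem_zipIdx_iff_getElem?.2 h, rfl⟩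

theorem nodup_numbered (F : List (AutCode × Val ℝ)) : ((numbered F).map Prod.fst).Nodup := by
  have : (Prod.fst ∘ Prod.swap : (AutCode × Val ℝ) × ℕ → ℕ) = Prod.snd := rfl
  rw [numbered, List.map_reverse, List.nodup_reverse, List.map_map, this, List.zipIdx_map_snd]
  exact List.nodup_range'

/-- The entry of the list at the computed index is the triple itself, so the index determines the
triple. -/
theorem index_injOn {N : List (ℕ × ℕ × ℕ)} {x y : ℕ × ℕ × ℕ} (hx : x ∈ N) (hy : y ∈ N)
    (h : index N x = index N y) : x = y := by
  have key : ∀ z ∈ N, N[index N z]? = some z := by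
    intro z hz
    have h1 : index N z < N.length := List.findIdx_lt_length_of_exists ⟨z, hz, by simp⟩
    have h2 : (N[index N z] == z) = true := List.findIdx_getElem (w := h1)
    rw [List.getElem?_eq_getElem h1, eq_of_beq h2]
  have := key x hx
  rw [h, key y hy] at this
  exact (Option.some.inj this).symm

end AutCode

/-! ### The compiled lists describe the joint automaton. -/

namespace SoftSpannerRep

open Label WVSA

variable {Γ X : Type} {Q : SoftSpanner Γ X} (R : SoftSpannerRep Q)

/-- The automaton that is compiled from a representation of a soft spanner. -/
noncomputable abbrev joint : WVSA Γ Q.P.vars ℝ := softJoin R.autP R.aut Q.w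

open Classical in
/-- The states of the compiled automaton as triples of numbers. -/
noncomputable def stateCode (x : R.joint.Q) : ℕ × ℕ × ℕ :=
  (R.listP.name x.1, R.enum.idxOf x.2.1, (R.list x.2.1).name x.2.2)

theorem stateCode_injective : Function.Injective R.stateCode := by
  classical
  rintro ⟨p, S, s⟩ ⟨p', S', s'⟩ h
  simp only [stateCode, Prod.mk.injEq] at h
  obtain ⟨h1, h2, h3⟩ := h
  obtain rfl := R.listP.name_inj h1
  obtain rfl := (List.idxOf_inj (R.mem_enum S)).1 h2
  obtain rfl := (R.list S).name_inj h3
  rfl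

variable [Encodable Γ] [Encodable X]

/-- The representation as a tuple of lists. -/
def code : AutCode × List (AutCode × Val ℝ) :=
  (R.listP.code BoolSR.toVal, R.enum.map fun S => ((R.list S).code BoolSR.toVal, .wt (Q.w S)))

theorem enc_code : enc R.code = R.toVal := by
  simp only [toVal, ← Listing.enc_code]
  simp only [code, enc, Val.ofList_map]
  rfl

open Classical in
theorem mem_numbered {f : ℕ × AutCode × Val ℝ} : f ∈ AutCode.numbered R.code.2 ↔
    ∃ S, f = (R.enum.idxOf S, (R.list S).code BoolSR.toVal, .wt (Q.w S)) := by
  rw [AutCode.mem_numbered, code, List.getElem?_map, Option.map_eq_some_iff]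
  constructor
  · rintro ⟨S, h1, h2⟩
    refine ⟨S, Prod.ext ?_ h2.symm⟩
    obtain ⟨h3, rfl⟩ := List.getElem?_eq_some_iff.1 h1
    exact (R.enum_nodup.idxOf_getElem _ h3).symm
  · rintro ⟨S, rfl⟩
    exact ⟨S, by simp [List.getElem?_idxOf (R.mem_enum S)], rfl⟩

theorem mem_joinStates {y : ℕ × ℕ × ℕ} :
    y ∈ AutCode.joinStates R.code.1 (AutCode.numbered R.code.2) ↔ ∃ x, R.stateCode x = y := by
  simp only [AutCode.joinStates, List.mem_flatMap, R.mem_numbered, List.mem_map]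
  constructor
  · rintro ⟨p, hp, _, ⟨S, rfl⟩, s, hs, rfl⟩
    obtain ⟨p, rfl⟩ := R.listP.mem_code_states.1 hp
    obtain ⟨s, rfl⟩ := (R.list S).mem_code_states.1 hs
    exact ⟨(p, ⟨S, s⟩), rfl⟩
  · rintro ⟨⟨p, S, s⟩, rfl⟩
    exact ⟨_, R.listP.mem_code_states.2 ⟨p, rfl⟩, _, ⟨S, rfl⟩, _,
      (R.list S).mem_code_states.2 ⟨s, rfl⟩, rfl⟩

/-- The condition omits w(S) ≠ 0, since the machine cannot test a real number for zero. Entries of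
weight zero may therefore be listed, which a `Listing` permits. -/
theorem mem_joinInitial {y : (ℕ × ℕ × ℕ) × Val ℝ} :
    y ∈ AutCode.joinInitial R.code.1 (AutCode.numbered R.code.2) ↔
      ∃ x : R.joint.Q, (R.autP.init x.1 ≠ 0 ∧
        ∃ q, (R.aut x.2.1).init q ≠ 0 ∧ (R.aut x.2.1).Gap q x.2.2) ∧
        (R.stateCode x, Val.wt (R.joint.init x)) = y := by
  have e : ∀ x : R.joint.Q, (R.autP.init x.1 ≠ 0 ∧
      ∃ q, (R.aut x.2.1).init q ≠ 0 ∧ (R.aut x.2.1).Gap q x.2.2) →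
      R.joint.init x = Q.w x.2.1 := fun x h => if_pos h
  simp only [AutCode.joinInitial, List.mem_flatMap, R.mem_numbered, List.mem_map, List.mem_filter,
    List.any_eq_true]
  constructor
  · rintro ⟨p, hp, _, ⟨S, rfl⟩, s, ⟨hs, i, hi, hg⟩, rfl⟩
    obtain ⟨p, h1, rfl⟩ := (R.listP.mem_code_initial R.listP_exact).1 hp
    obtain ⟨s, rfl⟩ := (R.list S).mem_code_states.1 hs
    obtain ⟨q, h2, rfl⟩ := ((R.list S).mem_code_initial (R.list_exact S)).1 hi
    have h3 := ((R.list S).code_gap (R.list_exact S)).1 hg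
    exact ⟨(p, ⟨S, s⟩), ⟨h1, q, h2, h3⟩,
      Prod.ext rfl (congrArg Val.wt (e (p, ⟨S, s⟩) ⟨h1, q, h2, h3⟩))⟩
  · rintro ⟨⟨p, S, s⟩, ⟨h1, q, h2, h3⟩, rfl⟩
    rw [e (p, ⟨S, s⟩) ⟨h1, q, h2, h3⟩]
    exact ⟨_, (R.listP.mem_code_initial R.listP_exact).2 ⟨p, h1, rfl⟩, _, ⟨S, rfl⟩, _,
      ⟨(R.list S).mem_code_states.2 ⟨s, rfl⟩, _,
        ((R.list S).mem_code_initial (R.list_exact S)).2 ⟨q, h2, rfl⟩,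
        ((R.list S).code_gap (R.list_exact S)).2 h3⟩, rfl⟩

theorem mem_joinFinal {y : (ℕ × ℕ × ℕ) × Val ℝ} :
    y ∈ AutCode.joinFinal R.code.1 (AutCode.numbered R.code.2) ↔
      ∃ x : R.joint.Q, R.joint.final x ≠ 0 ∧
        (R.stateCode x, Val.wt (R.joint.final x)) = y := by
  simp only [AutCode.joinFinal, List.mem_flatMap, R.mem_numbered, List.mem_map, List.mem_filter]
  constructor
  · rintro ⟨p, hp, _, ⟨S, rfl⟩, s, ⟨hs, ha⟩, rfl⟩
    obtain ⟨p, h1, rfl⟩ := (R.listP.mem_code_final R.listP_exact).1 hp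
    obtain ⟨s, h2, rfl⟩ := ((R.list S).mem_code_final (R.list_exact S)).1 hs
    have h3 := (R.listP.code_agree R.listP_exact (R.list_exact S)).1 ha
    have h4 : R.joint.final (p, ⟨S, s⟩) ≠ 0 := softJoin_final_ne_zero.2 ⟨h1, h2, h3⟩
    refine ⟨(p, ⟨S, s⟩), h4, ?_⟩
    rw [softJoin_final_eq h4]
    rfl
  · rintro ⟨⟨p, S, s⟩, h, rfl⟩
    rw [softJoin_final_eq h]
    obtain ⟨h1, h2, h3⟩ := softJoin_final_ne_zero.1 h
    exact ⟨_, (R.listP.mem_code_final R.listP_exact).2 ⟨p, h1, rfl⟩, _, ⟨S, rfl⟩, _,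
      ⟨((R.list S).mem_code_final (R.list_exact S)).2 ⟨s, h2, rfl⟩,
        (R.listP.code_agree R.listP_exact (R.list_exact S)).2 h3⟩, rfl⟩

theorem code_factorStep {p p' : R.autP.Q} {o : Label Γ {x // x ∈ Q.P.vars}} {v : Val ℝ}
    {S : {S // S ∈ Q.factors}} {s s' : (R.aut S).Q} :
    AutCode.factorStep (R.listP.code BoolSR.toVal) ((R.list S).code BoolSR.toVal)
      (R.listP.name p, o.code, R.listP.name p', v) ((R.list S).name s) ((R.list S).name s') = true ↔
      FactorStep R.autP R.aut p o ⟨S, s⟩ ⟨S, s'⟩ := by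
  simp only [AutCode.factorStep, beq_iff_eq, code_fst_eq_zero]
  by_cases ho : o.letter?.isSome
  · obtain ⟨a, rfl⟩ : ∃ a, o = letter a := by cases o <;> simp_all [letter?]
    simp only [ho, if_true, Bool.and_eq_true, List.any_eq_true, beq_iff_eq]
    constructor
    · rintro ⟨ha, t, ht, ⟨h1, h2⟩, h3⟩
      obtain ⟨q, o', q', h4, rfl⟩ := ((R.list S).mem_code_trans (R.list_exact S)).1 ht
      obtain rfl := (R.list S).name_inj h1
      obtain rfl := code_letter_eq_iff.1 h2
      exact .move ((R.listP.code_agree R.listP_exact (R.list_exact S)).1 ha) h4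
        (((R.list S).code_gap (R.list_exact S)).1 h3)
    · intro h
      cases h with
      | stay h => simp [letter?] at h
      | move ha h4 h3 =>
        exact ⟨(R.listP.code_agree R.listP_exact (R.list_exact S)).2 ha, _,
          ((R.list S).mem_code_trans (R.list_exact S)).2 ⟨_, _, _, h4, rfl⟩,
          ⟨rfl, rfl⟩, ((R.list S).code_gap (R.list_exact S)).2 h3⟩
  · simp only [ho]
    rw [Option.not_isSome_iff_eq_none] at ho
    simp only [Bool.false_eq_true, if_false, beq_iff_eq]
    constructor
    · intro h
      rw [(R.list S).name_inj h]
      exact .stay ho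
    · intro h
      cases h with
      | stay => rfl
      | move => simp [letter?] at ho

theorem mem_joinTrans {y : (ℕ × ℕ × ℕ) × (ℕ × ℕ) × (ℕ × ℕ × ℕ) × Val ℝ} :
    y ∈ AutCode.joinTrans R.code.1 (AutCode.numbered R.code.2) ↔
      ∃ t : R.joint.Q × Label Γ {x // x ∈ Q.P.vars} × R.joint.Q,
        R.joint.δ t.1 t.2.1 t.2.2 ≠ 0 ∧ (R.stateCode t.1, t.2.1.code, R.stateCode t.2.2,
          Val.wt (R.joint.δ t.1 t.2.1 t.2.2)) = y := by
  simp only [AutCode.joinTrans, List.mem_flatMap, R.mem_numbered, List.mem_map, List.mem_filter]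
  constructor
  · rintro ⟨t, ht, _, ⟨S, rfl⟩, s, hs, s', ⟨hs', h⟩, rfl⟩
    obtain ⟨p, o, p', h1, rfl⟩ := (R.listP.mem_code_trans R.listP_exact).1 ht
    obtain ⟨s, rfl⟩ := (R.list S).mem_code_states.1 hs
    obtain ⟨s', rfl⟩ := (R.list S).mem_code_states.1 hs'
    have h2 : R.joint.δ (p, ⟨S, s⟩) o (p', ⟨S, s'⟩) ≠ 0 :=
      softJoin_δ_ne_zero.2 ⟨h1, R.code_factorStep.1 h⟩
    refine ⟨((p, ⟨S, s⟩), o, (p', ⟨S, s'⟩)), h2, ?_⟩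
    rw [softJoin_δ_eq h2]
    rfl
  · rintro ⟨⟨⟨p, S, s⟩, o, ⟨p', S', s'⟩⟩, h, rfl⟩
    rw [softJoin_δ_eq h]
    obtain ⟨h1, h2⟩ := softJoin_δ_ne_zero.1 h
    obtain rfl : S = S' := by cases h2 <;> rfl
    exact ⟨_, (R.listP.mem_code_trans R.listP_exact).2 ⟨p, o, p', h1, rfl⟩, _, ⟨S, rfl⟩, _,
      (R.list S).mem_code_states.2 ⟨s, rfl⟩, _, ⟨(R.list S).mem_code_states.2 ⟨s', rfl⟩,
        R.code_factorStep.2 h2⟩, rfl⟩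

/-! ### Absence of repetitions in the compiled lists. -/

theorem nodup_code_states {V : Finset X} {M : WVSA Γ V BoolSR} (L : Listing M) :
    (L.code BoolSR.toVal).states.Nodup := L.states_nodup.map L.name_inj

theorem nodup_code_initial {V : Finset X} {M : WVSA Γ V BoolSR} (L : Listing M) :
    ((L.code BoolSR.toVal).initial.map Prod.fst).Nodup := by
  simp only [Listing.code, AutCode.initial, List.map_map]
  exact L.initial_nodup.map L.name_inj

theorem nodup_code_final {V : Finset X} {M : WVSA Γ V BoolSR} (L : Listing M) :
    ((L.code BoolSR.toVal).final.map Prod.fst).Nodup := by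
  simp only [Listing.code, AutCode.final, List.map_map]
  exact L.final_nodup.map L.name_inj

theorem nodup_code_trans {V : Finset X} {M : WVSA Γ V BoolSR} (L : Listing M) :
    ((L.code BoolSR.toVal).trans.map fun t => (t.1, t.2.1, t.2.2.1)).Nodup := by
  simp only [Listing.code, AutCode.trans, List.map_map]
  refine L.trans_nodup.map fun t t' h => ?_
  simp only [Function.comp_apply, Prod.mk.injEq] at h
  exact Prod.ext (L.name_inj h.1) (Prod.ext (code_injective h.2.1) (L.name_inj h.2.2))

theorem nodup_joinStates :
    (AutCode.joinStates R.code.1 (AutCode.numbered R.code.2)).Nodup := by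
  refine Listing.nodup_flatMap_of_key id Prod.fst
    (by rw [List.map_id]; exact nodup_code_states R.listP) (fun p _ => ?_) ?_
  · refine Listing.nodup_flatMap_of_key Prod.fst (fun y => y.2.1) (AutCode.nodup_numbered _)
      (fun f hf => ?_) ?_
    · obtain ⟨S, rfl⟩ := R.mem_numbered.1 hf
      exact (nodup_code_states (R.list S)).map fun s s' h => by simpa using h
    · rintro f - y hy
      obtain ⟨s, -, rfl⟩ := List.mem_map.1 hy
      rfl
  · rintro p - y hy
    obtain ⟨f, -, hy⟩ := List.mem_flatMap.1 hy
    obtain ⟨s, -, rfl⟩ := List.mem_map.1 hy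
    rfl

theorem nodup_joinInitial :
    (AutCode.joinInitial R.code.1 (AutCode.numbered R.code.2)).Nodup := by
  refine Listing.nodup_flatMap_of_key Prod.fst (fun y => y.1.1)
    (nodup_code_initial R.listP) (fun p _ => ?_) ?_
  · refine Listing.nodup_flatMap_of_key Prod.fst (fun y => y.1.2.1) (AutCode.nodup_numbered _)
      (fun f hf => ?_) ?_
    · obtain ⟨S, rfl⟩ := R.mem_numbered.1 hf
      exact ((nodup_code_states (R.list S)).filter _).map fun s s' h => by simpa using h
    · rintro f - y hy
      obtain ⟨s, -, rfl⟩ := List.mem_map.1 hy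
      rfl
  · rintro p - y hy
    obtain ⟨f, -, hy⟩ := List.mem_flatMap.1 hy
    obtain ⟨s, -, rfl⟩ := List.mem_map.1 hy
    rfl

theorem nodup_joinFinal :
    (AutCode.joinFinal R.code.1 (AutCode.numbered R.code.2)).Nodup := by
  refine Listing.nodup_flatMap_of_key Prod.fst (fun y => y.1.1)
    (nodup_code_final R.listP) (fun p _ => ?_) ?_
  · refine Listing.nodup_flatMap_of_key Prod.fst (fun y => y.1.2.1) (AutCode.nodup_numbered _)
      (fun f hf => ?_) ?_
    · obtain ⟨S, rfl⟩ := R.mem_numbered.1 hf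
      refine List.Nodup.of_map (fun y => y.1.2.2) ?_
      rw [List.map_map]
      exact (List.Nodup.sublist (List.Sublist.map _ List.filter_sublist)
        (nodup_code_final (R.list S)))
    · rintro f - y hy
      obtain ⟨s, -, rfl⟩ := List.mem_map.1 hy
      rfl
  · rintro p - y hy
    obtain ⟨f, -, hy⟩ := List.mem_flatMap.1 hy
    obtain ⟨s, -, rfl⟩ := List.mem_map.1 hy
    rfl

theorem nodup_joinTrans :
    (AutCode.joinTrans R.code.1 (AutCode.numbered R.code.2)).Nodup := by
  refine Listing.nodup_flatMap_of_key (fun t => (t.1, t.2.1, t.2.2.1))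
    (fun y => (y.1.1, y.2.1, y.2.2.1.1)) (nodup_code_trans R.listP) (fun t _ => ?_) ?_
  · refine Listing.nodup_flatMap_of_key Prod.fst (fun y => y.1.2.1) (AutCode.nodup_numbered _)
      (fun f hf => ?_) ?_
    · obtain ⟨S, rfl⟩ := R.mem_numbered.1 hf
      refine Listing.nodup_flatMap_of_key id (fun y => y.1.2.2)
        (by rw [List.map_id]; exact nodup_code_states (R.list S)) (fun s _ => ?_) ?_
      · exact ((nodup_code_states (R.list S)).filter _).map fun s s' h => by simpa using h
      · rintro s - y hy
        obtain ⟨s', -, rfl⟩ := List.mem_map.1 hy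
        rfl
    · rintro f - y hy
      obtain ⟨s, -, hy⟩ := List.mem_flatMap.1 hy
      obtain ⟨s', -, rfl⟩ := List.mem_map.1 hy
      rfl
  · rintro t - y hy
    obtain ⟨f, -, hy⟩ := List.mem_flatMap.1 hy
    obtain ⟨s, -, hy⟩ := List.mem_flatMap.1 hy
    obtain ⟨s', -, rfl⟩ := List.mem_map.1 hy
    rfl

/-- The compiled lists consist of codes of states and transitions of the joint automaton. They can
be pulled back to lists of such objects; injectivity of the coding gives completeness, and the
absence of repetitions passes to the preimages. States are named by their index in the list of
triples. -/
theorem exists_listing : ∃ L : Listing R.joint, L.code Val.wt = AutCode.compile R.code := by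
  set N := AutCode.joinStates R.code.1 (AutCode.numbered R.code.2) with hN
  obtain ⟨l₁, h₁⟩ := Listing.exists_map_eq (f := R.stateCode) (l := N)
    fun y hy => R.mem_joinStates.1 hy
  obtain ⟨l₂, h₂⟩ := Listing.exists_map_eq (f := fun x => (R.stateCode x, Val.wt (R.joint.init x)))
    (l := AutCode.joinInitial R.code.1 (AutCode.numbered R.code.2)) fun y hy => by
      obtain ⟨x, -, h⟩ := R.mem_joinInitial.1 hy
      exact ⟨x, h⟩
  obtain ⟨l₃, h₃⟩ := Listing.exists_map_eq (f := fun x => (R.stateCode x, Val.wt (R.joint.final x)))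
    (l := AutCode.joinFinal R.code.1 (AutCode.numbered R.code.2)) fun y hy => by
      obtain ⟨x, -, h⟩ := R.mem_joinFinal.1 hy
      exact ⟨x, h⟩
  obtain ⟨l₄, h₄⟩ := Listing.exists_map_eq
    (f := fun t : R.joint.Q × Label Γ {x // x ∈ Q.P.vars} × R.joint.Q =>
      (R.stateCode t.1, t.2.1.code, R.stateCode t.2.2, Val.wt (R.joint.δ t.1 t.2.1 t.2.2)))
    (l := AutCode.joinTrans R.code.1 (AutCode.numbered R.code.2)) fun y hy => by
      obtain ⟨x, -, h⟩ := R.mem_joinTrans.1 hy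
      exact ⟨x, h⟩
  have inj2 : ∀ w : R.joint.Q → Val ℝ, Function.Injective fun x => (R.stateCode x, w x) :=
    fun w x y h => R.stateCode_injective (Prod.mk.inj h).1
  have inj4 : Function.Injective
      fun t : R.joint.Q × Label Γ {x // x ∈ Q.P.vars} × R.joint.Q =>
        (R.stateCode t.1, t.2.1.code, R.stateCode t.2.2,
          Val.wt (R.joint.δ t.1 t.2.1 t.2.2)) := by
    intro t t' h
    simp only [Prod.mk.injEq] at h
    exact Prod.ext (R.stateCode_injective h.1)
      (Prod.ext (code_injective h.2.1) (R.stateCode_injective h.2.2.1))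
  refine ⟨{
    name := fun x => AutCode.index N (R.stateCode x)
    name_inj := fun x y h => R.stateCode_injective
      (AutCode.index_injOn (R.mem_joinStates.2 ⟨x, rfl⟩) (R.mem_joinStates.2 ⟨y, rfl⟩) h)
    vars := R.listP.vars
    vars_nodup := R.listP.vars_nodup
    mem_vars := R.listP.mem_vars
    states := l₁
    states_nodup := List.Nodup.of_map R.stateCode (by rw [h₁]; exact R.nodup_joinStates)
    mem_states := fun x => (List.mem_map_of_injective R.stateCode_injective).1
      (by rw [h₁]; exact R.mem_joinStates.2 ⟨x, rfl⟩)
    initial := l₂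
    initial_nodup := List.Nodup.of_map _ (by rw [h₂]; exact R.nodup_joinInitial)
    mem_initial := fun x hx => (List.mem_map_of_injective (inj2 _)).1
      (by rw [h₂]; exact R.mem_joinInitial.2 ⟨x, (softJoin_init_ne_zero.1 hx).1, rfl⟩)
    final := l₃
    final_nodup := List.Nodup.of_map _ (by rw [h₃]; exact R.nodup_joinFinal)
    mem_final := fun x hx => (List.mem_map_of_injective (inj2 _)).1
      (by rw [h₃]; exact R.mem_joinFinal.2 ⟨x, hx, rfl⟩)
    trans := l₄
    trans_nodup := List.Nodup.of_map _ (by rw [h₄]; exact R.nodup_joinTrans)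
    mem_trans := fun x o y h => (List.mem_map_of_injective inj4).1
      (by rw [h₄]; exact R.mem_joinTrans.2 ⟨(x, o, y), h, rfl⟩) }, ?_⟩
  simp only [Listing.code, AutCode.compile, ← hN, ← h₁, ← h₂, ← h₃, ← h₄, List.map_map]
  rfl

/-! ### Size of the input and the final program. -/

theorem size_code_le {V : Finset X} {M : WVSA Γ V BoolSR} (L : Listing M) (hL : L.Exact) :
    Coded.size (L.code BoolSR.toVal) ≤ 10 * M.size + 9 := by
  have key : ∀ {α β : Type} [Coded β] (f : α → β) (k : ℕ) (l : List α), (∀ x, Coded.size (f x) = k) →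
      Coded.size (l.map f) = l.length * (k + 1) + 1 := by
    intro α β _ f k l h
    induction l with
    | nil => simp
    | cons x l ih => simp only [List.map_cons, size_cons, ih, h, List.length_cons]; ring
  have card : ∀ l : List M.Q, l.Nodup → l.length ≤ Nat.card M.Q := by
    intro l hl
    have := Fintype.ofFinite M.Q
    rw [Nat.card_eq_fintype_card]
    exact hl.length_le_card
  have h1 := card _ L.states_nodup
  have h2 := card _ L.initial_nodup
  have h3 := card _ L.final_nodup
  have h4 : L.trans.length ≤
      {e : M.Q × Label Γ {x // x ∈ V} × M.Q | M.δ e.1 e.2.1 e.2.2 ≠ 0}.ncard := by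
    classical
    rw [← List.toFinset_card_of_nodup L.trans_nodup, ← Set.ncard_coe_finset]
    refine le_of_eq (congrArg Set.ncard (Set.ext fun e => ?_))
    simp only [List.coe_toFinset, Set.mem_ofPred_eq]
    exact ⟨fun h => hL.2.2 e h, fun h => L.mem_trans _ _ _ h⟩
  simp only [Listing.code, size_prod, size_val]
  -- A list cell adds 1 to its entry. A state thus costs at most 2 + 4 + 4 in its three lists and a
  -- transition 10; the constant 9 comes from the variable list, the four list ends and the four
  -- pairs.
  rw [key _ 1 L.states fun _ => rfl, key _ 3 L.initial fun _ => rfl, key _ 3 L.final fun _ => rfl,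
    key _ 9 L.trans fun _ => rfl]
  simp only [WVSA.size]
  omega

/-- A factor adds its weight, a pair and a list cell to its code, in total at most 10·s + 12 ≤ 12·(s
+ 1) for size s. This is where the summand |𝔖| in the measure is needed. -/
theorem size_code_le_size : Coded.size R.code ≤ 12 * R.size + 11 := by
  have h1 := size_code_le R.listP R.listP_exact
  have h2 : ∀ l : List {S // S ∈ Q.factors},
      Coded.size (l.map fun S => ((R.list S).code BoolSR.toVal, (Val.wt (Q.w S) : Val ℝ))) ≤
        12 * (l.map fun S => (R.aut S).size + 1).sum + 1 := by
    intro l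
    induction l with
    | nil => simp
    | cons S l ih =>
      have := size_code_le (R.list S) (R.list_exact S)
      rw [List.map_cons, List.map_cons, size_cons, List.sum_cons, size_prod, size_val]
      dsimp only
      omega
  have h3 : ∑ S : {S // S ∈ Q.factors}, ((R.aut S).size + 1) =
      (R.enum.map fun S => (R.aut S).size + 1).sum := by
    classical
    rw [← List.sum_toFinset _ R.enum_nodup]
    refine Finset.sum_congr (Finset.ext fun S => ?_) fun _ _ => rfl
    simp [R.mem_enum S]
  have h4 := h2 R.enum
  rw [code, size_prod, SoftSpannerRep.size, h3]
  dsimp only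
  omega

end SoftSpannerRep

/-- Soft spanners given by unambiguous functional automata are compiled in polynomial time. -/
theorem exists_compile_program {Γ X : Type} [Finite Γ] [Encodable Γ] [Encodable X] :
    ∃ (prog : Program) (p : Polynomial ℕ),
      ∀ (Q : SoftSpanner Γ X) (R : SoftSpannerRep Q),
        ∃ (A : WVSA Γ Q.P.vars ℝ) (L : Listing A) (n : ℕ),
          Q.CompiledBy A ∧
          prog.Outputs R.toVal (L.toVal Val.wt) n ∧
          n ≤ p.eval R.size ∧
          L.length ≤ p.eval R.size := by
  obtain ⟨P, i, p, h1, h2⟩ := PolyTime.compile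
  -- Execution starts with function 0, so a jump to the compiling function is put in front and all
  -- indices move by 1. The two calls and their two argument reads are the 4 extra steps.
  set start : Expr := .call (i + 1) (.var 0)
  have h3 : Program.Computes (start :: P.map (Expr.shift 1)) (i + 1) AutCode.compile p := by
    refine h1.shift (fun f body hf => ?_) fun n => le_rfl
    rw [List.getElem?_cons_succ, List.getElem?_map, hf]
    rfl
  refine ⟨start :: P.map (Expr.shift 1),
    p.comp (12 * Polynomial.X + 11) + 4, fun Q R => ?_⟩
  obtain ⟨L, hL⟩ := R.exists_listing
  obtain ⟨n, hn, hr⟩ := h3.call (x := R.code) (env := [enc R.code]) (e := .var 0) (.var rfl)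
  have hp := p.eval_mono_nat R.size_code_le_size
  have hs := h2 R.code
  have heval : (p.comp (12 * Polynomial.X + 11) + 4).eval R.size =
      p.eval (12 * R.size + 11) + 4 := by simp
  refine ⟨R.joint, L, 1 + n + 1, Q.compiledBy_softJoin R.autP_functional R.autP_unambiguous
    R.autP_represents R.aut_functional R.aut_unambiguous R.aut_represents, ?_, ?_, ?_⟩
  · rw [← R.enc_code, ← Listing.enc_code, hL]
    exact .call (.var rfl) rfl hr
  · rw [heval]; omega
  -- The output has polynomially bounded size, and a list is shorter than its size; this bounds the
  -- listed states and transitions together.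
  · have h4 : L.states.length < size (L.code Val.wt).states := by
      have e : (L.code Val.wt).states.length = L.states.length := List.length_map _
      rw [← e]; exact length_lt_size _
    have h5 : L.trans.length < size (L.code Val.wt).trans := by
      have e : (L.code Val.wt).trans.length = L.trans.length := List.length_map _
      rw [← e]; exact length_lt_size _
    have h6 : size (L.code Val.wt).states + size (L.code Val.wt).trans ≤ size (L.code Val.wt) := by
      generalize L.code Val.wt = M
      obtain ⟨a, b, c, d, e⟩ := M
      show size b + size e ≤ _
      simp only [size_prod]; omega
    rw [hL] at h4 h5 h6
    rw [heval, Listing.length]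
    omega

end Compile

theorem mainTheorem9 {Γ X : Type} [Finite Γ] :
    (∀ Q : SoftSpanner Γ X, Q.P.Regular → (∀ S ∈ Q.factors, S.Regular) →
      ∃ A : WVSA Γ Q.P.vars ℝ, Q.CompiledBy A) ∧
    (∀ [Encodable Γ] [Encodable X],
      ∃ (prog : Program) (p : Polynomial ℕ),
        ∀ (Q : SoftSpanner Γ X) (R : SoftSpannerRep Q),
          ∃ (A : WVSA Γ Q.P.vars ℝ) (L : Listing A) (n : ℕ),
            Q.CompiledBy A ∧
            prog.Outputs R.toVal (L.toVal Val.wt) n ∧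
            n ≤ p.eval R.size ∧
            L.length ≤ p.eval R.size) :=
  ⟨fun Q hP hS => Q.exists_compiledBy hP hS, exists_compile_program⟩
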